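/- Let $\mathfrak g$ be a finite-dimensional complex simple Lie algebra with a Cartan subalgebra $\mathfrak h$, simple roots $\alpha_1,\dots,\alpha_r$, fundamental weights $\omega_1,\dots,\omega_r$, integral weight lattice $\mathcal P$, Cartan matrix $(a_{ij})$, and let $(\cdot,\cdot)$ be a positive multiple of the form on $\mathfrak h^*$ induced by the Killing form, so that $(\alpha_i,\alpha_j)=d_ia_{ij}$ with $d_i=(\alpha_i,\alpha_i)/2>0$. Fix $t$ such that the maximal standard parabolic subalgebra $\mathfrak p=\mathfrak l\oplus\mathfrak u_+$ obtained by omitting $\alpha_t$ is of cominuscule type, i.e. its nilradical $\mathfrak u_+$ is abelian, and let $\mathfrak u_-$ be the opposite nilradical. Let $q>1$ be real and let $U_q(\mathfrak g)$ be the quantized enveloping algebra with generators $E_j,F_j$ ($1\le j\le r$) and $K_\lambda$ ($\lambda\in\mathcal P$), $K_j:=K_{\alpha_j}$, with the Hopf structure in which the $K_\lambda$ are grouplike, $\Delta(E_j)=E_j\otimes1+K_j\otimes E_j$, $\Delta(F_j)=F_j\otimes K_j^{-1}+1\otimes F_j$, and with the $*$-structure $E_j^*=K_jF_j$, $F_j^*=E_jK_j^{-1}$,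 $K_\lambda^*=K_\lambda$. Let $U_q(\mathfrak l)$ be the Hopf $*$-subalgebra generated by all $K_\lambda$ and the $E_j,F_j$ with $j\ne t$. Denote again by $\mathfrak u_\pm$ the finite-dimensional irreducible type 1 $U_q(\mathfrak l)$-modules with the same highest weights (in $\mathcal P$) as the $\mathfrak l$-modules $\mathfrak u_\pm$, and fix a nondegenerate $U_q(\mathfrak l)$-invariant pairing $\langle\cdot,\cdot\rangle:\mathfrak u_-\otimes\mathfrak u_+\to\mathbb C$. For $V=\mathfrak u_\pm$ let $\widehat R:V\otimes V\to V\otimes V$ be the standard braiding, i.e. the $U_q(\mathfrak l)$-module map such that $\widehat R(v\otimes w)=q^{(\mathrm{wt}(v),\mathrm{wt}(w))}w\otimes v+\sum_i w_i\otimes v_i$ with $\mathrm{wt}(w_i)\succ\mathrm{wt}(w)$, $\mathrm{wt}(v_i)\prec\mathrm{wt}(v)$ for all weight vectors $v,w$. Let $\sigma=\sigma_{V,V}$ be the commutor, i.e. the unitary part of the polar decomposition $\widehat R=\sigma(\widehat R^*\widehat R)^{1/2}$ with respect to the inner product on $V\otimes V$ induced by a $U_q(\mathfrak l)$-invariant inner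 product on $V$. Put $\Lambda_q(V)=T(V)/\langle\ker(\sigma-\mathrm{id})\rangle$, with graded components $\Lambda_q^n(V)$, and let $\Lambda_q^nV=\bigcap_{i=1}^{n-1}\ker(\sigma_i+\mathrm{id})\subseteq V^{\otimes n}$ be the space of quantum antisymmetric tensors, where $\sigma_i$ is $\sigma$ acting in the tensor factors $i,i+1$. Then for every $n\ge0$ the restrictions $\pi^n_\pm:\Lambda_q^n\mathfrak u_\pm\to\Lambda_q^n(\mathfrak u_\pm)$ of the quotient maps $\mathfrak u_\pm^{\otimes n}\to\Lambda_q^n(\mathfrak u_\pm)$ are bijective, and the action of $U_q(\mathfrak l)$ on $\mathfrak u_\pm^{\otimes n}$ descends to $\Lambda_q^n(\mathfrak u_\pm)$. Let $\langle\cdot,\cdot\rangle:\mathfrak u_-^{\otimes n}\otimes\mathfrak u_+^{\otimes n}\to\mathbb C$ be the pairing $$\langle y_1\otimes\cdots\otimes y_n,\;x_1\otimes\cdots\otimes x_n\rangle=\prod_{i=1}^n\langle y_i,x_{n+1-i}\rangle ,$$ and define a pairing $\Lambda_q^n(\mathfrak u_-)\otimes\Lambda_q^n(\mathfrak u_+)\to\mathbb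 C$ by $$\langle y,x\rangle:=\langle(\pi^n_-)^{-1}(y),(\pi^n_+)^{-1}(x)\rangle .$$ This pairing is nondegenerate and $U_q(\mathfrak l)$-invariant, and hence $y\mapsto\langle y,\cdot\rangle$ is an isomorphism of $U_q(\mathfrak l)$-modules $\Lambda_q^n(\mathfrak u_-)\cong\Lambda_q^n(\mathfrak u_+)^*$. -/

import Mathlib

open scoped TensorProduct

namespace QuantumNilradical

noncomputable section

/-! ### The quantized enveloping algebra

`I` indexes the simple roots, `a` is the Cartan matrix `a i j = ⟨α_j, α_i^∨⟩`, and `d` is a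
symmetrizer, `(α_i, α_j) = d i * a i j`. An integral weight `λ` is given by its coordinates
`λ i = ⟨λ, α_i^∨⟩` in the basis of fundamental weights. -/

/-- The integral weight lattice, in coordinates with respect to the fundamental weights. -/
abbrev Weight (I : Type*) : Type _ := I → ℤ

/-- The simple root `α_j` as an integral weight. -/
def simpleRoot {I : Type*} (a : Matrix I I ℤ) (j : I) : Weight I := fun i => a i j

open scoped Classical in
/-- The symmetric form on weights. It is determined by `(ω_i, α_j) = δ_{ij} d_i`, that is,
`(ω_i, ω_j) = d_i (a⁻¹)_{ij}`. -/
def weightForm {I : Type*} [Fintype I] (a : Matrix I I ℤ) (d : I → ℝ) (μ ν : Weight I) : ℝ :=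
  ∑ i, ∑ j, d i * (a.map (Int.cast : ℤ → ℝ))⁻¹ i j * μ i * ν j

/-- `q_i = q ^ d_i`. -/
def qi {I : Type*} (d : I → ℝ) (q : ℝ) (i : I) : ℝ := q ^ d i

/-- The quantum integer `[n] = (Q^n - Q^{-n}) / (Q - Q^{-1})`. -/
def qInt (Q : ℝ) (n : ℕ) : ℝ := (Q ^ n - (Q ^ n)⁻¹) / (Q - Q⁻¹)

/-- The quantum factorial. -/
def qFactorial (Q : ℝ) (n : ℕ) : ℝ := ∏ k ∈ Finset.range n, qInt Q (k + 1)

/-- The quantum binomial coefficient (for `s ≤ m`). -/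
def qBinom (Q : ℝ) (m s : ℕ) : ℝ := qFactorial Q m / (qFactorial Q s * qFactorial Q (m - s))

/-- The generators of the quantized enveloping algebra. -/
inductive Gen (I : Type*) : Type _
  | E (i : I) : Gen I
  | F (i : I) : Gen I
  | K (l : Weight I) : Gen I

/-- The free algebra on the generators. -/
abbrev Free (I : Type*) : Type _ := FreeAlgebra ℂ (Gen I)

/-- The generator `E_i` in the free algebra. -/
def fE {I : Type*} (i : I) : Free I := FreeAlgebra.ι ℂ (Gen.E i)

/-- The generator `F_i` in the free algebra. -/
def fF {I : Type*} (i : I) : Free I := FreeAlgebra.ι ℂ (Gen.F i)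

/-- The generator `K_l` in the free algebra. -/
def fK {I : Type*} (l : Weight I) : Free I := FreeAlgebra.ι ℂ (Gen.K l)

/-- The quantum Serre expression
`∑_{s=0}^{1-a_{ij}} (-1)^s [1-a_{ij} choose s]_{q_i} x^{1-a_{ij}-s} y x^s`. -/
def serre {I : Type*} (a : Matrix I I ℤ) (d : I → ℝ) (q : ℝ) (i j : I) (x y : Free I) : Free I :=
  ∑ s ∈ Finset.range ((1 - a i j).toNat + 1),
    ((((-1) ^ s * qBinom (qi d q i) (1 - a i j).toNat s : ℝ)) : ℂ) •
      (x ^ ((1 - a i j).toNat - s) * y * x ^ s)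

/-- The defining relations of the quantized enveloping algebra, with a torus element `K_l` for
every integral weight `l`. Note `(l, α_i) = d_i l_i`, so that `q ^ (l, α_i) = q_i ^ (l_i)`. -/
inductive Rel {I : Type*} (a : Matrix I I ℤ) (d : I → ℝ) (q : ℝ) : Free I → Free I → Prop
  | K_zero : Rel a d q (fK 0) 1
  | K_mul (l m : Weight I) : Rel a d q (fK l * fK m) (fK (l + m))
  | K_E (l : Weight I) (i : I) :
      Rel a d q (fK l * fE i * fK (-l)) (((qi d q i ^ l i : ℝ) : ℂ) • fE i)
  | K_F (l : Weight I) (i : I) :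
      Rel a d q (fK l * fF i * fK (-l)) (((qi d q i ^ (-l i) : ℝ) : ℂ) • fF i)
  | E_F_same (i : I) :
      Rel a d q (fE i * fF i - fF i * fE i)
        ((((qi d q i - (qi d q i)⁻¹)⁻¹ : ℝ) : ℂ) • (fK (simpleRoot a i) - fK (-simpleRoot a i)))
  | E_F_ne (i j : I) (hij : i ≠ j) : Rel a d q (fE i * fF j - fF j * fE i) 0
  | serre_E (i j : I) (hij : i ≠ j) : Rel a d q (serre a d q i j (fE i) (fE j)) 0
  | serre_F (i j : I) (hij : i ≠ j) : Rel a d q (serre a d q i j (fF i) (fF j)) 0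

/-- The quantized enveloping algebra `U_q(𝔤)`, weight lattice form. -/
abbrev Uq {I : Type*} (a : Matrix I I ℤ) (d : I → ℝ) (q : ℝ) : Type _ := RingQuot (Rel a d q)

section Levi

variable {I : Type*} (a : Matrix I I ℤ) (d : I → ℝ) (q : ℝ) (t : I)

/-- The canonical projection from the free algebra. -/
def toUq : Free I →ₐ[ℂ] Uq a d q := RingQuot.mkAlgHom ℂ (Rel a d q)

/-- The subalgebra `U_q(𝔩)` of `U_q(𝔤)` generated by all `K_l` and by the `E_j`, `F_j` with
`j ≠ t`. -/
def UqLevi : Subalgebra ℂ (Uq a d q) :=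
  Algebra.adjoin ℂ
    (Set.range (fun l : Weight I => toUq a d q (fK l)) ∪
      Set.range (fun j : {j : I // j ≠ t} => toUq a d q (fE j.1)) ∪
      Set.range (fun j : {j : I // j ≠ t} => toUq a d q (fF j.1)))

/-- `K_l` as an element of `U_q(𝔩)`. -/
def leviK (l : Weight I) : UqLevi a d q t :=
  ⟨toUq a d q (fK l), Algebra.subset_adjoin (Or.inl (Or.inl ⟨l, rfl⟩))⟩

/-- `E_j`, `j ≠ t`, as an element of `U_q(𝔩)`. -/
def leviE (j : {j : I // j ≠ t}) : UqLevi a d q t :=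
  ⟨toUq a d q (fE j.1), Algebra.subset_adjoin (Or.inl (Or.inr ⟨j, rfl⟩))⟩

/-- `F_j`, `j ≠ t`, as an element of `U_q(𝔩)`. -/
def leviF (j : {j : I // j ≠ t}) : UqLevi a d q t :=
  ⟨toUq a d q (fF j.1), Algebra.subset_adjoin (Or.inr ⟨j, rfl⟩)⟩

end Levi

/-! ### Actions of the generators of `U_q(𝔩)`

The algebra `U_q(𝔩)` is generated by the `K_l` and the `E_j`, `F_j`, so module maps, invariant
pairings, tensor products and duals are all determined by what the generators do. On generators the
Hopf structure is
`Δ(K_l) = K_l ⊗ K_l`, `Δ(E_j) = E_j ⊗ 1 + K_j ⊗ E_j`, `Δ(F_j) = F_j ⊗ K_j⁻¹ + 1 ⊗ F_j`,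
`ε(K_l) = 1`, `ε(E_j) = ε(F_j) = 0`,
`S(K_l) = K_{-l}`, `S(E_j) = -K_j⁻¹ E_j`, `S(F_j) = -F_j K_j`. -/

/-- The operators by which the generators of `U_q(𝔩)` act on a space `W`. -/
structure GenAction {I : Type*} (t : I) (W : Type*) [AddCommGroup W] [Module ℂ W] where
  K : Weight I → Module.End ℂ W
  E : {j : I // j ≠ t} → Module.End ℂ W
  F : {j : I // j ≠ t} → Module.End ℂ W

/-- The action of the generators on a `U_q(𝔩)`-module. -/
def genAction {I : Type*} (a : Matrix I I ℤ) (d : I → ℝ) (q : ℝ) (t : I) (V : Type*)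
    [AddCommGroup V] [Module ℂ V] [Module (UqLevi a d q t) V]
    [IsScalarTower ℂ (UqLevi a d q t) V] : GenAction t V where
  K l := Algebra.lsmul ℂ ℂ V (leviK a d q t l)
  E j := Algebra.lsmul ℂ ℂ V (leviE a d q t j)
  F j := Algebra.lsmul ℂ ℂ V (leviF a d q t j)

namespace GenAction

variable {I : Type*} {t : I} {V W : Type*} [AddCommGroup V] [Module ℂ V] [AddCommGroup W]
  [Module ℂ W]

/-- A linear map that commutes with the action of the generators. -/
def IsHom (X : GenAction t V) (Y : GenAction t W) (f : V →ₗ[ℂ] W) : Prop :=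
  (∀ l v, f (X.K l v) = Y.K l (f v)) ∧
  (∀ j v, f (X.E j v) = Y.E j (f v)) ∧
  (∀ j v, f (X.F j v) = Y.F j (f v))

/-- A pairing `B` with `B(x₍₁₎ v, x₍₂₎ w) = ε(x) B(v, w)` for all generators `x`. -/
def IsInvariantPairing (a : Matrix I I ℤ) (X : GenAction t V) (Y : GenAction t W)
    (B : V →ₗ[ℂ] W →ₗ[ℂ] ℂ) : Prop :=
  (∀ l v w, B (X.K l v) (Y.K l w) = B v w) ∧
  (∀ j v w, B (X.E j v) w + B (X.K (simpleRoot a j.1) v) (Y.E j w) = 0) ∧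
  (∀ j v w, B (X.F j v) (Y.K (-simpleRoot a j.1) w) + B v (Y.F j w) = 0)

/-- The action on the dual space, `(x f)(v) = f(S(x) v)`. -/
def dual (a : Matrix I I ℤ) (X : GenAction t V) : GenAction t (Module.Dual ℂ V) where
  K l := (X.K (-l)).dualMap
  E j := (-(X.K (-simpleRoot a j.1) * X.E j)).dualMap
  F j := (-(X.F j * X.K (simpleRoot a j.1))).dualMap

/-- The action on a tensor product of two modules. -/
def tensor (a : Matrix I I ℤ) (X : GenAction t V) (Y : GenAction t W) :
    GenAction t (V ⊗[ℂ] W) where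
  K l := TensorProduct.map (X.K l) (Y.K l)
  E j := TensorProduct.map (X.E j) LinearMap.id +
    TensorProduct.map (X.K (simpleRoot a j.1)) (Y.E j)
  F j := TensorProduct.map (X.F j) (Y.K (-simpleRoot a j.1)) +
    TensorProduct.map LinearMap.id (Y.F j)

/-- The action on the `n`-th tensor power, through the iterated coproduct:
`E_j` acts by `∑ K_j ⊗ ⋯ ⊗ K_j ⊗ E_j ⊗ 1 ⊗ ⋯ ⊗ 1` and
`F_j` acts by `∑ 1 ⊗ ⋯ ⊗ 1 ⊗ F_j ⊗ K_j⁻¹ ⊗ ⋯ ⊗ K_j⁻¹`. -/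
def tensorPower (a : Matrix I I ℤ) (X : GenAction t V) (n : ℕ) : GenAction t (⨂[ℂ]^n V) where
  K l := PiTensorProduct.map (fun _ => X.K l)
  E j := ∑ k : Fin n, PiTensorProduct.map (fun i =>
    if i < k then X.K (simpleRoot a j.1) else if i = k then X.E j else LinearMap.id)
  F j := ∑ k : Fin n, PiTensorProduct.map (fun i =>
    if i < k then LinearMap.id else if i = k then X.F j else X.K (-simpleRoot a j.1))

variable [Fintype I]

/-- The space of vectors of weight `μ`: `K_l` acts as `q ^ (l, μ)`. -/
def weightSpace (a : Matrix I I ℤ) (d : I → ℝ) (q : ℝ) (X : GenAction t V) (μ : Weight I) :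
    Submodule ℂ V :=
  ⨅ l : Weight I, LinearMap.ker (X.K l - ((q ^ weightForm a d l μ : ℝ) : ℂ) • LinearMap.id)

/-- The strict order on weights of `U_q(𝔩)`: `ν - μ` is a nonzero sum of simple roots `α_j`,
`j ≠ t`. -/
def WeightLT (a : Matrix I I ℤ) (t : I) (μ ν : Weight I) : Prop :=
  ∃ c : I → ℕ, c t = 0 ∧ c ≠ 0 ∧ ν = μ + ∑ j, (c j : ℤ) • simpleRoot a j

/-- `R` is the standard braiding of `V` with itself: the module map with
`R (v ⊗ w) = q ^ (wt v, wt w) w ⊗ v + ∑ wᵢ ⊗ vᵢ`, where `wt wᵢ` is higher than `wt w` and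
`wt vᵢ` is lower than `wt v`. -/
def IsBraiding (a : Matrix I I ℤ) (d : I → ℝ) (q : ℝ) (X : GenAction t V)
    (R : V ⊗[ℂ] V →ₗ[ℂ] V ⊗[ℂ] V) : Prop :=
  IsHom (X.tensor a X) (X.tensor a X) R ∧
  ∀ (μ ν : Weight I) (v w : V), v ∈ X.weightSpace a d q μ → w ∈ X.weightSpace a d q ν →
    R (v ⊗ₜ[ℂ] w) - ((q ^ weightForm a d μ ν : ℝ) : ℂ) • (w ⊗ₜ[ℂ] v) ∈
      Submodule.span ℂ {z : V ⊗[ℂ] V | ∃ (μ' ν' : Weight I) (v' w' : V),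
        v' ∈ X.weightSpace a d q μ' ∧ w' ∈ X.weightSpace a d q ν' ∧
        WeightLT a t μ' μ ∧ WeightLT a t ν ν' ∧ z = w' ⊗ₜ[ℂ] v'}

/-- `h` is a positive-definite Hermitian inner product, conjugate-linear in the first variable,
that is invariant, `h (x v) w = h v (x* w)`, for the compact real form
`E_j* = K_j F_j`, `F_j* = E_j K_j⁻¹`, `K_l* = K_l`. -/
def IsInvariantInner (a : Matrix I I ℤ) (X : GenAction t V) (h : V →ₗ⋆[ℂ] V →ₗ[ℂ] ℂ) : Prop :=
  (∀ v w, h w v = starRingEnd ℂ (h v w)) ∧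
  (∀ v, v ≠ 0 → 0 < (h v v).re) ∧
  (∀ l v w, h (X.K l v) w = h v (X.K l w)) ∧
  (∀ j v w, h (X.E j v) w = h v (X.K (simpleRoot a j.1) (X.F j w))) ∧
  (∀ j v w, h (X.F j v) w = h v (X.E j (X.K (-simpleRoot a j.1) w)))

/-- `s` is the commutor of `V` with itself: the unitary part in the polar decomposition
`R = s (R* R)^{1/2}` of the braiding `R`, with respect to the inner product `h₂` on `V ⊗ V` induced
by an invariant inner product `h` on `V`. The factor `P = (R* R)^{1/2}` is the positive operator
for which `R = s P` with `s` unitary. -/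
def IsCommutor (a : Matrix I I ℤ) (d : I → ℝ) (q : ℝ) (X : GenAction t V)
    (s : V ⊗[ℂ] V →ₗ[ℂ] V ⊗[ℂ] V) : Prop :=
  ∃ (h : V →ₗ⋆[ℂ] V →ₗ[ℂ] ℂ) (h₂ : V ⊗[ℂ] V →ₗ⋆[ℂ] V ⊗[ℂ] V →ₗ[ℂ] ℂ)
    (R P : V ⊗[ℂ] V →ₗ[ℂ] V ⊗[ℂ] V),
    X.IsInvariantInner a h ∧
    (∀ v w v' w', h₂ (v ⊗ₜ[ℂ] w) (v' ⊗ₜ[ℂ] w') = h v v' * h w w') ∧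
    X.IsBraiding a d q R ∧
    (∀ x y, h₂ (P x) y = h₂ x (P y)) ∧ (∀ x, 0 ≤ (h₂ x (P x)).re) ∧
    (Function.Surjective s ∧ ∀ x y, h₂ (s x) (s y) = h₂ x y) ∧
    R = s ∘ₗ P

open scoped Classical in
/-- The commutor `σ_{V,V}`. For a finite-dimensional simple module of type 1 over `U_q(𝔩)` it
exists and is unique (rescaling the inner product does not change it), so the default value plays
no role there. -/
def commutor (a : Matrix I I ℤ) (d : I → ℝ) (q : ℝ) (X : GenAction t V) :
    V ⊗[ℂ] V →ₗ[ℂ] V ⊗[ℂ] V :=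
  if h : ∃ s, X.IsCommutor a d q s then h.choose else LinearMap.id

end GenAction

/-- The commutor `σ_{V,V}` of a `U_q(𝔩)`-module `V`. -/
def moduleCommutor {I : Type*} [Fintype I] (a : Matrix I I ℤ) (d : I → ℝ) (q : ℝ) (t : I)
    (V : Type*) [AddCommGroup V] [Module ℂ V] [Module (UqLevi a d q t) V]
    [IsScalarTower ℂ (UqLevi a d q t) V] : V ⊗[ℂ] V →ₗ[ℂ] V ⊗[ℂ] V :=
  (genAction a d q t V).commutor a d q

/-! ### Antisymmetric tensors and the quantum exterior algebra -/

section Exterior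

variable {V : Type*} [AddCommGroup V] [Module ℂ V]

/-- Replace the entries number `i` and `i + 1` of `v₀ ⊗ ⋯ ⊗ v_{n-1}` by a given tensor. -/
def insertPair (n i : ℕ) (hi : i + 1 < n) (v : Fin n → V) : V ⊗[ℂ] V →ₗ[ℂ] ⨂[ℂ]^n V :=
  TensorProduct.lift (LinearMap.mk₂ ℂ
    (fun x y => PiTensorProduct.tprod ℂ
      (Function.update (Function.update v ⟨i, by omega⟩ x) ⟨i + 1, hi⟩ y))
    (by
      intro x x' y
      have hne : (⟨i, by omega⟩ : Fin n) ≠ ⟨i + 1, hi⟩ := by simp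
      simp only [Function.update_comm hne, MultilinearMap.map_update_add])
    (by
      intro c x y
      have hne : (⟨i, by omega⟩ : Fin n) ≠ ⟨i + 1, hi⟩ := by simp
      simp only [Function.update_comm hne, MultilinearMap.map_update_smul])
    (by intro x y y'; simp only [MultilinearMap.map_update_add])
    (by intro c x y; simp only [MultilinearMap.map_update_smul]))

theorem insertPair_tmul (n i : ℕ) (hi : i + 1 < n) (v : Fin n → V) (x y : V) :
    insertPair n i hi v (x ⊗ₜ[ℂ] y) = PiTensorProduct.tprod ℂ
      (Function.update (Function.update v ⟨i, by omega⟩ x) ⟨i + 1, hi⟩ y) := by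
  simp [insertPair]

theorem insertPair_update_left (n i : ℕ) (hi : i + 1 < n) (v : Fin n → V) (x : V) :
    insertPair n i hi (Function.update v ⟨i, by omega⟩ x) = insertPair n i hi v := by
  ext y z
  simp [insertPair_tmul]

theorem insertPair_update_right (n i : ℕ) (hi : i + 1 < n) (v : Fin n → V) (x : V) :
    insertPair n i hi (Function.update v ⟨i + 1, hi⟩ x) = insertPair n i hi v := by
  have hne : (⟨i + 1, hi⟩ : Fin n) ≠ ⟨i, by omega⟩ := by simp
  ext y z
  simp [insertPair_tmul, Function.update_comm hne]

theorem insertPair_update_of_ne (n i : ℕ) (hi : i + 1 < n) (v : Fin n → V) (k : Fin n)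
    (h₁ : k ≠ ⟨i, by omega⟩) (h₂ : k ≠ ⟨i + 1, hi⟩) (x y z : V) :
    insertPair n i hi (Function.update v k x) (y ⊗ₜ[ℂ] z) = PiTensorProduct.tprod ℂ
      (Function.update (Function.update (Function.update v ⟨i, by omega⟩ y) ⟨i + 1, hi⟩ z) k x) := by
  rw [insertPair_tmul, Function.update_comm h₁, Function.update_comm h₂]

/-- The operator `s_i` on `V^{⊗ n}` that is `s` in the neighbouring tensor factors number `i` and
`i + 1` (counted from `0`) and the identity in all others. -/
def adjacentOp (s : V ⊗[ℂ] V →ₗ[ℂ] V ⊗[ℂ] V) (n i : ℕ) (hi : i + 1 < n) :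
    ⨂[ℂ]^n V →ₗ[ℂ] ⨂[ℂ]^n V :=
  PiTensorProduct.lift
    { toFun := fun v => insertPair n i hi v (s (v ⟨i, by omega⟩ ⊗ₜ[ℂ] v ⟨i + 1, hi⟩))
      map_update_add' := by
        intro inst v k x y
        obtain rfl : inst = instDecidableEqFin n := Subsingleton.elim _ _
        have hne : (⟨i, by omega⟩ : Fin n) ≠ ⟨i + 1, hi⟩ := by simp
        by_cases h₁ : k = ⟨i, by omega⟩
        · subst h₁
          simp [insertPair_update_left, TensorProduct.add_tmul]
        by_cases h₂ : k = ⟨i + 1, hi⟩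
        · subst h₂
          simp [insertPair_update_right, TensorProduct.tmul_add]
        rw [Function.update_of_ne (Ne.symm h₁), Function.update_of_ne (Ne.symm h₂),
          Function.update_of_ne (Ne.symm h₁), Function.update_of_ne (Ne.symm h₂),
          Function.update_of_ne (Ne.symm h₁), Function.update_of_ne (Ne.symm h₂),
          ← LinearMap.add_apply]
        congr 1
        ext a b
        simp [insertPair_update_of_ne n i hi v k h₁ h₂, MultilinearMap.map_update_add]
      map_update_smul' := by
        intro inst v k c x
        obtain rfl : inst = instDecidableEqFin n := Subsingleton.elim _ _
        have hne : (⟨i, by omega⟩ : Fin n) ≠ ⟨i + 1, hi⟩ := by simp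
        by_cases h₁ : k = ⟨i, by omega⟩
        · subst h₁
          simp [insertPair_update_left, ← TensorProduct.smul_tmul']
        by_cases h₂ : k = ⟨i + 1, hi⟩
        · subst h₂
          simp [insertPair_update_right]
        rw [Function.update_of_ne (Ne.symm h₁), Function.update_of_ne (Ne.symm h₂),
          Function.update_of_ne (Ne.symm h₁), Function.update_of_ne (Ne.symm h₂),
          ← LinearMap.smul_apply]
        congr 1
        ext a b
        simp [insertPair_update_of_ne n i hi v k h₁ h₂, MultilinearMap.map_update_smul] }

theorem adjacentOp_tprod (s : V ⊗[ℂ] V →ₗ[ℂ] V ⊗[ℂ] V) (n i : ℕ) (hi : i + 1 < n)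
    (v : Fin n → V) :
    adjacentOp s n i hi (PiTensorProduct.tprod ℂ v) =
      insertPair n i hi v (s (v ⟨i, by omega⟩ ⊗ₜ[ℂ] v ⟨i + 1, hi⟩)) := by
  simp [adjacentOp]

/-- The space `Λ_q^n V ⊆ V^{⊗ n}` of quantum antisymmetric tensors, for the commutor `s`. -/
def antisymTensors (s : V ⊗[ℂ] V →ₗ[ℂ] V ⊗[ℂ] V) (n : ℕ) : Submodule ℂ (⨂[ℂ]^n V) :=
  ⨅ (i : ℕ) (hi : i + 1 < n), LinearMap.ker (adjacentOp s n i hi + LinearMap.id)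

/-- The inclusion of `V ⊗ V` in the tensor algebra. -/
def tensorSquareToAlgebra : V ⊗[ℂ] V →ₗ[ℂ] TensorAlgebra ℂ V :=
  TensorProduct.lift
    ((LinearMap.mul ℂ (TensorAlgebra ℂ V)).compl₁₂ (TensorAlgebra.ι ℂ) (TensorAlgebra.ι ℂ))

/-- The relations `z = 0`, `z ∈ ker (s - id)`, of the quantum exterior algebra. -/
def ExtRel (s : V ⊗[ℂ] V →ₗ[ℂ] V ⊗[ℂ] V) (x y : TensorAlgebra ℂ V) : Prop :=
  ∃ z ∈ LinearMap.ker (s - LinearMap.id), x = tensorSquareToAlgebra z ∧ y = 0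

/-- The quantum exterior algebra `Λ_q(V) = T(V) / ⟨ker (s - id)⟩`, for the commutor `s`. -/
abbrev QExt (s : V ⊗[ℂ] V →ₗ[ℂ] V ⊗[ℂ] V) : Type _ := RingQuot (ExtRel s)

/-- The quotient map `T(V) → Λ_q(V)`. -/
def toQExt (s : V ⊗[ℂ] V →ₗ[ℂ] V ⊗[ℂ] V) : TensorAlgebra ℂ V →ₐ[ℂ] QExt s :=
  RingQuot.mkAlgHom ℂ (ExtRel s)

/-- The graded component `Λ_q^n(V)`, spanned by the products of `n` elements of `V`. -/
def QExtPow (s : V ⊗[ℂ] V →ₗ[ℂ] V ⊗[ℂ] V) (n : ℕ) : Submodule ℂ (QExt s) :=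
  LinearMap.range ((toQExt s).toLinearMap ∘ₗ TensorAlgebra.ι ℂ) ^ n

theorem list_prod_mem_pow {A : Type*} [Ring A] [Algebra ℂ A] (M : Submodule ℂ A) (l : List A)
    (hl : ∀ x ∈ l, x ∈ M) : l.prod ∈ M ^ l.length := by
  induction l with
  | nil => simp [Submodule.one_eq_span, Submodule.mem_span_singleton_self]
  | cons x l ih =>
    rw [List.prod_cons, List.length_cons, pow_succ']
    exact Submodule.mul_mem_mul (hl x (by simp)) (ih fun y hy => hl y (by simp [hy]))

theorem toQExt_mem (s : V ⊗[ℂ] V →ₗ[ℂ] V ⊗[ℂ] V) (n : ℕ) (x : ⨂[ℂ]^n V) :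
    toQExt s (TensorPower.toTensorAlgebra x) ∈ QExtPow s n := by
  induction x using PiTensorProduct.induction_on with
  | smul_tprod c v =>
    rw [map_smul, map_smul]
    refine Submodule.smul_mem _ _ ?_
    rw [TensorPower.toTensorAlgebra_tprod, TensorAlgebra.tprod_apply, map_list_prod]
    have h := list_prod_mem_pow (LinearMap.range ((toQExt s).toLinearMap ∘ₗ TensorAlgebra.ι ℂ))
      (List.map (toQExt s) (List.ofFn fun i => TensorAlgebra.ι ℂ (v i))) (by
        intro y hy
        obtain ⟨z, hz, rfl⟩ := List.mem_map.1 hy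
        obtain ⟨i, rfl⟩ := (List.mem_ofFn' _ _).1 hz
        exact ⟨v i, rfl⟩)
    simpa [QExtPow] using h
  | add x y hx hy =>
    rw [map_add, map_add]
    exact Submodule.add_mem _ hx hy

/-- The quotient map `V^{⊗ n} → Λ_q^n(V)`. -/
def tensorToExt (s : V ⊗[ℂ] V →ₗ[ℂ] V ⊗[ℂ] V) (n : ℕ) : ⨂[ℂ]^n V →ₗ[ℂ] QExtPow s n :=
  ((toQExt s).toLinearMap ∘ₗ TensorPower.toTensorAlgebra).codRestrict (QExtPow s n)
    (toQExt_mem s n)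

/-- The restriction `π^n : Λ_q^n V → Λ_q^n(V)` of the quotient map to antisymmetric tensors. -/
def antisymToExt (s : V ⊗[ℂ] V →ₗ[ℂ] V ⊗[ℂ] V) (n : ℕ) :
    antisymTensors s n →ₗ[ℂ] QExtPow s n :=
  (tensorToExt s n).domRestrict (antisymTensors s n)

variable {W : Type*} [AddCommGroup W] [Module ℂ W]

/-- The pairing of tensor powers induced by a pairing `B`, with the order of factors reversed:
`⟨y₁ ⊗ ⋯ ⊗ yₙ, x₁ ⊗ ⋯ ⊗ xₙ⟩ = ⟨y₁, xₙ⟩ ⋯ ⟨yₙ, x₁⟩`. -/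
def tensorPairing (B : W →ₗ[ℂ] V →ₗ[ℂ] ℂ) (n : ℕ) : ⨂[ℂ]^n W →ₗ[ℂ] ⨂[ℂ]^n V →ₗ[ℂ] ℂ :=
  (LinearMap.dualMap
      (PiTensorProduct.reindex ℂ (fun _ : Fin n => V) Fin.revPerm).toLinearMap) ∘ₗ
    TensorPower.pairingDual ℂ V n ∘ₗ PiTensorProduct.map (fun _ => B)

theorem tensorPairing_tprod (B : W →ₗ[ℂ] V →ₗ[ℂ] ℂ) (n : ℕ) (y : Fin n → W) (x : Fin n → V) :
    tensorPairing B n (PiTensorProduct.tprod ℂ y) (PiTensorProduct.tprod ℂ x) =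
      ∏ i, B (y i) (x i.rev) := by
  simp [tensorPairing, PiTensorProduct.map_tprod, PiTensorProduct.reindex_tprod]

/-- The pairing `⟨y, x⟩ = ⟨(π₋^n)⁻¹ y, (π₊^n)⁻¹ x⟩` of `Λ_q^n(W)` with `Λ_q^n(V)`. -/
def extPairing (B : W →ₗ[ℂ] V →ₗ[ℂ] ℂ) (s' : W ⊗[ℂ] W →ₗ[ℂ] W ⊗[ℂ] W)
    (s : V ⊗[ℂ] V →ₗ[ℂ] V ⊗[ℂ] V) (n : ℕ) (h' : Function.Bijective (antisymToExt s' n))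
    (h : Function.Bijective (antisymToExt s n)) :
    QExtPow s' n →ₗ[ℂ] QExtPow s n →ₗ[ℂ] ℂ :=
  (tensorPairing B n).compl₁₂
    ((antisymTensors s' n).subtype ∘ₗ (LinearEquiv.ofBijective _ h').symm.toLinearMap)
    ((antisymTensors s n).subtype ∘ₗ (LinearEquiv.ofBijective _ h).symm.toLinearMap)

end Exterior

/-! ### The parabolic subalgebra and its quantized nilradical -/

section Parabolic

open LieAlgebra LieAlgebra.IsKilling

variable {𝔤 : Type*} [LieRing 𝔤] [LieAlgebra ℂ 𝔤] [FiniteDimensional ℂ 𝔤] [IsSimple ℂ 𝔤]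
  {H : LieSubalgebra ℂ 𝔤} [H.IsCartanSubalgebra] (b : (rootSystem H).Base)

/-- The Cartan matrix `a i j = ⟨α_j, α_i^∨⟩ = 2 (α_i, α_j) / (α_i, α_i)` (the transpose of
Mathlib's `RootPairing.Base.cartanMatrix`). -/
def cartan : Matrix b.support b.support ℤ := b.cartanMatrix.transpose

/-- A root as an integral weight, in coordinates with respect to the fundamental weights. -/
def rootWeight (α : H.root) : Weight b.support := fun i => (rootSystem H).pairingIn ℤ α i

/-- The set `Δ(𝔲₊)` of positive roots that are not in the span of the simple roots other than
`α_t`. -/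
def radicalRoots (t : b.support) : Set H.root :=
  {α | b.IsPos α ∧ (rootSystem H).root α ∉
    Submodule.span ℂ ((rootSystem H).root '' {j | j ∈ b.support ∧ j ≠ t.1})}

/-- The set `Δ(𝔲₋) = -Δ(𝔲₊)`. -/
def negRadicalRoots (t : b.support) : Set H.root :=
  {α | ∃ β ∈ radicalRoots b t, (rootSystem H).root α = -(rootSystem H).root β}

/-- The nilradical `𝔲₊`, the sum of the root spaces for the roots in `Δ(𝔲₊)`. -/
def nilradical (t : b.support) : Submodule ℂ 𝔤 :=
  ⨆ α ∈ radicalRoots b t, (rootSpace H (α.1 : H → ℂ)).toSubmodule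

/-- The maximal standard parabolic subalgebra that omits `α_t` is of cominuscule type: its
nilradical is abelian. -/
def IsCominuscule (t : b.support) : Prop :=
  ∀ x ∈ nilradical b t, ∀ y ∈ nilradical b t, ⁅x, y⁆ = 0

/-- `α` is the highest weight of the sum of the root spaces for the roots in `Φ`, as an
`𝔩`-module. -/
def IsHighestRoot (t : b.support) (Φ : Set H.root) (α : H.root) : Prop :=
  α ∈ Φ ∧ ∀ j : b.support, j ≠ t → ∀ β ∈ Φ,
    (rootSystem H).root β ≠ (rootSystem H).root α + (rootSystem H).root j.1

/-- `V` is the finite-dimensional irreducible (type 1) `U_q(𝔩)`-module with the same highest weight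
as the `𝔩`-module with the set `Φ` of weights. -/
def IsQuantization (d : b.support → ℝ) (q : ℝ) (t : b.support) (Φ : Set H.root) (V : Type*)
    [AddCommGroup V] [Module ℂ V] [Module (UqLevi (cartan b) d q t) V]
    [IsScalarTower ℂ (UqLevi (cartan b) d q t) V] : Prop :=
  FiniteDimensional ℂ V ∧ IsSimpleModule (UqLevi (cartan b) d q t) V ∧
  ∃ α, IsHighestRoot b t Φ α ∧ ∃ v : V, v ≠ 0 ∧
    v ∈ (genAction (cartan b) d q t V).weightSpace (cartan b) d q (rootWeight b α) ∧
    ∀ j, (genAction (cartan b) d q t V).E j v = 0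

end Parabolic

end

end QuantumNilradical

namespace QuantumNilradical

open scoped TensorProduct

noncomputable section

/-! ### Weights -/

/-! The key fact is that the commutor `σ` is the sign of the braiding `R`. Let `v` be a lowest
weight vector of an irreducible `V`. No weight lies below that of `v`, so `R (v ⊗ w)` has no
correction terms and is a scalar multiple of `w ⊗ v`; and the vectors `v ⊗ w` generate `V ⊗ V` as a
module (`IsStable.eq_top_of_left`). Identities compatible with the action may therefore be checked
on them. In this way `R` is seen to be self-adjoint (`IsBraiding.selfAdjoint`), and the braidings of
`𝔲₋` and `𝔲₊` are seen to be transposes of each other under the order-reversing pairing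
(`IsBraiding.pairingSq_apply`). The range of `R` contains `V ⊗ v`, so `R` is also surjective. Thus
`R` is diagonalizable with nonzero real eigenvalues, `(R* R)^{1/2} = |R|`, and `σ = sign R`
(`IsCommutor.exists_isSignOf`). Hence `σ` is a self-adjoint involution and a module map, and the
commutors of `𝔲₋` and `𝔲₊` are transposes of each other.

The degree `n` part of the ideal of relations is `∑ ker (σ_i - 1)` (`ker_tensorToExt`). As the `σ_i`
are self-adjoint involutions on `V^{⊗ n}`, the orthogonal complement of this sum is `⋂ ker (σ_i +
1)`, the space of antisymmetric tensors (`isCompl_antisymTensors`). This gives the bijectivity of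
`π^n`; the braid relation plays no role. Reversing the order of the factors makes the pairing of
tensor powers invariant for the iterated coproduct, and makes each `σ_i` on one side the transpose
of a `σ_j` on the other. So antisymmetric tensors on either side annihilate the relations on the
other, and the nondegenerate pairing of tensor powers stays nondegenerate on antisymmetric tensors
(`extPairing_nondegenerate`).

Since `commutor` is a choice with a default value, a commutor must also be shown to exist. The
braiding is built by extending `w ↦ K_μ w ⊗ v`, the value prescribed at a lowest weight vector `v`
of weight `μ`, to a homomorphism from `V` to the linear maps `V → V ⊗ V`
(`IsRep.exists_isHom_tensorLowest`). An invariant inner product comes from an explicit unitary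
representation on the span of the root vectors (`IsAbelianRootSet.isModel`), carried over to the
irreducible module of the same highest weight (`IsRep.exists_isInvariantInner`); only here is the
nilradical required to be abelian. Both extensions arise in the same way: a pair of extremal vectors
generates a stable subspace of a product, and this subspace is shown to be the graph of a
homomorphism. The quantum Serre relations are never needed. -/

/-- The facts about the weight form that the representation theory uses. -/
structure IsDatum {I : Type*} [Fintype I] (a : Matrix I I ℤ) (d : I → ℝ) (q : ℝ) : Prop where
  form_simpleRoot : ∀ l j, weightForm a d l (simpleRoot a j) = d j * l j
  form_comm : ∀ μ ν, weightForm a d μ ν = weightForm a d ν μ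
  d_pos : ∀ i, 0 < d i
  one_lt : 1 < q

section Form

variable {I : Type*} [Fintype I] (a : Matrix I I ℤ) (d : I → ℝ) (q : ℝ)

theorem weightForm_add_right (l μ ν : Weight I) :
    weightForm a d l (μ + ν) = weightForm a d l μ + weightForm a d l ν := by
  simp [weightForm, mul_add, Finset.sum_add_distrib]

theorem weightForm_add_left (l μ ν : Weight I) :
    weightForm a d (μ + ν) l = weightForm a d μ l + weightForm a d ν l := by
  simp [weightForm, mul_add, add_mul, Finset.sum_add_distrib]

theorem weightForm_neg_right (l μ : Weight I) : weightForm a d l (-μ) = -weightForm a d l μ := by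
  simp [weightForm]

theorem weightForm_neg_left (l μ : Weight I) : weightForm a d (-l) μ = -weightForm a d l μ := by
  simp [weightForm]

theorem weightForm_zero_left (μ : Weight I) : weightForm a d 0 μ = 0 := by
  simp [weightForm]

theorem weightForm_zero_right (μ : Weight I) : weightForm a d μ 0 = 0 := by
  simp [weightForm]

/-- The scalar `q ^ (l, μ)` by which `K_l` acts on vectors of weight `μ`. -/
def qchar (l μ : Weight I) : ℂ := ((q ^ weightForm a d l μ : ℝ) : ℂ)

end Form

section Char

variable {I : Type*} [Fintype I] {a : Matrix I I ℤ} {d : I → ℝ} {q : ℝ} (D : IsDatum a d q)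
include D

theorem IsDatum.q_pos : 0 < q := lt_trans one_pos D.one_lt

theorem qchar_ne_zero (l μ : Weight I) : qchar a d q l μ ≠ 0 := by
  simpa [qchar] using (Real.rpow_pos_of_pos D.q_pos _).ne'

theorem qchar_add_right (l μ ν : Weight I) :
    qchar a d q l (μ + ν) = qchar a d q l μ * qchar a d q l ν := by
  rw [qchar, weightForm_add_right, Real.rpow_add D.q_pos, Complex.ofReal_mul]; rfl

theorem qchar_add_left (l m μ : Weight I) :
    qchar a d q (l + m) μ = qchar a d q l μ * qchar a d q m μ := by
  rw [qchar, weightForm_add_left, Real.rpow_add D.q_pos, Complex.ofReal_mul]; rfl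

omit D in
theorem qchar_zero_left (μ : Weight I) : qchar a d q 0 μ = 1 := by
  simp [qchar, weightForm_zero_left]

theorem qchar_comm (l μ : Weight I) : qchar a d q l μ = qchar a d q μ l := by
  rw [qchar, D.form_comm]; rfl

theorem qchar_neg_right (l μ : Weight I) : qchar a d q l (-μ) = (qchar a d q l μ)⁻¹ := by
  rw [qchar, weightForm_neg_right, Real.rpow_neg D.q_pos.le, Complex.ofReal_inv]; rfl

theorem qchar_neg_left (l μ : Weight I) : qchar a d q (-l) μ = (qchar a d q l μ)⁻¹ := by
  rw [qchar, weightForm_neg_left, Real.rpow_neg D.q_pos.le, Complex.ofReal_inv]; rfl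

theorem qchar_simpleRoot (l : Weight I) (j : I) :
    qchar a d q l (simpleRoot a j) = ((qi d q j ^ l j : ℝ) : ℂ) := by
  rw [qchar, D.form_simpleRoot, qi, Real.rpow_mul D.q_pos.le, Real.rpow_intCast]

/-- Taking `l` to be a simple root `α_j` recovers `d_j μ_j`, because `q ≠ 1` makes the exponent
visible. -/
theorem qchar_injective {μ ν : Weight I} (h : ∀ l, qchar a d q l μ = qchar a d q l ν) : μ = ν := by
  funext j
  have h1 := h (simpleRoot a j)
  rw [qchar, qchar, Complex.ofReal_inj] at h1
  have h2 := (Real.strictMono_rpow_of_base_gt_one D.one_lt).injective h1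
  rw [D.form_comm, D.form_comm _ ν, D.form_simpleRoot, D.form_simpleRoot] at h2
  exact_mod_cast mul_left_cancel₀ (D.d_pos j).ne' h2

/-- The weight with all coordinates `1` is `ρ`, and `(ρ, α_j) = d_j > 0`. Pairing with `ρ` thus
turns the partial order of weights into an order on real numbers. -/
theorem weightForm_lt_of_weightLT {t : I} {μ ν : Weight I} (h : GenAction.WeightLT a t μ ν) :
    weightForm a d (fun _ => 1) μ < weightForm a d (fun _ => 1) ν := by
  obtain ⟨c, -, hc, rfl⟩ := h
  have key : ∀ s : Finset I, weightForm a d (fun _ => 1) (∑ j ∈ s, (c j : ℤ) • simpleRoot a j) =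
      ∑ j ∈ s, (c j : ℝ) * d j := by
    classical
    intro s
    induction s using Finset.induction_on with
    | empty => simp [weightForm_zero_right]
    | insert j s hj ih =>
      rw [Finset.sum_insert hj, Finset.sum_insert hj, weightForm_add_right, ih]
      congr 1
      have : ∀ n : ℕ, weightForm a d (fun _ => 1) ((n : ℤ) • simpleRoot a j) = n * d j := by
        intro n
        induction n with
        | zero => simp [weightForm_zero_right]
        | succ n ih =>
          push_cast
          rw [add_smul, one_smul, weightForm_add_right, ih, D.form_simpleRoot]
          push_cast
          ring
      exact this (c j)
  rw [weightForm_add_right, key]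
  obtain ⟨j, hj⟩ := Function.ne_iff.1 hc
  have : 0 < ∑ j, (c j : ℝ) * d j := by
    refine Finset.sum_pos' (fun i _ => mul_nonneg (Nat.cast_nonneg _) (D.d_pos i).le)
      ⟨j, Finset.mem_univ j, mul_pos ?_ (D.d_pos j)⟩
    exact_mod_cast Nat.pos_of_ne_zero hj
  linarith

end Char

theorem weightLT_of_add_simpleRoot {I : Type*} [Fintype I] (a : Matrix I I ℤ) {t j : I}
    (hj : j ≠ t) (μ : Weight I) : GenAction.WeightLT a t μ (μ + simpleRoot a j) := by
  classical
  refine ⟨Pi.single j 1, by simp [hj.symm], fun h => by simpa using congrFun h j, ?_⟩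
  congr 1
  rw [Finset.sum_eq_single j] <;> simp +contextual

theorem WeightLT.trans {I : Type*} [Fintype I] {a : Matrix I I ℤ} {t : I} {μ ν κ : Weight I}
    (h : GenAction.WeightLT a t μ ν) (h' : GenAction.WeightLT a t ν κ) :
    GenAction.WeightLT a t μ κ := by
  obtain ⟨c, hc, hc0, rfl⟩ := h
  obtain ⟨c', hc', hc0', rfl⟩ := h'
  refine ⟨c + c', by simp [hc, hc'], fun h => hc0 ?_, ?_⟩
  · funext j
    have := congrFun h j
    simp only [Pi.add_apply, Pi.zero_apply] at this ⊢
    omega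
  · simp [add_smul, Finset.sum_add_distrib, add_assoc]

/-! ### Representations by generators -/

namespace GenAction

variable {I : Type*} {t : I} {V W : Type*} [AddCommGroup V] [Module ℂ V] [AddCommGroup W]
  [Module ℂ W]

/-- A subspace that is stable under the generators. -/
structure IsStable (X : GenAction t V) (N : Submodule ℂ V) : Prop where
  K : ∀ l, ∀ v ∈ N, X.K l v ∈ N
  E : ∀ j, ∀ v ∈ N, X.E j v ∈ N
  F : ∀ j, ∀ v ∈ N, X.F j v ∈ N

/-- The action is irreducible. -/
structure IsIrr (X : GenAction t V) : Prop where
  nontrivial : Nontrivial V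
  eq_bot_or_eq_top : ∀ N, X.IsStable N → N = ⊥ ∨ N = ⊤

theorem IsIrr.eq_top {X : GenAction t V} (hX : X.IsIrr) {N : Submodule ℂ V} (hN : X.IsStable N)
    {v : V} (hv : v ∈ N) (hv0 : v ≠ 0) : N = ⊤ := by
  rcases hX.eq_bot_or_eq_top N hN with h | h
  · subst h
    exact absurd ((Submodule.mem_bot ℂ).1 hv) hv0
  · exact h

variable [Fintype I]

/-- The relations of `U_q(𝔩)` between the `K_l`, `E_j` and `F_j`, the Serre relations excepted. -/
structure IsRep (a : Matrix I I ℤ) (d : I → ℝ) (q : ℝ) (X : GenAction t V) : Prop where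
  K_zero : X.K 0 = 1
  K_add : ∀ l m, X.K (l + m) = X.K l * X.K m
  K_E : ∀ l j, X.K l * X.E j = qchar a d q l (simpleRoot a j.1) • (X.E j * X.K l)
  K_F : ∀ l j, X.K l * X.F j = qchar a d q l (-simpleRoot a j.1) • (X.F j * X.K l)
  E_F_same : ∀ j, X.E j * X.F j - X.F j * X.E j =
    (((qi d q j.1 - (qi d q j.1)⁻¹)⁻¹ : ℝ) : ℂ) •
      (X.K (simpleRoot a j.1) - X.K (-simpleRoot a j.1))
  E_F_ne : ∀ i j, i ≠ j → X.E i * X.F j - X.F j * X.E i = 0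

variable {a : Matrix I I ℤ} {d : I → ℝ} {q : ℝ} {X : GenAction t V}

theorem mem_weightSpace {μ : Weight I} {v : V} :
    v ∈ X.weightSpace a d q μ ↔ ∀ l, X.K l v = qchar a d q l μ • v := by
  simp [weightSpace, qchar, sub_eq_zero]

namespace IsRep

variable (hX : X.IsRep a d q)
include hX

theorem K_neg_K (l : Weight I) (v : V) : X.K (-l) (X.K l v) = v := by
  have := hX.K_add (-l) l
  rw [neg_add_cancel, hX.K_zero] at this
  exact (LinearMap.congr_fun this v).symm

theorem K_K_neg (l : Weight I) (v : V) : X.K l (X.K (-l) v) = v := by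
  simpa using hX.K_neg_K (-l) v

theorem K_E_apply (l j) (v : V) :
    X.K l (X.E j v) = qchar a d q l (simpleRoot a j.1) • X.E j (X.K l v) :=
  LinearMap.congr_fun (hX.K_E l j) v

theorem K_F_apply (l j) (v : V) :
    X.K l (X.F j v) = qchar a d q l (-simpleRoot a j.1) • X.F j (X.K l v) :=
  LinearMap.congr_fun (hX.K_F l j) v

theorem E_mem (D : IsDatum a d q) {μ : Weight I} {v : V} (hv : v ∈ X.weightSpace a d q μ) (j) :
    X.E j v ∈ X.weightSpace a d q (μ + simpleRoot a j.1) := by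
  rw [mem_weightSpace] at hv ⊢
  intro l
  rw [hX.K_E_apply, hv, map_smul, smul_smul, qchar_add_right D, mul_comm]

theorem F_mem (D : IsDatum a d q) {μ : Weight I} {v : V} (hv : v ∈ X.weightSpace a d q μ) (j) :
    X.F j v ∈ X.weightSpace a d q (μ - simpleRoot a j.1) := by
  rw [mem_weightSpace] at hv ⊢
  intro l
  rw [hX.K_F_apply, hv, map_smul, smul_smul, sub_eq_add_neg, qchar_add_right D, mul_comm]

/-- The sum of the weight spaces is stable under the generators, so irreducibility makes one nonzero
weight vector enough. -/
theorem iSup_weightSpace_eq_top (D : IsDatum a d q) (hirr : X.IsIrr) {μ : Weight I} {v : V}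
    (hv : v ∈ X.weightSpace a d q μ) (hv0 : v ≠ 0) : ⨆ ν, X.weightSpace a d q ν = ⊤ := by
  refine hirr.eq_top (v := v) ⟨fun l => ?_, fun j => ?_, fun j => ?_⟩
    (Submodule.mem_iSup_of_mem μ hv) hv0
  · suffices h : (⨆ ν, X.weightSpace a d q ν) ≤ Submodule.comap (X.K l) (⨆ ν, X.weightSpace a d q ν) from h
    refine iSup_le fun ν w hw => Submodule.mem_iSup_of_mem ν ?_
    rw [mem_weightSpace.1 hw l]
    exact Submodule.smul_mem _ _ hw
  · suffices h : (⨆ ν, X.weightSpace a d q ν) ≤ Submodule.comap (X.E j) (⨆ ν, X.weightSpace a d q ν) from h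
    exact iSup_le fun ν w hw => Submodule.mem_iSup_of_mem _ (hX.E_mem D hw j)
  · suffices h : (⨆ ν, X.weightSpace a d q ν) ≤ Submodule.comap (X.F j) (⨆ ν, X.weightSpace a d q ν) from h
    exact iSup_le fun ν w hw => Submodule.mem_iSup_of_mem _ (hX.F_mem D hw j)

end IsRep

/-- To prove a statement for all vectors it is enough to treat weight vectors. -/
theorem forall_mem_of_weight (hspan : ⨆ ν, X.weightSpace a d q ν = ⊤) {N : Submodule ℂ V}
    (h : ∀ μ, ∀ v ∈ X.weightSpace a d q μ, v ∈ N) (v : V) : v ∈ N := by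
  have : (⊤ : Submodule ℂ V) ≤ N := hspan ▸ iSup_le h
  exact this trivial

/-- `v` is a nonzero weight vector of weight `μ`, and no weight is lower than `μ`. -/
structure IsLowest (a : Matrix I I ℤ) (d : I → ℝ) (q : ℝ) (X : GenAction t V) (μ : Weight I)
    (v : V) : Prop where
  mem : v ∈ X.weightSpace a d q μ
  ne_zero : v ≠ 0
  eq_bot : ∀ ν, WeightLT a t ν μ → X.weightSpace a d q ν = ⊥

/-- Minimize `(ρ, μ)` over the weights. Only finitely many values occur, because `q ^ (ρ, μ)` is an
eigenvalue of `K_ρ` on a finite-dimensional space. -/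
theorem exists_isLowest (D : IsDatum a d q) [FiniteDimensional ℂ V] [Nontrivial V]
    (hspan : ⨆ ν, X.weightSpace a d q ν = ⊤) : ∃ μ v, X.IsLowest a d q μ v := by
  set S : Set ℝ := {x | ∃ μ, X.weightSpace a d q μ ≠ ⊥ ∧ weightForm a d (fun _ => 1) μ = x}
  have hfin : S.Finite := by
    refine Set.Finite.of_finite_image (f := fun x : ℝ => ((q ^ x : ℝ) : ℂ)) ?_ ?_
    · refine (Module.End.finite_hasEigenvalue (X.K fun _ => 1)).subset ?_
      rintro _ ⟨_, ⟨μ, hμ, rfl⟩, rfl⟩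
      obtain ⟨v, hv, hv0⟩ := Submodule.exists_mem_ne_zero_of_ne_bot hμ
      exact Module.End.hasEigenvalue_of_hasEigenvector
        (Module.End.hasEigenvector_iff.2 ⟨Module.End.mem_eigenspace_iff.2
          (mem_weightSpace.1 hv _), hv0⟩)
    · intro x _ y _ hxy
      exact (Real.strictMono_rpow_of_base_gt_one D.one_lt).injective (Complex.ofReal_inj.1 hxy)
  have hne : S.Nonempty := by
    by_contra hS
    have : ∀ ν, X.weightSpace a d q ν = ⊥ := fun ν => by
      by_contra h
      exact hS ⟨_, ν, h, rfl⟩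
    simp only [this, iSup_bot] at hspan
    exact bot_ne_top hspan
  obtain ⟨x, ⟨μ, hμ, rfl⟩, hmin⟩ := Set.exists_min_image S id hfin hne
  obtain ⟨v, hv, hv0⟩ := Submodule.exists_mem_ne_zero_of_ne_bot hμ
  refine ⟨μ, v, hv, hv0, fun ν hν => ?_⟩
  by_contra h
  exact absurd (hmin _ ⟨ν, h, rfl⟩) (not_le.2 (weightForm_lt_of_weightLT D hν))

theorem IsLowest.F_eq_zero (D : IsDatum a d q) (hX : X.IsRep a d q) {μ : Weight I} {v : V}
    (hv : X.IsLowest a d q μ v) (j) : X.F j v = 0 := by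
  have h := hX.F_mem D hv.mem j
  rw [hv.eq_bot] at h
  · exact h
  · simpa using weightLT_of_add_simpleRoot a j.2 (μ - simpleRoot a j.1)

end GenAction

/-! ### Modules over the quantized Levi factor -/

section Module

variable {I : Type*} {a : Matrix I I ℤ} {d : I → ℝ} {q : ℝ} {t : I}

theorem toUq_eq_of_rel {x y : Free I} (h : Rel a d q x y) : toUq a d q x = toUq a d q y :=
  RingQuot.mkAlgHom_rel ℂ h

variable {V : Type*} [AddCommGroup V] [Module ℂ V] [Module (UqLevi a d q t) V]
    [IsScalarTower ℂ (UqLevi a d q t) V]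

theorem genAction_isRep [Fintype I] (D : IsDatum a d q) : (genAction a d q t V).IsRep a d q := by
  have hK0 : leviK a d q t 0 = 1 :=
    Subtype.ext (by simpa [leviK] using toUq_eq_of_rel (a := a) (d := d) (q := q) Rel.K_zero)
  have hKadd : ∀ l m, leviK a d q t (l + m) = leviK a d q t l * leviK a d q t m := fun l m =>
    Subtype.ext (by
      simpa [leviK] using (toUq_eq_of_rel (a := a) (d := d) (q := q) (Rel.K_mul l m)).symm)
  have hKK : ∀ l, leviK a d q t (-l) * leviK a d q t l = 1 := fun l => by
    rw [← hKadd, neg_add_cancel, hK0]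
  have hKE : ∀ l j, leviK a d q t l * leviE a d q t j * leviK a d q t (-l) =
      qchar a d q l (simpleRoot a j.1) • leviE a d q t j := fun l j => by
    rw [qchar_simpleRoot D]
    exact Subtype.ext (by
      simpa [leviK, leviE] using (toUq_eq_of_rel (a := a) (d := d) (q := q) (Rel.K_E l j.1)))
  have hKF : ∀ l j, leviK a d q t l * leviF a d q t j * leviK a d q t (-l) =
      qchar a d q l (-simpleRoot a j.1) • leviF a d q t j := fun l j => by
    rw [qchar_neg_right D, qchar_simpleRoot D]
    exact Subtype.ext (by
      simpa [leviK, leviF] using (toUq_eq_of_rel (a := a) (d := d) (q := q) (Rel.K_F l j.1)))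
  refine ⟨?_, ?_, ?_, ?_, ?_, ?_⟩
  · change Algebra.lsmul ℂ ℂ V _ = 1
    rw [hK0, map_one]
  · intro l m
    change Algebra.lsmul ℂ ℂ V _ = Algebra.lsmul ℂ ℂ V _ * Algebra.lsmul ℂ ℂ V _
    rw [hKadd, map_mul]
  · intro l j
    change Algebra.lsmul ℂ ℂ V _ * Algebra.lsmul ℂ ℂ V _ =
      _ • (Algebra.lsmul ℂ ℂ V _ * Algebra.lsmul ℂ ℂ V _)
    rw [← map_mul, ← map_mul, ← map_smul, ← smul_mul_assoc, ← hKE, mul_assoc, hKK, mul_one]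
  · intro l j
    change Algebra.lsmul ℂ ℂ V _ * Algebra.lsmul ℂ ℂ V _ =
      _ • (Algebra.lsmul ℂ ℂ V _ * Algebra.lsmul ℂ ℂ V _)
    rw [← map_mul, ← map_mul, ← map_smul, ← smul_mul_assoc, ← hKF, mul_assoc, hKK, mul_one]
  · intro j
    change Algebra.lsmul ℂ ℂ V _ * Algebra.lsmul ℂ ℂ V _ - Algebra.lsmul ℂ ℂ V _ *
      Algebra.lsmul ℂ ℂ V _ = _ • (Algebra.lsmul ℂ ℂ V _ - Algebra.lsmul ℂ ℂ V _)
    rw [← map_mul, ← map_mul, ← map_sub, ← map_sub, ← map_smul]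
    congr 1
    exact Subtype.ext (by
      simpa [leviK, leviE, leviF] using
        (toUq_eq_of_rel (a := a) (d := d) (q := q) (Rel.E_F_same j.1)))
  · intro i j hij
    change Algebra.lsmul ℂ ℂ V _ * Algebra.lsmul ℂ ℂ V _ - Algebra.lsmul ℂ ℂ V _ *
      Algebra.lsmul ℂ ℂ V _ = 0
    rw [← map_mul, ← map_mul, ← map_sub, ← map_zero (Algebra.lsmul ℂ ℂ V (A := UqLevi a d q t))]
    congr 1
    exact Subtype.ext (by
      simpa [leviE, leviF] using
        (toUq_eq_of_rel (a := a) (d := d) (q := q) (Rel.E_F_ne i.1 j.1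
          (fun h => hij (Subtype.ext h)))))

/-- A subspace stable under the generators is a submodule, by induction over the generated
subalgebra. From here on modules are handled through their generators alone. -/
theorem genAction_isIrr [hV : IsSimpleModule (UqLevi a d q t) V] : (genAction a d q t V).IsIrr := by
  refine ⟨IsSimpleModule.nontrivial (UqLevi a d q t) V, fun N hN => ?_⟩
  have key : ∀ x : UqLevi a d q t, ∀ v ∈ N, x • v ∈ N := by
    rintro ⟨x, hx⟩
    induction hx using Algebra.adjoin_induction with
    | mem x hx =>
      rcases hx with (⟨l, rfl⟩ | ⟨j, rfl⟩) | ⟨j, rfl⟩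
      · exact hN.K l
      · exact hN.E j
      · exact hN.F j
    | algebraMap c =>
      intro v hv
      have : (⟨algebraMap ℂ (Uq a d q) c, Subalgebra.algebraMap_mem _ c⟩ : UqLevi a d q t) • v =
          c • v := by
        rw [← algebraMap_smul (UqLevi a d q t) c v]
        rfl
      rw [this]
      exact N.smul_mem c hv
    | add x y hx hy h1 h2 =>
      intro v hv
      have : (⟨x + y, Subalgebra.add_mem _ hx hy⟩ : UqLevi a d q t) = ⟨x, hx⟩ + ⟨y, hy⟩ := rfl
      rw [this, add_smul]
      exact N.add_mem (h1 v hv) (h2 v hv)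
    | mul x y hx hy h1 h2 =>
      intro v hv
      have : (⟨x * y, Subalgebra.mul_mem _ hx hy⟩ : UqLevi a d q t) = ⟨x, hx⟩ * ⟨y, hy⟩ := rfl
      rw [this, mul_smul]
      exact h1 _ (h2 v hv)
  let N' : Submodule (UqLevi a d q t) V :=
    { carrier := N
      add_mem' := N.add_mem
      zero_mem' := N.zero_mem
      smul_mem' := key }
  have := (isSimpleModule_iff _ _).1 hV
  rcases eq_bot_or_eq_top N' with h | h
  · left
    ext v
    exact (SetLike.ext_iff.1 h v)
  · right
    ext v
    exact (SetLike.ext_iff.1 h v)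

end Module

end

end QuantumNilradical

/-! ### Properties of an arbitrary braiding and of an arbitrary commutor. -/

namespace QuantumNilradical

open scoped TensorProduct

noncomputable section

/-! ### Positive definite sesquilinear forms -/

section PosForm

variable {E : Type*} [AddCommGroup E] [Module ℂ E]

/-- A positive definite Hermitian form, conjugate-linear in the first variable. -/
structure IsPosForm (h : E →ₗ⋆[ℂ] E →ₗ[ℂ] ℂ) : Prop where
  symm : ∀ v w, h w v = starRingEnd ℂ (h v w)
  pos : ∀ v, v ≠ 0 → 0 < (h v v).re

namespace IsPosForm

variable {h : E →ₗ⋆[ℂ] E →ₗ[ℂ] ℂ} (hh : IsPosForm h)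
include hh

theorem eq_zero {v : E} (hv : (h v v).re ≤ 0) : v = 0 := by
  by_contra h0
  exact absurd (hh.pos v h0) (not_lt.2 hv)

theorem ext {v w : E} (hvw : ∀ z, h v z = h w z) : v = w := by
  rw [← sub_eq_zero]
  exact hh.eq_zero (by simp [hvw])

theorem re_nonneg (v : E) : 0 ≤ (h v v).re := by
  by_cases hv : v = 0
  · simp [hv]
  · exact (hh.pos v hv).le

/-- The inner product space structure defined by a positive definite form. -/
abbrev core : InnerProductSpace.Core ℂ E where
  inner v w := h v w
  conj_inner_symm v w := (hh.symm w v).symm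
  re_inner_nonneg v := hh.re_nonneg v
  add_left v w z := by simp
  smul_left v w r := by simp
  definite v hv := by
    by_contra h0
    exact absurd (hh.pos v h0) (by simp [show h v v = 0 from hv])

theorem exists_basis [FiniteDimensional ℂ E] :
    ∃ e : Module.Basis (Fin (Module.finrank ℂ E)) ℂ E, ∀ i j, h (e i) (e j) = if i = j then 1 else 0 := by
  let _ := hh.core.toNormedAddCommGroup
  let _ : InnerProductSpace ℂ E := InnerProductSpace.ofCore hh.core.toCore
  refine ⟨(stdOrthonormalBasis ℂ E).toBasis, fun i j => ?_⟩
  rw [OrthonormalBasis.coe_toBasis]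
  exact orthonormal_iff_ite.1 (stdOrthonormalBasis ℂ E).orthonormal i j

theorem iSup_eigenspace_eq_top [FiniteDimensional ℂ E] {T : E →ₗ[ℂ] E}
    (hT : ∀ v w, h (T v) w = h v (T w)) :
    ⨆ r : ℝ, Module.End.eigenspace T (r : ℂ) = ⊤ := by
  let _ := hh.core.toNormedAddCommGroup
  let _ : InnerProductSpace ℂ E := InnerProductSpace.ofCore hh.core.toCore
  have hsym : T.IsSymmetric := hT
  have h1 : ⨆ c : ℂ, Module.End.eigenspace T c = ⊤ :=
    (Submodule.orthogonal_eq_bot_iff).1 hsym.orthogonalComplement_iSup_eigenspaces_eq_bot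
  refine le_antisymm le_top (h1 ▸ iSup_le fun c => ?_)
  by_cases hc : Module.End.eigenspace T c = ⊥
  · simp [hc]
  · have h2 := hsym.conj_eigenvalue_eq_self (Module.End.hasEigenvalue_iff.2 hc)
    obtain ⟨r, rfl⟩ := Complex.conj_eq_iff_real.1 h2
    exact le_iSup (fun r : ℝ => Module.End.eigenspace T (r : ℂ)) r

end IsPosForm

theorem isPosForm_of_basis {ι : Type*} [Fintype ι] [DecidableEq ι] (e : Module.Basis ι ℂ E)
    (h : E →ₗ⋆[ℂ] E →ₗ[ℂ] ℂ) (he : ∀ i j, h (e i) (e j) = if i = j then 1 else 0) :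
    IsPosForm h := by
  have key : ∀ v w, h v w = ∑ i, starRingEnd ℂ (e.repr v i) * e.repr w i := by
    intro v w
    conv_lhs => rw [← e.sum_repr v, ← e.sum_repr w]
    simp only [map_sum, LinearMap.map_smulₛₗ, LinearMap.sum_apply, LinearMap.smul_apply, he,
      RingHom.id_apply, smul_eq_mul, mul_ite, mul_one, mul_zero,
      Finset.sum_ite_eq', Finset.mem_univ, if_true]
    exact Finset.sum_congr rfl fun _ _ => mul_comm _ _
  refine ⟨fun v w => by simp [key, mul_comm], fun v hv => ?_⟩
  have : (h v v).re = ∑ i, Complex.normSq (e.repr v i) := by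
    rw [key, Complex.re_sum]
    refine Finset.sum_congr rfl fun i _ => ?_
    rw [mul_comm, Complex.mul_conj, Complex.ofReal_re]
  rw [this]
  obtain ⟨i, hi⟩ : ∃ i, e.repr v i ≠ 0 := by
    by_contra! h0
    exact hv (e.repr.map_eq_zero_iff.1 (Finsupp.ext h0))
  exact Finset.sum_pos' (fun i _ => Complex.normSq_nonneg _)
    ⟨i, Finset.mem_univ i, Complex.normSq_pos.2 hi⟩

end PosForm

/-! ### Tensor squares -/

namespace GenAction

variable {I : Type*} {t : I} {V W : Type*} [AddCommGroup V] [Module ℂ V] [AddCommGroup W]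
  [Module ℂ W] {a : Matrix I I ℤ} {d : I → ℝ} {q : ℝ} {X : GenAction t V} {Y : GenAction t W}

@[simp]
theorem tensor_K_tmul (l : Weight I) (v : V) (w : W) :
    (X.tensor a Y).K l (v ⊗ₜ w) = X.K l v ⊗ₜ Y.K l w := rfl

@[simp]
theorem tensor_E_tmul (j) (v : V) (w : W) :
    (X.tensor a Y).E j (v ⊗ₜ w) = X.E j v ⊗ₜ w + X.K (simpleRoot a j.1) v ⊗ₜ Y.E j w := rfl

@[simp]
theorem tensor_F_tmul (j) (v : V) (w : W) :
    (X.tensor a Y).F j (v ⊗ₜ w) = X.F j v ⊗ₜ Y.K (-simpleRoot a j.1) w + v ⊗ₜ Y.F j w := rfl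

variable [Fintype I]

/-- A stable subspace of `V ⊗ W` that contains `v ⊗ W` for a nonzero `v` is everything. -/
theorem IsStable.eq_top_of_left (hirr : X.IsIrr) (hY : Y.IsRep a d q)
    {M : Submodule ℂ (V ⊗[ℂ] W)} (hM : (X.tensor a Y).IsStable M) {v : V} (hv0 : v ≠ 0)
    (hv : ∀ w : W, v ⊗ₜ w ∈ M) : M = ⊤ := by
  let N : Submodule ℂ V :=
    { carrier := {v | ∀ w : W, v ⊗ₜ w ∈ M}
      add_mem' := fun hx hy w => by rw [TensorProduct.add_tmul]; exact M.add_mem (hx w) (hy w)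
      zero_mem' := fun w => by simp
      smul_mem' := fun c x hx w => by rw [← TensorProduct.smul_tmul']; exact M.smul_mem c (hx w) }
  -- Stability under `K` comes first: it removes the cross term `K_j v ⊗ E_j w` of the coproduct
  -- below.
  have hK : ∀ l, ∀ v ∈ N, X.K l v ∈ N := fun l v hv w => by
    have := hM.K l _ (hv (Y.K (-l) w))
    rwa [tensor_K_tmul, hY.K_K_neg] at this
  have hN : X.IsStable N := by
    refine ⟨hK, fun j v hv w => ?_, fun j v hv w => ?_⟩
    · have := M.sub_mem (hM.E j _ (hv w)) (hK (simpleRoot a j.1) v hv (Y.E j w))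
      rwa [tensor_E_tmul, add_sub_cancel_right] at this
    · have := M.sub_mem (hM.F j _ (hv (Y.K (simpleRoot a j.1) w)))
        (hv (Y.F j (Y.K (simpleRoot a j.1) w)))
      rwa [tensor_F_tmul, add_sub_cancel_right, hY.K_neg_K] at this
  have hN' := hirr.eq_top hN (v := v) hv hv0
  rw [eq_top_iff, ← TensorProduct.span_tmul_eq_top, Submodule.span_le]
  rintro _ ⟨v, w, rfl⟩
  exact (hN' ▸ Submodule.mem_top : v ∈ N) w

/-- A stable subspace of `V ⊗ W` that contains `V ⊗ w` for a nonzero `w` is everything. -/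
theorem IsStable.eq_top_of_right (hX : X.IsRep a d q) (hirr : Y.IsIrr)
    {M : Submodule ℂ (V ⊗[ℂ] W)} (hM : (X.tensor a Y).IsStable M) {w : W} (hw0 : w ≠ 0)
    (hw : ∀ v : V, v ⊗ₜ w ∈ M) : M = ⊤ := by
  let N : Submodule ℂ W :=
    { carrier := {w | ∀ v : V, v ⊗ₜ w ∈ M}
      add_mem' := fun hx hy w => by rw [TensorProduct.tmul_add]; exact M.add_mem (hx w) (hy w)
      zero_mem' := fun w => by simp
      smul_mem' := fun c x hx w => by rw [TensorProduct.tmul_smul]; exact M.smul_mem c (hx w) }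
  have hK : ∀ l, ∀ w ∈ N, Y.K l w ∈ N := fun l w hw v => by
    have := hM.K l _ (hw (X.K (-l) v))
    rwa [tensor_K_tmul, hX.K_K_neg] at this
  have hN : Y.IsStable N := by
    refine ⟨hK, fun j w hw v => ?_, fun j w hw v => ?_⟩
    · have := M.sub_mem (hM.E j _ (hw (X.K (-simpleRoot a j.1) v)))
        (hw (X.E j (X.K (-simpleRoot a j.1) v)))
      rwa [tensor_E_tmul, add_sub_cancel_left, hX.K_K_neg] at this
    · have := M.sub_mem (hM.F j _ (hw v)) (hK (-simpleRoot a j.1) w hw (X.F j v))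
      rwa [tensor_F_tmul, add_sub_cancel_left] at this
  have hN' := hirr.eq_top hN (v := w) hw hw0
  rw [eq_top_iff, ← TensorProduct.span_tmul_eq_top, Submodule.span_le]
  rintro _ ⟨v, w, rfl⟩
  exact (hN' ▸ Submodule.mem_top : w ∈ N) v

/-! ### The braiding -/

/-- The `K_l` are self-adjoint with real eigenvalues, and together these eigenvalues separate the
weights. -/
theorem weightSpace_form_eq_zero (D : IsDatum a d q) {h : V →ₗ⋆[ℂ] V →ₗ[ℂ] ℂ}
    (hh : X.IsInvariantInner a h) {μ ν : Weight I} (hμν : μ ≠ ν) {v w : V}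
    (hv : v ∈ X.weightSpace a d q μ) (hw : w ∈ X.weightSpace a d q ν) : h v w = 0 := by
  by_contra h0
  refine hμν (qchar_injective D fun l => ?_)
  have := hh.2.2.1 l v w
  rw [mem_weightSpace.1 hv, mem_weightSpace.1 hw] at this
  simp only [LinearMap.map_smulₛₗ, LinearMap.smul_apply, map_smul, smul_eq_mul] at this
  have h1 := mul_right_cancel₀ h0 this
  simpa [qchar, Complex.conj_ofReal] using h1

theorem ext_tmul_weight {M : Type*} [AddCommGroup M] [Module ℂ M]
    (hV : ⨆ ν, X.weightSpace a d q ν = ⊤) (hW : ⨆ ν, Y.weightSpace a d q ν = ⊤)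
    {f g : V ⊗[ℂ] W →ₗ[ℂ] M}
    (h : ∀ μ, ∀ v ∈ X.weightSpace a d q μ, ∀ ν, ∀ w ∈ Y.weightSpace a d q ν,
      f (v ⊗ₜ w) = g (v ⊗ₜ w)) : f = g := by
  refine TensorProduct.ext' fun v w => ?_
  refine forall_mem_of_weight (N := LinearMap.eqLocus (f ∘ₗ (TensorProduct.mk ℂ V W).flip w)
    (g ∘ₗ (TensorProduct.mk ℂ V W).flip w)) hV (fun μ v hv => ?_) v
  exact forall_mem_of_weight (N := LinearMap.eqLocus (f ∘ₗ TensorProduct.mk ℂ V W v)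
    (g ∘ₗ TensorProduct.mk ℂ V W v)) hW (fun ν w hw => h μ v hv ν w hw) w

namespace IsBraiding

variable {R : V ⊗[ℂ] V →ₗ[ℂ] V ⊗[ℂ] V} (hR : X.IsBraiding a d q R)
include hR

/-- Every correction term contains a vector of weight below `μ`, and there are none except `0`. -/
theorem apply_lowest {μ ν : Weight I} {v w : V} (hv : X.IsLowest a d q μ v)
    (hw : w ∈ X.weightSpace a d q ν) : R (v ⊗ₜ w) = qchar a d q μ ν • (w ⊗ₜ v) := by
  have h := hR.2 μ ν v w hv.mem hw
  rw [← sub_eq_zero]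
  rw [← Submodule.mem_bot ℂ]
  refine Submodule.span_le.2 ?_ h
  rintro z ⟨μ', ν', v', w', hv', -, hlt, -, rfl⟩
  rw [hv.eq_bot μ' hlt] at hv'
  simp [(Submodule.mem_bot ℂ).1 hv']

/-- The range is stable and contains `w ⊗ v` for the lowest vector `v` and every weight vector `w`,
so it is everything. -/
theorem surjective (D : IsDatum a d q) (hX : X.IsRep a d q) (hirr : X.IsIrr)
    (hspan : ⨆ ν, X.weightSpace a d q ν = ⊤) {μ : Weight I} {v : V}
    (hv : X.IsLowest a d q μ v) : Function.Surjective R := by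
  rw [← LinearMap.range_eq_top]
  refine IsStable.eq_top_of_right (X := X) (Y := X) hX hirr ⟨?_, ?_, ?_⟩ hv.ne_zero
    fun w => ?_
  · rintro l _ ⟨x, rfl⟩
    exact ⟨_, hR.1.1 l x⟩
  · rintro j _ ⟨x, rfl⟩
    exact ⟨_, hR.1.2.1 j x⟩
  · rintro j _ ⟨x, rfl⟩
    exact ⟨_, hR.1.2.2 j x⟩
  · refine forall_mem_of_weight (N := (LinearMap.range R).comap ((TensorProduct.mk ℂ V V).flip v))
      hspan (fun ν w hw => ?_) w
    refine ⟨(qchar a d q μ ν)⁻¹ • (v ⊗ₜ w), ?_⟩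
    rw [map_smul, hR.apply_lowest hv hw, smul_smul, inv_mul_cancel₀ (qchar_ne_zero D _ _), one_smul]
    rfl

/-- The braiding is self-adjoint. -/
theorem selfAdjoint (D : IsDatum a d q) (hX : X.IsRep a d q) (hirr : X.IsIrr)
    (hspan : ⨆ ν, X.weightSpace a d q ν = ⊤) {μ : Weight I} {v : V}
    (hv : X.IsLowest a d q μ v) {h : V →ₗ⋆[ℂ] V →ₗ[ℂ] ℂ} (hh : X.IsInvariantInner a h)
    {h₂ : V ⊗[ℂ] V →ₗ⋆[ℂ] V ⊗[ℂ] V →ₗ[ℂ] ℂ}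
    (hh₂ : ∀ v w v' w', h₂ (v ⊗ₜ[ℂ] w) (v' ⊗ₜ[ℂ] w') = h v v' * h w w') (x y : V ⊗[ℂ] V) :
    h₂ (R x) y = h₂ x (R y) := by
  have pure_ext : ∀ (f g : V ⊗[ℂ] V →ₗ⋆[ℂ] V ⊗[ℂ] V →ₗ[ℂ] ℂ),
      (∀ v w v' w', f (v ⊗ₜ w) (v' ⊗ₜ w') = g (v ⊗ₜ w) (v' ⊗ₜ w')) → ∀ x y, f x y = g x y := by
    intro f g hfg x y
    induction x using TensorProduct.induction_on with
    | zero => simp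
    | add x x' hx hx' => simp [hx, hx']
    | tmul v w =>
      induction y using TensorProduct.induction_on with
      | zero => simp
      | add y y' hy hy' => simp [hy, hy']
      | tmul v' w' => exact hfg v w v' w'
  have invK : ∀ l x y, h₂ ((X.tensor a X).K l x) y = h₂ x ((X.tensor a X).K l y) := by
    intro l
    refine pure_ext (h₂.comp ((X.tensor a X).K l)) (h₂.compl₂ ((X.tensor a X).K l)) ?_
    intro v w v' w'
    simp [hh₂, hh.2.2.1]
  have invE : ∀ j x y, h₂ ((X.tensor a X).E j x) y =
      h₂ x ((X.tensor a X).K (simpleRoot a j.1) ((X.tensor a X).F j y)) := by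
    intro j
    refine pure_ext (h₂.comp ((X.tensor a X).E j))
      (h₂.compl₂ ((X.tensor a X).K (simpleRoot a j.1) ∘ₗ (X.tensor a X).F j)) ?_
    intro v w v' w'
    simp [hh₂, hh.2.2.1, hh.2.2.2.1, hX.K_K_neg]
  have invF : ∀ j x y, h₂ ((X.tensor a X).F j x) y =
      h₂ x ((X.tensor a X).E j ((X.tensor a X).K (-simpleRoot a j.1) y)) := by
    intro j
    refine pure_ext (h₂.comp ((X.tensor a X).F j))
      (h₂.compl₂ ((X.tensor a X).E j ∘ₗ (X.tensor a X).K (-simpleRoot a j.1))) ?_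
    intro v w v' w'
    simp [hh₂, hh.2.2.1, hh.2.2.2.2, hX.K_K_neg]
  -- Both `R` and its adjoint intertwine the action, since the form is invariant for the
  -- `*`-structure. So the locus where they agree is stable, and it remains to test it on `v ⊗ w`
  -- with `v` lowest.
  let M : Submodule ℂ (V ⊗[ℂ] V) :=
    { carrier := {x | ∀ y, h₂ (R x) y = h₂ x (R y)}
      add_mem' := fun hx hx' y => by simp [hx y, hx' y]
      zero_mem' := fun y => by simp
      smul_mem' := fun c x hx y => by simp [hx y] }
  have hM : (X.tensor a X).IsStable M := by
    refine ⟨fun l x hx y => ?_, fun j x hx y => ?_, fun j x hx y => ?_⟩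
    · rw [hR.1.1, invK, hx, hR.1.1, invK]
    · rw [hR.1.2.1, invE, hx, hR.1.1, hR.1.2.2, invE]
    · rw [hR.1.2.2, invF, hx, hR.1.2.1, hR.1.1, invF]
  suffices hMtop : M = ⊤ from (hMtop ▸ Submodule.mem_top : x ∈ M) y
  refine hM.eq_top_of_left hirr hX hv.ne_zero fun w => ?_
  refine forall_mem_of_weight (N := M.comap (TensorProduct.mk ℂ V V v)) hspan (fun ν w hw => ?_) w
  change ∀ y, h₂ (R (v ⊗ₜ w)) y = h₂ (v ⊗ₜ w) (R y)
  rw [hR.apply_lowest hv hw]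
  refine fun y => LinearMap.congr_fun (ext_tmul_weight (f := h₂ (qchar a d q μ ν • w ⊗ₜ v))
    (g := h₂ (v ⊗ₜ w) ∘ₗ R) hspan hspan fun ν' y hy μ' x hx => ?_) y
  rw [LinearMap.comp_apply]
  by_cases hx0 : x = 0
  · simp [hx0]
  have key : h₂ (v ⊗ₜ w) (R (y ⊗ₜ x)) = qchar a d q ν' μ' * (h v x * h w y) := by
    -- The correction terms have a first factor of weight above that of `x`. Such a factor pairs
    -- with `v` only if its weight is the lowest weight `μ`, and then `x` would lie in a weight
    -- space below `μ`.
    have h2 : h₂ (v ⊗ₜ w) (R (y ⊗ₜ x) - qchar a d q ν' μ' • (x ⊗ₜ y)) = 0 := by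
      refine (Submodule.span_le (p := LinearMap.ker (h₂ (v ⊗ₜ w)))).2 ?_ (hR.2 ν' μ' y x hy hx)
      rintro z ⟨ν'', μ'', y', x', hy', hx', hlt, hlt', rfl⟩
      change h₂ (v ⊗ₜ w) (x' ⊗ₜ y') = 0
      rw [hh₂]
      have hμ : μ ≠ μ'' := by
        rintro rfl
        rw [hv.eq_bot _ hlt', Submodule.mem_bot] at hx
        exact hx0 hx
      rw [weightSpace_form_eq_zero D hh hμ hv.mem hx', zero_mul]
    rw [map_sub, sub_eq_zero] at h2
    rw [h2, map_smul, hh₂, smul_eq_mul]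
  rw [key, LinearMap.map_smulₛₗ, LinearMap.smul_apply, hh₂, smul_eq_mul]
  by_cases hμ : μ = μ'
  · by_cases hν : ν = ν'
    · subst hμ hν
      rw [qchar_comm D ν μ, mul_comm (h w y)]
      simp [qchar, Complex.conj_ofReal]
    · rw [weightSpace_form_eq_zero D hh hν hw hy]; simp
  · rw [weightSpace_form_eq_zero D hh hμ hv.mem hx]; simp

end IsBraiding

/-- The pairing of tensor squares induced by a pairing, with the factors reversed. -/
def pairingSq (B : W →ₗ[ℂ] V →ₗ[ℂ] ℂ) : W ⊗[ℂ] W →ₗ[ℂ] V ⊗[ℂ] V →ₗ[ℂ] ℂ :=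
  TensorProduct.lift (LinearMap.mk₂ ℂ
    (fun y y' => LinearMap.mul' ℂ ℂ ∘ₗ TensorProduct.map (B y') (B y))
    (fun y₁ y₂ y' => by ext; simp [mul_add]) (fun c y y' => by ext; simp [mul_left_comm])
    (fun y y₁ y₂ => by ext; simp [add_mul]) (fun c y y' => by ext; simp [mul_assoc]))

@[simp]
theorem pairingSq_tmul (B : W →ₗ[ℂ] V →ₗ[ℂ] ℂ) (y y' : W) (x x' : V) :
    pairingSq B (y ⊗ₜ y') (x ⊗ₜ x') = B y' x * B y x' := by
  simp [pairingSq]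

/-- Invariance under `K_l` forces the two weights to be opposite wherever the pairing is nonzero. -/
theorem weightSpace_pairing_eq_zero (D : IsDatum a d q) {B : W →ₗ[ℂ] V →ₗ[ℂ] ℂ}
    (hB : IsInvariantPairing a Y X B) {μ ν : Weight I} (hμν : μ ≠ -ν) {w : W} {v : V}
    (hw : w ∈ Y.weightSpace a d q μ) (hv : v ∈ X.weightSpace a d q ν) : B w v = 0 := by
  by_contra h0
  refine hμν (qchar_injective D fun l => ?_)
  have := hB.1 l w v
  rw [mem_weightSpace.1 hw, mem_weightSpace.1 hv] at this
  simp only [LinearMap.smul_apply, map_smul, smul_eq_mul, ← mul_assoc] at this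
  have h1 := mul_right_cancel₀ h0 (this.trans (one_mul _).symm)
  rw [qchar_neg_right D]
  exact eq_inv_of_mul_eq_one_left ((mul_comm _ _).trans h1)

/-- The braidings of dual modules are transposed to each other. -/
theorem IsBraiding.pairingSq_apply (D : IsDatum a d q) (hX : X.IsRep a d q) (hY : Y.IsRep a d q)
    (hirr : Y.IsIrr) (hspanX : ⨆ ν, X.weightSpace a d q ν = ⊤)
    (hspanY : ⨆ ν, Y.weightSpace a d q ν = ⊤) {μ : Weight I} {v : W}
    (hv : Y.IsLowest a d q μ v) {B : W →ₗ[ℂ] V →ₗ[ℂ] ℂ} (hB : IsInvariantPairing a Y X B)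
    (hBnd : B.Nondegenerate) {R : V ⊗[ℂ] V →ₗ[ℂ] V ⊗[ℂ] V} (hR : X.IsBraiding a d q R)
    {R' : W ⊗[ℂ] W →ₗ[ℂ] W ⊗[ℂ] W} (hR' : Y.IsBraiding a d q R') (y : W ⊗[ℂ] W)
    (x : V ⊗[ℂ] V) : pairingSq B (R' y) x = pairingSq B y (R x) := by
  have pure_ext : ∀ (f g : W ⊗[ℂ] W →ₗ[ℂ] V ⊗[ℂ] V →ₗ[ℂ] ℂ),
      (∀ v w v' w', f (v ⊗ₜ w) (v' ⊗ₜ w') = g (v ⊗ₜ w) (v' ⊗ₜ w')) → ∀ x y, f x y = g x y := by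
    intro f g hfg x y
    have : f = g := by
      ext v w v' w'
      exact hfg v w v' w'
    rw [this]
  have invK : ∀ l x y, pairingSq B ((Y.tensor a Y).K l x) ((X.tensor a X).K l y) =
      pairingSq B x y := by
    intro l
    refine pure_ext ((pairingSq B).compl₁₂ ((Y.tensor a Y).K l) ((X.tensor a X).K l)) _ ?_
    intro v w v' w'
    simp [hB.1]
  have hEeq : ∀ j v w, B (Y.E j v) w = - B (Y.K (simpleRoot a j.1) v) (X.E j w) := fun j v w =>
    eq_neg_of_add_eq_zero_left (hB.2.1 j v w)
  have hFeq : ∀ j v w, B v (X.F j w) = - B (Y.F j v) (X.K (-simpleRoot a j.1) w) := fun j v w =>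
    eq_neg_of_add_eq_zero_right (hB.2.2 j v w)
  have invE : ∀ j x y, pairingSq B ((Y.tensor a Y).E j x) y =
      pairingSq B (-(Y.tensor a Y).K (simpleRoot a j.1) x) ((X.tensor a X).E j y) := by
    intro j
    refine pure_ext ((pairingSq B).comp ((Y.tensor a Y).E j))
      ((pairingSq B).compl₁₂ (-(Y.tensor a Y).K (simpleRoot a j.1)) ((X.tensor a X).E j)) ?_
    intro v w v' w'
    simp [hB.1, hEeq]
  have invF : ∀ j x y, pairingSq B x ((X.tensor a X).F j y) =
      pairingSq B (-(Y.tensor a Y).F j x) ((X.tensor a X).K (-simpleRoot a j.1) y) := by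
    intro j
    refine pure_ext ((pairingSq B).compl₂ ((X.tensor a X).F j))
      ((pairingSq B).compl₁₂ (-(Y.tensor a Y).F j) ((X.tensor a X).K (-simpleRoot a j.1))) ?_
    intro v w v' w'
    simp [hB.1, hFeq]
  have tK : ∀ l x, (X.tensor a X).K l ((X.tensor a X).K (-l) x) = x := by
    intro l x
    have : (X.tensor a X).K l ∘ₗ (X.tensor a X).K (-l) = LinearMap.id := by
      ext v w
      simp [hX.K_K_neg]
    exact LinearMap.congr_fun this x
  let M : Submodule ℂ (W ⊗[ℂ] W) :=
    { carrier := {y | ∀ x, pairingSq B (R' y) x = pairingSq B y (R x)}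
      add_mem' := fun hx hx' y => by simp [hx y, hx' y]
      zero_mem' := fun y => by simp
      smul_mem' := fun c x hx y => by simp [hx y] }
  -- Moving `E_j` across the pairing leaves a `K_j` on the first argument, so stability under the
  -- `K_l` has to be available before that under the `E_j`.
  have hMK : ∀ l, ∀ y ∈ M, (Y.tensor a Y).K l y ∈ M := by
    intro l y hy x
    obtain ⟨x', rfl⟩ : ∃ x', (X.tensor a X).K l x' = x := ⟨_, tK l x⟩
    rw [hR'.1.1, invK, hy, hR.1.1, invK]
  have hM : (Y.tensor a Y).IsStable M := by
    refine ⟨hMK, fun j y hy x => ?_, fun j y hy x => ?_⟩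
    · rw [hR'.1.2.1, invE, invE, ← hR'.1.1, ← map_neg,
        M.neg_mem (hMK (simpleRoot a j.1) y hy), hR.1.2.1]
    · obtain ⟨x', rfl⟩ : ∃ x', (X.tensor a X).K (-simpleRoot a j.1) x' = x := ⟨_, tK _ x⟩
      have key : ∀ u z, pairingSq B ((Y.tensor a Y).F j u) ((X.tensor a X).K (-simpleRoot a j.1) z) =
          -pairingSq B u ((X.tensor a X).F j z) := fun u z => by simp [invF]
      rw [hR'.1.2.2, key, hy, hR.1.2.2, hR.1.1, key]
  suffices hMtop : M = ⊤ from (hMtop ▸ Submodule.mem_top : y ∈ M) x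
  refine hM.eq_top_of_left hirr hY hv.ne_zero fun w => ?_
  refine forall_mem_of_weight (N := M.comap (TensorProduct.mk ℂ W W v)) hspanY (fun ν w hw => ?_) w
  change ∀ x, pairingSq B (R' (v ⊗ₜ w)) x = pairingSq B (v ⊗ₜ w) (R x)
  rw [hR'.apply_lowest hv hw]
  refine fun y => LinearMap.congr_fun (ext_tmul_weight
    (f := pairingSq B (qchar a d q μ ν • w ⊗ₜ v))
    (g := pairingSq B (v ⊗ₜ w) ∘ₗ R) hspanX hspanX fun μ' x hx ν' x' hx' => ?_) y
  rw [LinearMap.comp_apply]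
  by_cases hx0 : x = 0
  · simp [hx0]
  have key : pairingSq B (v ⊗ₜ w) (R (x ⊗ₜ x')) = qchar a d q μ' ν' * (B w x' * B v x) := by
    have h2 : pairingSq B (v ⊗ₜ w) (R (x ⊗ₜ x') - qchar a d q μ' ν' • (x' ⊗ₜ x)) = 0 := by
      refine (Submodule.span_le (p := LinearMap.ker (pairingSq B (v ⊗ₜ w)))).2 ?_
        (hR.2 μ' ν' x x' hx hx')
      rintro z ⟨μ'', ν'', z, z', hz, hz', hlt, -, rfl⟩
      change pairingSq B (v ⊗ₜ w) (z' ⊗ₜ z) = 0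
      rw [pairingSq_tmul]
      -- If `μ = -μ''`, then `-μ'` lies below the lowest weight `μ` of `W`. Vectors of weight `-μ'`
      -- are the only ones that can pair nontrivially with `x`, so nondegeneracy gives `x = 0`.
      have hμ : μ ≠ -μ'' := by
        rintro rfl
        refine hx0 (hBnd.2 x fun y => ?_)
        refine forall_mem_of_weight (N := LinearMap.ker (B.flip x)) hspanY (fun κ y hy => ?_) y
        change B y x = 0
        by_cases hκ : κ = -μ'
        · have hlt2 : WeightLT a t κ (-μ'') := by
            obtain ⟨c, hc, hc0, rfl⟩ := hlt
            exact ⟨c, hc, hc0, by rw [hκ]; abel⟩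
          rw [hv.eq_bot _ hlt2, Submodule.mem_bot] at hy
          simp [hy]
        · exact weightSpace_pairing_eq_zero D hB hκ hy hx
      rw [weightSpace_pairing_eq_zero D hB hμ hv.mem hz, mul_zero]
    rw [map_sub, sub_eq_zero] at h2
    rw [h2, map_smul, pairingSq_tmul, smul_eq_mul]
  rw [key, map_smul, LinearMap.smul_apply, pairingSq_tmul, smul_eq_mul]
  by_cases hμ : μ = -μ'
  · by_cases hν : ν = -ν'
    · subst hμ hν
      rw [qchar_neg_right D, qchar_neg_left D, inv_inv, mul_comm (B v x)]
    · rw [weightSpace_pairing_eq_zero D hB hν hw hx']; simp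
  · rw [weightSpace_pairing_eq_zero D hB hμ hv.mem hx]; simp

/-! ### The commutor -/

/-- `s` is the sign of the diagonalizable operator `R`. -/
structure IsSignOf {E : Type*} [AddCommGroup E] [Module ℂ E] (s R : E →ₗ[ℂ] E) : Prop where
  iSup_eigenspace : ⨆ r : ℝ, Module.End.eigenspace R (r : ℂ) = ⊤
  ne_zero : ∀ (r : ℝ) (x : E), R x = (r : ℂ) • x → x ≠ 0 → r ≠ 0
  apply : ∀ (r : ℝ) (x : E), R x = (r : ℂ) • x → s x = (SignType.sign r : ℂ) • x

namespace IsSignOf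

variable {E E' : Type*} [AddCommGroup E] [Module ℂ E] [AddCommGroup E'] [Module ℂ E']
  {s R : E →ₗ[ℂ] E} (hs : IsSignOf s R)
include hs

theorem forall_mem {N : Submodule ℂ E} (h : ∀ (r : ℝ) (x : E), R x = (r : ℂ) • x → x ∈ N) (x : E) :
    x ∈ N := by
  have : (⊤ : Submodule ℂ E) ≤ N :=
    hs.iSup_eigenspace ▸ iSup_le fun r x hx => h r x (Module.End.mem_eigenspace_iff.1 hx)
  exact this trivial

theorem involutive (x : E) : s (s x) = x := by
  refine hs.forall_mem (N := LinearMap.eqLocus (s ∘ₗ s) LinearMap.id) (fun r x hx => ?_) x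
  change s (s x) = x
  by_cases hx0 : x = 0
  · simp [hx0]
  rw [hs.apply r x hx, map_smul, hs.apply r x hx, smul_smul]
  have := hs.ne_zero r x hx hx0
  rcases lt_or_gt_of_ne this with h | h <;> simp [h]

/-- An operator commuting with `R` preserves its eigenspaces, on each of which `s` is a scalar. -/
theorem comm {A : E →ₗ[ℂ] E} (hA : ∀ x, R (A x) = A (R x)) (x : E) : s (A x) = A (s x) := by
  refine hs.forall_mem (N := LinearMap.eqLocus (s ∘ₗ A) (A ∘ₗ s)) (fun r x hx => ?_) x
  change s (A x) = A (s x)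
  rw [hs.apply r x hx, map_smul, hs.apply r (A x) (by rw [hA, hx, map_smul])]

/-- Eigenvectors for different eigenvalues pair to zero, and equal eigenvalues have equal signs. The
twist `σ` covers two uses: complex conjugation for self-adjointness, and the identity for
transposition under a bilinear pairing. -/
theorem adjoint {s' R' : E' →ₗ[ℂ] E'} (hs' : IsSignOf s' R') {σ : ℂ →+* ℂ}
    (hσ : ∀ r : ℝ, σ r = r) {h : E →ₛₗ[σ] E' →ₗ[ℂ] ℂ} (hh : ∀ x y, h (R x) y = h x (R' y)) (x : E)
    (y : E') : h (s x) y = h x (s' y) := by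
  let N : Submodule ℂ E :=
    { carrier := {x | ∀ y, h (s x) y = h x (s' y)}
      add_mem' := fun hx hx' y => by simp [hx y, hx' y]
      zero_mem' := fun y => by simp
      smul_mem' := fun c x hx y => by simp [hx y] }
  refine hs.forall_mem (N := N) (fun r x hx y => ?_) x y
  refine hs'.forall_mem (N := LinearMap.eqLocus (h (s x)) (h x ∘ₗ s')) (fun r' y hy => ?_) y
  change h (s x) y = h x (s' y)
  have h1 := hh x y
  rw [hx, hy, LinearMap.map_smulₛₗ, hσ, map_smul, LinearMap.smul_apply, smul_eq_mul,
    smul_eq_mul] at h1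
  have hsign : ∀ e : SignType, σ (e : ℂ) = (e : ℂ) := by
    intro e
    cases e <;> simp
  rw [hs.apply r x hx, hs'.apply r' y hy, LinearMap.map_smulₛₗ, map_smul, LinearMap.smul_apply,
    smul_eq_mul, smul_eq_mul, hsign]
  by_cases h0 : h x y = 0
  · simp [h0]
  · have := mul_right_cancel₀ h0 h1
    rw [Complex.ofReal_inj.1 this]

end IsSignOf

theorem isPosForm_tensor [FiniteDimensional ℂ V] {h : V →ₗ⋆[ℂ] V →ₗ[ℂ] ℂ} (hh : IsPosForm h)
    {h₂ : V ⊗[ℂ] V →ₗ⋆[ℂ] V ⊗[ℂ] V →ₗ[ℂ] ℂ}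
    (hh₂ : ∀ v w v' w', h₂ (v ⊗ₜ[ℂ] w) (v' ⊗ₜ[ℂ] w') = h v v' * h w w') : IsPosForm h₂ := by
  obtain ⟨e, he⟩ := hh.exists_basis
  refine isPosForm_of_basis (e.tensorProduct e) h₂ ?_
  rintro ⟨i, i'⟩ ⟨j, j'⟩
  simp only [Module.Basis.tensorProduct_apply, hh₂, he, Prod.mk.injEq]
  split_ifs <;> simp_all

/-- As `R` is self-adjoint, `P² = R* R = R²`, so the positive operator `P` is `|R|` and `s = R P⁻¹`
is the sign of `R`. -/
theorem IsCommutor.exists_isSignOf (D : IsDatum a d q) [FiniteDimensional ℂ V]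
    (hX : X.IsRep a d q) (hirr : X.IsIrr) (hspan : ⨆ ν, X.weightSpace a d q ν = ⊤)
    {s : V ⊗[ℂ] V →ₗ[ℂ] V ⊗[ℂ] V} (hs : X.IsCommutor a d q s) :
    ∃ (h : V →ₗ⋆[ℂ] V →ₗ[ℂ] ℂ) (h₂ : V ⊗[ℂ] V →ₗ⋆[ℂ] V ⊗[ℂ] V →ₗ[ℂ] ℂ)
      (R : V ⊗[ℂ] V →ₗ[ℂ] V ⊗[ℂ] V), IsPosForm h ∧
      (∀ v w v' w', h₂ (v ⊗ₜ[ℂ] w) (v' ⊗ₜ[ℂ] w') = h v v' * h w w') ∧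
      (∀ x y, h₂ (R x) y = h₂ x (R y)) ∧ X.IsBraiding a d q R ∧ IsSignOf s R := by
  obtain ⟨h, h₂, R, P, hh, hh₂, hR, hP, hPpos, ⟨-, hsu⟩, hsP⟩ := hs
  have := hirr.nontrivial
  obtain ⟨μ, v, hv⟩ := exists_isLowest D hspan
  have hself := hR.selfAdjoint D hX hirr hspan hv hh hh₂
  have hpos : IsPosForm h := ⟨hh.1, hh.2.1⟩
  have hpos₂ : IsPosForm h₂ := isPosForm_tensor hpos hh₂
  refine ⟨h, h₂, R, hpos, hh₂, hself, hR, ?_⟩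
  have hinj : Function.Injective R :=
    LinearMap.injective_iff_surjective.2 (hR.surjective D hX hirr hspan hv)
  have hne : ∀ (r : ℝ) (x : V ⊗[ℂ] V), R x = (r : ℂ) • x → x ≠ 0 → r ≠ 0 := by
    rintro r x hx hx0 rfl
    exact hx0 (hinj (by simpa using hx))
  -- Unitarity of `s` gives `h₂ (P x) (P z) = h₂ (s P x) (s P z) = h₂ (R x) (R z)`.
  have hsq : ∀ x, P (P x) = R (R x) := fun x => hpos₂.ext fun z => by
    rw [hP, hself, ← hsu, hsP]
    rfl
  refine ⟨hpos₂.iSup_eigenspace_eq_top hself, hne, fun r x hx => ?_⟩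
  by_cases hx0 : x = 0
  · simp [hx0]
  have hr := hne r x hx hx0
  have hPx : P x = ((|r| : ℝ) : ℂ) • x := by
    rw [← sub_eq_zero]
    -- By `P² x = r² x`, the vector `y` has eigenvalue `-|r|` under `P`. This is negative, so
    -- positivity of `P` forces `y = 0`.
    set y := P x - ((|r| : ℝ) : ℂ) • x with hy
    have hPy : P y = -(((|r| : ℝ) : ℂ) • y) := by
      rw [hy, map_sub, map_smul, hsq, hx, map_smul, hx, smul_smul, smul_sub, smul_smul,
        ← Complex.ofReal_mul, ← Complex.ofReal_mul, abs_mul_abs_self]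
      abel
    have h1 := hPpos y
    rw [hPy, map_neg, map_smul, smul_eq_mul, Complex.neg_re, Complex.re_ofReal_mul] at h1
    refine hpos₂.eq_zero ?_
    by_contra hlt
    have := mul_pos (abs_pos.2 hr) (not_le.1 hlt)
    linarith
  have h1 : ((|r| : ℝ) : ℂ) • s x = (r : ℂ) • x := by
    rw [← map_smul, ← hPx, ← hx, hsP]
    rfl
  have h2 : ((|r| : ℝ) : ℂ) ≠ 0 := by simpa using hr
  refine smul_right_injective _ h2 ?_
  simp only [h1, smul_smul]
  congr 1
  rcases lt_trichotomy r 0 with h | h | h <;> simp [h, abs_of_neg, abs_of_pos]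

end GenAction

end

end QuantumNilradical

/-! ### Exterior powers attached to an involution that is self-adjoint on the tensor square. -/

namespace QuantumNilradical

open scoped TensorProduct

noncomputable section

/-! ### Operators on tensor powers -/

section TensorPower

variable {V W : Type*} [AddCommGroup V] [Module ℂ V] [AddCommGroup W] [Module ℂ W]

theorem insertPair_self (n i : ℕ) (hi : i + 1 < n) (v : Fin n → V) :
    insertPair n i hi v (v ⟨i, by omega⟩ ⊗ₜ v ⟨i + 1, hi⟩) = PiTensorProduct.tprod ℂ v := by
  rw [insertPair_tmul, Function.update_eq_self, Function.update_eq_self]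

theorem insertPair_congr {n i : ℕ} (hi : i + 1 < n) {v w : Fin n → V}
    (h : ∀ k : Fin n, k.1 ≠ i → k.1 ≠ i + 1 → v k = w k) :
    insertPair n i hi v = insertPair n i hi w := by
  ext x y
  simp only [TensorProduct.AlgebraTensorModule.curry_apply, TensorProduct.curry_apply,
    LinearMap.coe_restrictScalars, insertPair_tmul]
  congr 1
  funext k
  by_cases h1 : k = ⟨i + 1, hi⟩
  · subst h1; simp
  by_cases h2 : k = ⟨i, by omega⟩
  · subst h2; simp
  rw [Function.update_of_ne h1, Function.update_of_ne h2, Function.update_of_ne h1,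
    Function.update_of_ne h2]
  exact h k (fun h => h2 (Fin.ext h)) (fun h => h1 (Fin.ext h))

theorem map_insertPair {n i : ℕ} (hi : i + 1 < n) (f : Fin n → V →ₗ[ℂ] V) (v : Fin n → V)
    (z : V ⊗[ℂ] V) :
    PiTensorProduct.map f (insertPair n i hi v z) = insertPair n i hi (fun k => f k (v k))
      (TensorProduct.map (f ⟨i, by omega⟩) (f ⟨i + 1, hi⟩) z) := by
  induction z using TensorProduct.induction_on with
  | zero => simp
  | add x y hx hy => simp only [map_add, hx, hy]
  | tmul x y =>
    rw [TensorProduct.map_tmul, insertPair_tmul, insertPair_tmul, PiTensorProduct.map_tprod]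
    congr 1
    funext k
    by_cases h1 : k = ⟨i + 1, hi⟩
    · subst h1; simp
    by_cases h2 : k = ⟨i, by omega⟩
    · subst h2; simp
    simp [Function.update_of_ne h1, Function.update_of_ne h2]

variable (s : V ⊗[ℂ] V →ₗ[ℂ] V ⊗[ℂ] V)

theorem adjacentOp_insertPair {n i : ℕ} (hi : i + 1 < n) (v : Fin n → V) (z : V ⊗[ℂ] V) :
    adjacentOp s n i hi (insertPair n i hi v z) = insertPair n i hi v (s z) := by
  induction z using TensorProduct.induction_on with
  | zero => simp
  | add x y hx hy => simp only [map_add, hx, hy]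
  | tmul x y =>
    rw [insertPair_tmul, adjacentOp_tprod, Function.update_self, insertPair_update_right,
      insertPair_update_left, Function.update_of_ne (by simp), Function.update_self]

variable {s}

theorem tensorPower_hom_ext {n : ℕ} {M : Type*} [AddCommMonoid M] [Module ℂ M]
    {f g : (⨂[ℂ]^n V) →ₗ[ℂ] M}
    (h : ∀ v, f (PiTensorProduct.tprod ℂ v) = g (PiTensorProduct.tprod ℂ v)) (x) : f x = g x :=
  LinearMap.congr_fun (PiTensorProduct.ext (MultilinearMap.ext h)) x

theorem adjacentOp_involutive (hs : ∀ x, s (s x) = x) {n i : ℕ} (hi : i + 1 < n) (x : ⨂[ℂ]^n V) :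
    adjacentOp s n i hi (adjacentOp s n i hi x) = x := by
  refine tensorPower_hom_ext (f := adjacentOp s n i hi ∘ₗ adjacentOp s n i hi)
    (g := LinearMap.id) (fun v => ?_) x
  rw [LinearMap.comp_apply, adjacentOp_tprod, adjacentOp_insertPair, hs, insertPair_self]
  rfl

theorem map_adjacentOp {n i : ℕ} (hi : i + 1 < n) (f : Fin n → V →ₗ[ℂ] V) (v : Fin n → V) :
    PiTensorProduct.map f (adjacentOp s n i hi (PiTensorProduct.tprod ℂ v)) =
      insertPair n i hi (fun k => f k (v k)) (TensorProduct.map (f ⟨i, by omega⟩) (f ⟨i + 1, hi⟩)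
        (s (v ⟨i, by omega⟩ ⊗ₜ v ⟨i + 1, hi⟩))) := by
  rw [adjacentOp_tprod, map_insertPair]

theorem adjacentOp_map {n i : ℕ} (hi : i + 1 < n) (f : Fin n → V →ₗ[ℂ] V) (v : Fin n → V) :
    adjacentOp s n i hi (PiTensorProduct.map f (PiTensorProduct.tprod ℂ v)) =
      insertPair n i hi (fun k => f k (v k)) (s (TensorProduct.map (f ⟨i, by omega⟩)
        (f ⟨i + 1, hi⟩) (v ⟨i, by omega⟩ ⊗ₜ v ⟨i + 1, hi⟩))) := by
  rw [PiTensorProduct.map_tprod, adjacentOp_tprod, TensorProduct.map_tmul]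

theorem adjacentOp_comm_map {n i : ℕ} (hi : i + 1 < n) {f : Fin n → V →ₗ[ℂ] V}
    (hf : ∀ z, s (TensorProduct.map (f ⟨i, by omega⟩) (f ⟨i + 1, hi⟩) z) =
      TensorProduct.map (f ⟨i, by omega⟩) (f ⟨i + 1, hi⟩) (s z)) (x : ⨂[ℂ]^n V) :
    adjacentOp s n i hi (PiTensorProduct.map f x) = PiTensorProduct.map f (adjacentOp s n i hi x) := by
  refine tensorPower_hom_ext (f := adjacentOp s n i hi ∘ₗ PiTensorProduct.map f)
    (g := PiTensorProduct.map f ∘ₗ adjacentOp s n i hi) (fun v => ?_) x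
  rw [LinearMap.comp_apply, LinearMap.comp_apply, adjacentOp_map, map_adjacentOp, hf]

/-- A sum of factorwise operators commutes with `s_i` if the two summands number `i` and `i + 1`
agree away from the factors `i` and `i + 1` and together commute with `s` there, and all the other
summands commute with `s` in these factors. -/
theorem adjacentOp_comm_sum {n i : ℕ} (hi : i + 1 < n) (f : Fin n → Fin n → V →ₗ[ℂ] V)
    (hne : ∀ k : Fin n, k.1 ≠ i → k.1 ≠ i + 1 →
      ∀ z, s (TensorProduct.map (f k ⟨i, by omega⟩) (f k ⟨i + 1, hi⟩) z) =
        TensorProduct.map (f k ⟨i, by omega⟩) (f k ⟨i + 1, hi⟩) (s z))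
    (hoff : ∀ k : Fin n, k.1 ≠ i → k.1 ≠ i + 1 → f ⟨i, by omega⟩ k = f ⟨i + 1, hi⟩ k)
    (hpair : ∀ z, s ((TensorProduct.map (f ⟨i, by omega⟩ ⟨i, by omega⟩)
          (f ⟨i, by omega⟩ ⟨i + 1, hi⟩) +
        TensorProduct.map (f ⟨i + 1, hi⟩ ⟨i, by omega⟩) (f ⟨i + 1, hi⟩ ⟨i + 1, hi⟩)) z) =
      (TensorProduct.map (f ⟨i, by omega⟩ ⟨i, by omega⟩) (f ⟨i, by omega⟩ ⟨i + 1, hi⟩) +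
        TensorProduct.map (f ⟨i + 1, hi⟩ ⟨i, by omega⟩) (f ⟨i + 1, hi⟩ ⟨i + 1, hi⟩)) (s z))
    (x : ⨂[ℂ]^n V) :
    adjacentOp s n i hi ((∑ k, PiTensorProduct.map (f k)) x) =
      (∑ k, PiTensorProduct.map (f k)) (adjacentOp s n i hi x) := by
  have hmem : (⟨i + 1, hi⟩ : Fin n) ∈ Finset.univ.erase ⟨i, by omega⟩ := by simp
  rw [← Finset.add_sum_erase _ _ (Finset.mem_univ (⟨i, by omega⟩ : Fin n)),
    ← Finset.add_sum_erase _ _ hmem, ← add_assoc]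
  rw [LinearMap.add_apply, LinearMap.add_apply, map_add]
  congr 1
  · refine tensorPower_hom_ext
      (f := adjacentOp s n i hi ∘ₗ (PiTensorProduct.map (f ⟨i, by omega⟩) +
        PiTensorProduct.map (f ⟨i + 1, hi⟩)))
      (g := (PiTensorProduct.map (f ⟨i, by omega⟩) +
        PiTensorProduct.map (f ⟨i + 1, hi⟩)) ∘ₗ adjacentOp s n i hi) (fun v => ?_) x
    have hv : insertPair n i hi (fun k => f ⟨i, by omega⟩ k (v k)) =
        insertPair n i hi (fun k => f ⟨i + 1, hi⟩ k (v k)) :=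
      insertPair_congr hi fun k h1 h2 => by rw [hoff k h1 h2]
    rw [LinearMap.comp_apply, LinearMap.comp_apply, LinearMap.add_apply, LinearMap.add_apply,
      map_add, adjacentOp_map, adjacentOp_map, map_adjacentOp, map_adjacentOp, hv, ← map_add,
      ← map_add, ← map_add, ← LinearMap.add_apply, ← LinearMap.add_apply, hpair]
  · rw [LinearMap.sum_apply, LinearMap.sum_apply, map_sum]
    refine Finset.sum_congr rfl fun k hk => ?_
    simp only [Finset.mem_erase, Finset.mem_univ, and_true] at hk
    exact adjacentOp_comm_map hi (hne k (fun h => hk.2 (Fin.ext h)) (fun h => hk.1 (Fin.ext h))) x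

section Hom

variable {I : Type*} {t : I} {a : Matrix I I ℤ} {X : GenAction t V}
  (hs : GenAction.IsHom (X.tensor a X) (X.tensor a X) s) {n i : ℕ} (hi : i + 1 < n)
include hs

/-- The summands with `E_j` outside the factors `i`, `i + 1` act there by `1 ⊗ 1` or `K_j ⊗ K_j`.
The two remaining summands add up to `E_j ⊗ 1 + K_j ⊗ E_j`, the action of `E_j` on the tensor
square. -/
theorem adjacentOp_tensorPower_E (j : {j : I // j ≠ t}) (x : ⨂[ℂ]^n V) :
    adjacentOp s n i hi ((X.tensorPower a n).E j x) =
      (X.tensorPower a n).E j (adjacentOp s n i hi x) := by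
  have hK : ∀ l z, s (TensorProduct.map (X.K l) (X.K l) z) =
    TensorProduct.map (X.K l) (X.K l) (s z) := hs.1
  refine adjacentOp_comm_sum hi (fun k i => if i < k then X.K (simpleRoot a j.1) else
    if i = k then X.E j else LinearMap.id) (fun k h1 h2 z => ?_) (fun k h1 h2 => ?_)
    (fun z => ?_) x
  · rcases lt_or_gt_of_ne h1 with h | h
    · simp [Fin.lt_def, Fin.ext_iff, show ¬ i < k.1 by omega, show ¬ i + 1 < k.1 by omega,
        show ¬ i = k.1 by omega, show ¬ i + 1 = k.1 by omega]
    · simp only [Fin.lt_def, h, show i + 1 < k.1 by omega, if_true, hK]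
  · simp only [Fin.lt_def, Fin.ext_iff, h1, h2, if_false]
    by_cases h : k.1 < i
    · simp only [h, show k.1 < i + 1 by omega, if_true]
    · simp only [h, show ¬ k.1 < i + 1 by omega, if_false]
  · simp only [Fin.lt_def, Fin.ext_iff, lt_self_iff_false, if_false, if_true,
      show ¬ i + 1 < i by omega, show ¬ i + 1 = i by omega, show i < i + 1 by omega]
    exact hs.2.1 j z

theorem adjacentOp_tensorPower_F (j : {j : I // j ≠ t}) (x : ⨂[ℂ]^n V) :
    adjacentOp s n i hi ((X.tensorPower a n).F j x) =
      (X.tensorPower a n).F j (adjacentOp s n i hi x) := by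
  have hK : ∀ l z, s (TensorProduct.map (X.K l) (X.K l) z) =
    TensorProduct.map (X.K l) (X.K l) (s z) := hs.1
  refine adjacentOp_comm_sum hi (fun k i => if i < k then LinearMap.id else
    if i = k then X.F j else X.K (-simpleRoot a j.1)) (fun k h1 h2 z => ?_) (fun k h1 h2 => ?_)
    (fun z => ?_) x
  · rcases lt_or_gt_of_ne h1 with h | h
    · simp only [Fin.lt_def, Fin.ext_iff, show ¬ i < k.1 by omega, show ¬ i + 1 < k.1 by omega,
        show ¬ i = k.1 by omega, show ¬ i + 1 = k.1 by omega, hK, if_false]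
    · simp [Fin.lt_def, h, show i + 1 < k.1 by omega]
  · simp only [Fin.lt_def, Fin.ext_iff, h1, h2, if_false]
    by_cases h : k.1 < i
    · simp only [h, show k.1 < i + 1 by omega, if_true]
    · simp only [h, show ¬ k.1 < i + 1 by omega, if_false]
  · simp only [Fin.lt_def, Fin.ext_iff, lt_self_iff_false, if_false, if_true,
      show ¬ i + 1 < i by omega, show ¬ i + 1 = i by omega, show i < i + 1 by omega]
    exact hs.2.2 j z

theorem adjacentOp_isHom :
    GenAction.IsHom (X.tensorPower a n) (X.tensorPower a n) (adjacentOp s n i hi) :=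
  ⟨fun l x => adjacentOp_comm_map (f := fun _ => X.K l) hi (hs.1 l) x, adjacentOp_tensorPower_E hs hi,
    adjacentOp_tensorPower_F hs hi⟩

end Hom

/-! ### Symmetric and antisymmetric tensors -/

theorem mem_antisymTensors {n : ℕ} {x : ⨂[ℂ]^n V} :
    x ∈ antisymTensors s n ↔ ∀ (i : ℕ) (hi : i + 1 < n), adjacentOp s n i hi x = -x := by
  simp [antisymTensors, eq_neg_iff_add_eq_zero]

variable (s) in
/-- The degree `n` part of the ideal generated by `ker (s - id)`. -/
def symRel (n : ℕ) : Submodule ℂ (⨂[ℂ]^n V) :=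
  ⨆ (i : ℕ) (hi : i + 1 < n), LinearMap.ker (adjacentOp s n i hi - LinearMap.id)

theorem mem_symRel {n i : ℕ} (hi : i + 1 < n) {x : ⨂[ℂ]^n V} (hx : adjacentOp s n i hi x = x) :
    x ∈ symRel s n := by
  refine Submodule.mem_iSup_of_mem i (Submodule.mem_iSup_of_mem hi ?_)
  simp [hx]

theorem symRel_le {n : ℕ} {N : Submodule ℂ (⨂[ℂ]^n V)}
    (h : ∀ (i : ℕ) (hi : i + 1 < n) x, adjacentOp s n i hi x = x → x ∈ N) : symRel s n ≤ N :=
  iSup_le fun i => iSup_le fun hi x hx => h i hi x (by simpa [sub_eq_zero] using hx)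

theorem insertPair_mem_symRel {n i : ℕ} (hi : i + 1 < n) (v : Fin n → V) {z : V ⊗[ℂ] V}
    (hz : s z = z) : insertPair n i hi v z ∈ symRel s n :=
  mem_symRel hi (by rw [adjacentOp_insertPair, hz])

theorem antisymTensors_isStable {I : Type*} {t : I} {a : Matrix I I ℤ} {X : GenAction t V}
    (hs : GenAction.IsHom (X.tensor a X) (X.tensor a X) s) (n : ℕ) :
    (X.tensorPower a n).IsStable (antisymTensors s n) := by
  refine ⟨fun l x hx => ?_, fun j x hx => ?_, fun j x hx => ?_⟩ <;>
    rw [mem_antisymTensors] at hx ⊢ <;> intro i hi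
  · rw [(adjacentOp_isHom hs hi).1, hx, map_neg]
  · rw [(adjacentOp_isHom hs hi).2.1, hx, map_neg]
  · rw [(adjacentOp_isHom hs hi).2.2, hx, map_neg]

theorem symRel_isStable {I : Type*} {t : I} {a : Matrix I I ℤ} {X : GenAction t V}
    (hs : GenAction.IsHom (X.tensor a X) (X.tensor a X) s) (n : ℕ) :
    (X.tensorPower a n).IsStable (symRel s n) := by
  refine ⟨fun l x hx => ?_, fun j x hx => ?_, fun j x hx => ?_⟩
  · refine symRel_le (N := (symRel s n).comap ((X.tensorPower a n).K l)) (fun i hi x hx => ?_) hx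
    exact mem_symRel hi (by rw [(adjacentOp_isHom hs hi).1, hx])
  · refine symRel_le (N := (symRel s n).comap ((X.tensorPower a n).E j)) (fun i hi x hx => ?_) hx
    exact mem_symRel hi (by rw [(adjacentOp_isHom hs hi).2.1, hx])
  · refine symRel_le (N := (symRel s n).comap ((X.tensorPower a n).F j)) (fun i hi x hx => ?_) hx
    exact mem_symRel hi (by rw [(adjacentOp_isHom hs hi).2.2, hx])

theorem prod_update_pair {n i : ℕ} (hi : i + 1 < n) (g : Fin n → ℂ) :
    ∏ k, g k = g ⟨i, by omega⟩ * g ⟨i + 1, hi⟩ *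
      ∏ k ∈ (Finset.univ.erase (⟨i, by omega⟩ : Fin n)).erase ⟨i + 1, hi⟩, g k := by
  have hmem : (⟨i + 1, hi⟩ : Fin n) ∈ Finset.univ.erase ⟨i, by omega⟩ := by simp
  rw [mul_assoc, Finset.mul_prod_erase _ _ hmem, Finset.mul_prod_erase _ _ (Finset.mem_univ _)]

/-- The form is the one for which the tensor products of an orthonormal basis are again orthonormal.
-/
theorem exists_powForm [FiniteDimensional ℂ V] {h : V →ₗ⋆[ℂ] V →ₗ[ℂ] ℂ} (hh : IsPosForm h) (n : ℕ) :
    ∃ H : (⨂[ℂ]^n V) →ₗ⋆[ℂ] (⨂[ℂ]^n V) →ₗ[ℂ] ℂ, IsPosForm H ∧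
      ∀ v w, H (PiTensorProduct.tprod ℂ v) (PiTensorProduct.tprod ℂ w) = ∏ i, h (v i) (w i) := by
  obtain ⟨e, he⟩ := hh.exists_basis
  let b := Basis.piTensorProduct (fun _ : Fin n => e)
  let H : (⨂[ℂ]^n V) →ₗ⋆[ℂ] (⨂[ℂ]^n V) →ₗ[ℂ] ℂ :=
    LinearMap.mk₂'ₛₗ (starRingEnd ℂ) (RingHom.id ℂ)
      (fun x y => ∑ p, starRingEnd ℂ (b.repr x p) * b.repr y p)
      (fun x x' y => by simp [add_mul, Finset.sum_add_distrib])
      (fun c x y => by simp [Finset.mul_sum, mul_assoc])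
      (fun x y y' => by simp [mul_add, Finset.sum_add_distrib])
      (fun c x y => by simp [Finset.mul_sum, mul_left_comm])
  have hH : ∀ x y, H x y = ∑ p, starRingEnd ℂ (b.repr x p) * b.repr y p := fun x y => rfl
  refine ⟨H, isPosForm_of_basis b H fun p p' => ?_, fun v w => ?_⟩
  · simp [hH, Finsupp.single_apply]
  · have key : ∀ v w, h v w = ∑ k, starRingEnd ℂ (e.repr v k) * e.repr w k := by
      intro v w
      conv_lhs => rw [← e.sum_repr v, ← e.sum_repr w]
      simp only [map_sum, LinearMap.map_smulₛₗ, LinearMap.sum_apply, LinearMap.smul_apply, he,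
        RingHom.id_apply, smul_eq_mul, mul_ite, mul_one, mul_zero,
        Finset.sum_ite_eq', Finset.mem_univ, if_true]
      exact Finset.sum_congr rfl fun _ _ => mul_comm _ _
    simp only [key, hH, b, Basis.piTensorProduct_repr_tprod_apply, map_prod,
      ← Finset.prod_mul_distrib]
    rw [Finset.prod_univ_sum]
    simp

theorem powForm_adjacentOp {h : V →ₗ⋆[ℂ] V →ₗ[ℂ] ℂ}
    {h₂ : V ⊗[ℂ] V →ₗ⋆[ℂ] V ⊗[ℂ] V →ₗ[ℂ] ℂ}
    (hh₂ : ∀ v w v' w', h₂ (v ⊗ₜ[ℂ] w) (v' ⊗ₜ[ℂ] w') = h v v' * h w w')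
    (hs : ∀ x y, h₂ (s x) y = h₂ x (s y)) {n : ℕ}
    {H : (⨂[ℂ]^n V) →ₗ⋆[ℂ] (⨂[ℂ]^n V) →ₗ[ℂ] ℂ}
    (hH : ∀ v w, H (PiTensorProduct.tprod ℂ v) (PiTensorProduct.tprod ℂ w) = ∏ i, h (v i) (w i))
    {i : ℕ} (hi : i + 1 < n) (x y : ⨂[ℂ]^n V) :
    H (adjacentOp s n i hi x) y = H x (adjacentOp s n i hi y) := by
  -- With the other entries fixed, the form on pairs inserted at `i`, `i + 1` is `h₂` times a
  -- constant, so self-adjointness of `s` passes to `s_i`.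
  have key : ∀ v w z z', H (insertPair n i hi v z) (insertPair n i hi w z') =
      h₂ z z' * ∏ k ∈ (Finset.univ.erase (⟨i, by omega⟩ : Fin n)).erase ⟨i + 1, hi⟩,
        h (v k) (w k) := by
    intro v w z z'
    induction z using TensorProduct.induction_on with
    | zero => simp
    | add x y hx hy => simp only [map_add, LinearMap.add_apply, hx, hy, add_mul]
    | tmul x y =>
      induction z' using TensorProduct.induction_on with
      | zero => simp
      | add x y hx hy => simp only [map_add, hx, hy, add_mul]
      | tmul x' y' =>
        rw [insertPair_tmul, insertPair_tmul, hH, prod_update_pair hi, hh₂]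
        congr 1
        · simp
        · refine Finset.prod_congr rfl fun k hk => ?_
          simp only [Finset.mem_erase, Finset.mem_univ, and_true] at hk
          simp [Function.update_of_ne hk.1, Function.update_of_ne hk.2]
  induction x using PiTensorProduct.induction_on with
  | add x x' hx hx' => simp [hx, hx']
  | smul_tprod c v =>
    simp only [map_smul, LinearMap.map_smulₛₗ, LinearMap.smul_apply]
    congr 1
    induction y using PiTensorProduct.induction_on with
    | add x x' hx hx' => simp [hx, hx']
    | smul_tprod c w =>
      simp only [map_smul]
      congr 1
      rw [← insertPair_self n i hi v, ← insertPair_self n i hi w, adjacentOp_insertPair,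
        adjacentOp_insertPair, key, key, hs]

theorem IsPosForm.exists_sub_orthogonal {E : Type*} [AddCommGroup E] [Module ℂ E]
    [FiniteDimensional ℂ E] {h : E →ₗ⋆[ℂ] E →ₗ[ℂ] ℂ} (hh : IsPosForm h) (N : Submodule ℂ E) (x : E) :
    ∃ y ∈ N, ∀ m ∈ N, h m (x - y) = 0 := by
  let _ := hh.core.toNormedAddCommGroup
  let _ : InnerProductSpace ℂ E := InnerProductSpace.ofCore hh.core.toCore
  obtain ⟨y, hy, z, hz, rfl⟩ := N.exists_add_mem_mem_orthogonal x
  exact ⟨y, hy, fun m hm => by rw [add_sub_cancel_left]; exact hz m hm⟩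

variable (s) in
/-- `s` is an involution that is self-adjoint for the square of a positive definite form. -/
def IsUnitaryInvolution : Prop :=
  (∀ x, s (s x) = x) ∧ ∃ (h : V →ₗ⋆[ℂ] V →ₗ[ℂ] ℂ) (h₂ : V ⊗[ℂ] V →ₗ⋆[ℂ] V ⊗[ℂ] V →ₗ[ℂ] ℂ),
    IsPosForm h ∧ (∀ v w v' w', h₂ (v ⊗ₜ[ℂ] w) (v' ⊗ₜ[ℂ] w') = h v v' * h w w') ∧
    ∀ x y, h₂ (s x) y = h₂ x (s y)

/-- For self-adjoint involutions, `ker (s_i + 1)` is the orthogonal complement of `ker (s_i - 1)`.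
Hence the intersection of the former is the orthogonal complement of the sum of the latter. -/
theorem isCompl_antisymTensors [FiniteDimensional ℂ V] (hs : IsUnitaryInvolution s) (n : ℕ) :
    IsCompl (antisymTensors s n) (symRel s n) := by
  obtain ⟨hinv, h, h₂, hh, hh₂, hself⟩ := hs
  obtain ⟨H, hHpos, hH⟩ := exists_powForm hh n
  have hadj : ∀ (i : ℕ) (hi : i + 1 < n) x y, H (adjacentOp s n i hi x) y =
      H x (adjacentOp s n i hi y) := fun i hi x y => powForm_adjacentOp hh₂ hself hH hi x y
  constructor
  · rw [Submodule.disjoint_def]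
    intro x hx hx'
    refine hHpos.eq_zero (le_of_eq ?_)
    have : symRel s n ≤ LinearMap.ker (H x) := symRel_le fun i hi y hy => by
      have h1 := hadj i hi x y
      rw [mem_antisymTensors.1 hx, hy, map_neg, LinearMap.neg_apply] at h1
      rw [LinearMap.mem_ker]
      linear_combination -(1 / 2 : ℂ) * h1
    rw [LinearMap.mem_ker.1 (this hx')]
    rfl
  · rw [codisjoint_iff, eq_top_iff]
    intro x _
    obtain ⟨y, hy, hxy⟩ := hHpos.exists_sub_orthogonal (symRel s n) x
    refine Submodule.mem_sup.2 ⟨x - y, ?_, y, hy, by simp⟩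
    rw [mem_antisymTensors]
    intro i hi
    rw [eq_neg_iff_add_eq_zero]
    refine hHpos.ext fun z => ?_
    rw [map_add, LinearMap.add_apply, hadj, ← map_add, hHpos.symm, hxy]
    · simp
    -- The vector `z + s_i z` is fixed by `s_i`, so it is a relation and is orthogonal to `x - y`.
    · exact mem_symRel hi (by rw [map_add, adjacentOp_involutive hinv]; abel)

/-! ### The quantum exterior algebra -/

theorem toTensorAlgebra_insertPair {n i : ℕ} (hi : i + 1 < n) (v : Fin n → V) (z : V ⊗[ℂ] V) :
    TensorPower.toTensorAlgebra (insertPair n i hi v z) =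
      ((List.ofFn fun k => TensorAlgebra.ι ℂ (v k)).take i).prod * tensorSquareToAlgebra z *
        ((List.ofFn fun k => TensorAlgebra.ι ℂ (v k)).drop (i + 2)).prod := by
  induction z using TensorProduct.induction_on with
  | zero => simp
  | add x y hx hy => simp only [map_add, hx, hy, mul_add, add_mul]
  | tmul x y =>
    rw [insertPair_tmul, TensorPower.toTensorAlgebra_tprod, TensorAlgebra.tprod_apply]
    have h1 : tensorSquareToAlgebra (x ⊗ₜ[ℂ] y) =
        [TensorAlgebra.ι ℂ x, TensorAlgebra.ι ℂ y].prod := by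
      simp [tensorSquareToAlgebra]
    rw [h1, ← List.prod_append, ← List.prod_append]
    congr 1
    refine List.ext_getElem (by simp; omega) fun k h1 h2 => ?_
    simp only [List.length_ofFn] at h1
    rw [List.getElem_ofFn]
    rcases lt_trichotomy k i with h | rfl | h
    · rw [List.getElem_append_left (by simp; omega), List.getElem_append_left (by simp; omega),
        List.getElem_take,
        List.getElem_ofFn, Function.update_of_ne (by simp; omega),
        Function.update_of_ne (by simp; omega)]
    · rw [List.getElem_append_left (by simp; omega), List.getElem_append_right (by simp),
        Function.update_of_ne (by simp), Function.update_self]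
      simp [show min k n = k by omega]
    · by_cases h' : k = i + 1
      · subst h'
        rw [List.getElem_append_left (by simp; omega), List.getElem_append_right (by simp),
          Function.update_self]
        simp [show min i n = i by omega]
      · rw [List.getElem_append_right (by simp; omega),
          Function.update_of_ne (by simp; omega), Function.update_of_ne (by simp; omega)]
        simp only [List.length_append, List.length_take, List.length_ofFn, List.getElem_drop,
          List.getElem_ofFn, List.length_cons, List.length_nil]
        congr 3
        omega

theorem toDirectSum_toTensorAlgebra {n : ℕ} (x : ⨂[ℂ]^n V) :
    TensorAlgebra.toDirectSum (TensorPower.toTensorAlgebra x) =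
      DirectSum.of (fun n => ⨂[ℂ]^n V) n x := by
  refine tensorPower_hom_ext
    (f := TensorAlgebra.toDirectSum.toLinearMap ∘ₗ TensorPower.toTensorAlgebra)
    (g := DirectSum.lof ℂ ℕ (fun n => ⨂[ℂ]^n V) n) (fun v => ?_) x
  simp only [LinearMap.comp_apply, TensorPower.toTensorAlgebra_tprod]
  exact TensorAlgebra.toDirectSum_tensorPower_tprod v

theorem tensorAlgebra_mem_of_list {N : Submodule ℂ (TensorAlgebra ℂ V)}
    (h : ∀ L : List V, (L.map (TensorAlgebra.ι ℂ)).prod ∈ N) (x : TensorAlgebra ℂ V) : x ∈ N := by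
  have h1 : x ∈ Algebra.adjoin ℂ (Set.range (TensorAlgebra.ι ℂ (M := V))) := by
    rw [TensorAlgebra.adjoin_range_ι]
    trivial
  rw [← Subalgebra.mem_toSubmodule, Algebra.adjoin_eq_span] at h1
  refine Submodule.span_le.2 ?_ h1
  intro y hy
  obtain ⟨L, hL, rfl⟩ := Submonoid.exists_list_of_mem_closure hy
  choose g hg using fun y : {y // y ∈ L} => hL y.1 y.2
  have : L = (L.attach.map g).map (TensorAlgebra.ι ℂ) := by
    rw [List.map_map]
    conv_lhs => rw [← List.attach_map_subtype_val L]
    exact List.map_congr_left fun y _ => (hg y).symm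
  rw [this]
  exact h _

/-- By linearity `x` and `y` may be taken to be words. The product is then homogeneous: `z` is
inserted into a tensor at the position given by the length of the first word. -/
theorem toDirectSum_mul_tensorSquare_mul_mem {z : V ⊗[ℂ] V} (hz : s z = z)
    (x y : TensorAlgebra ℂ V) (n : ℕ) :
    TensorAlgebra.toDirectSum (x * tensorSquareToAlgebra z * y) n ∈ symRel s n := by
  let p : TensorAlgebra ℂ V →ₗ[ℂ] ⨂[ℂ]^n V :=
    DirectSum.component ℂ ℕ (fun n => ⨂[ℂ]^n V) n ∘ₗ TensorAlgebra.toDirectSum.toLinearMap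
  refine tensorAlgebra_mem_of_list (N := (symRel s n).comap (p ∘ₗ LinearMap.mulRight ℂ y ∘ₗ
    LinearMap.mulRight ℂ (tensorSquareToAlgebra z))) (fun L => ?_) x
  refine tensorAlgebra_mem_of_list (N := (symRel s n).comap (p ∘ₗ
    LinearMap.mulLeft ℂ ((L.map (TensorAlgebra.ι ℂ)).prod * tensorSquareToAlgebra z)))
    (fun L' => ?_) y
  change TensorAlgebra.toDirectSum ((L.map (TensorAlgebra.ι ℂ)).prod * tensorSquareToAlgebra z *
    (L'.map (TensorAlgebra.ι ℂ)).prod) n ∈ symRel s n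
  -- The two zeros are placeholders, overwritten by `insertPair`.
  let M := L ++ [0, 0] ++ L'
  have hM : M.length = L.length + 2 + L'.length := by simp [M]; omega
  have hi : L.length + 1 < M.length := by omega
  have key := toTensorAlgebra_insertPair hi (fun k => M[k]) z
  have hof : (List.ofFn fun k : Fin M.length => TensorAlgebra.ι ℂ M[k]) =
      M.map (TensorAlgebra.ι ℂ) := by
    refine List.ext_getElem (by simp) fun k h1 h2 => by simp
  rw [hof, ← List.map_take, ← List.map_drop] at key
  have e1 : M.take L.length = L := by simp [M]
  have e2 : M.drop (L.length + 2) = L' := by simp [M, List.drop_append]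
  rw [e1, e2] at key
  rw [← key, toDirectSum_toTensorAlgebra]
  by_cases hn : M.length = n
  · subst hn
    rw [DirectSum.of_eq_same]
    exact insertPair_mem_symRel hi _ hz
  · rw [DirectSum.of_eq_of_ne _ _ _ (Ne.symm hn)]
    exact Submodule.zero_mem _

/-- The quotient ring is defined by a congruence, so membership in the ideal must be extracted. Let
`J` be the left ideal generated by the right multiples of the relations. The relations act by zero
on `T(V) / J`, so `Λ_q(V)` acts there, and an `x` that vanishes in `Λ_q(V)` kills the class of `1`,
whence `x ∈ J`. -/
theorem toDirectSum_mem_of_toQExt_eq_zero {x : TensorAlgebra ℂ V} (hx : toQExt s x = 0) (n : ℕ) :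
    TensorAlgebra.toDirectSum x n ∈ symRel s n := by
  let S : Set (TensorAlgebra ℂ V) :=
    {x | ∃ z, s z = z ∧ ∃ y, x = tensorSquareToAlgebra z * y}
  let J : Ideal (TensorAlgebra ℂ V) := Ideal.span S
  let f : TensorAlgebra ℂ V →ₐ[ℂ] Module.End ℂ (TensorAlgebra ℂ V ⧸ J) :=
    Algebra.lsmul ℂ ℂ (TensorAlgebra ℂ V ⧸ J)
  have hfapp : ∀ x u, f x u = x • u := fun x u => rfl
  have hf : ∀ ⦃x y⦄, ExtRel s x y → f x = f y := by
    rintro _ _ ⟨z, hz, rfl, rfl⟩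
    rw [map_zero]
    refine LinearMap.ext fun u => ?_
    obtain ⟨u, rfl⟩ := Submodule.Quotient.mk_surjective _ u
    rw [hfapp, LinearMap.zero_apply, ← Submodule.Quotient.mk_smul, Submodule.Quotient.mk_eq_zero]
    exact Ideal.subset_span ⟨z, by simpa [sub_eq_zero] using hz, u, rfl⟩
  have hxJ : x ∈ J := by
    have h1 : RingQuot.liftAlgHom ℂ ⟨f, hf⟩ (toQExt s x) = f x :=
      RingQuot.liftAlgHom_mkAlgHom_apply ℂ f hf x
    rw [hx, map_zero] at h1
    have h2 := LinearMap.congr_fun h1 (Submodule.Quotient.mk 1)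
    rw [LinearMap.zero_apply, hfapp] at h2
    rwa [← Submodule.Quotient.mk_smul, eq_comm, Submodule.Quotient.mk_eq_zero, smul_eq_mul,
      mul_one] at h2
  suffices h : ∀ u, TensorAlgebra.toDirectSum (u * x) n ∈ symRel s n by simpa using h 1
  refine Submodule.span_induction (p := fun x _ => ∀ u, TensorAlgebra.toDirectSum (u * x) n ∈
    symRel s n) ?_ ?_ ?_ ?_ hxJ
  · rintro _ ⟨z, hz, y, rfl⟩ u
    rw [← mul_assoc]
    exact toDirectSum_mul_tensorSquare_mul_mem hz u y n
  · intro u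
    simp
  · intro x y _ _ hx hy u
    rw [mul_add, map_add, DirectSum.add_apply]
    exact Submodule.add_mem _ (hx u) (hy u)
  · intro c x _ hx u
    rw [smul_eq_mul, ← mul_assoc]
    exact hx (u * c)

theorem ker_tensorToExt (hs : ∀ x, s (s x) = x) (n : ℕ) :
    LinearMap.ker (tensorToExt s n) = symRel s n := by
  refine le_antisymm (fun x hx => ?_) (symRel_le fun i hi x hx => ?_)
  · have h1 : toQExt s (TensorPower.toTensorAlgebra x) = 0 := congrArg Subtype.val hx
    have h2 := toDirectSum_mem_of_toQExt_eq_zero h1 n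
    rwa [toDirectSum_toTensorAlgebra, DirectSum.of_eq_same] at h2
  · have h1 : ∀ v z, s z = z → tensorToExt s n (insertPair n i hi v z) = 0 := by
      intro v z hz
      refine Subtype.ext ?_
      change toQExt s (TensorPower.toTensorAlgebra _) = 0
      have h2 : toQExt s (tensorSquareToAlgebra z) = 0 := by
        rw [← map_zero (toQExt s)]
        exact RingQuot.mkAlgHom_rel ℂ ⟨z, by simp [hz], rfl, rfl⟩
      rw [toTensorAlgebra_insertPair, map_mul, map_mul, h2, mul_zero, zero_mul]
    -- Since `s` is an involution, `z + s z` is a relation for every `z`. A tensor `x` fixed by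
    -- `s_i` satisfies `(s_i + 1) x = 2 x`, so its image vanishes too.
    have h2 : tensorToExt s n ∘ₗ (adjacentOp s n i hi + LinearMap.id) = 0 := by
      refine LinearMap.ext fun x => tensorPower_hom_ext
        (f := tensorToExt s n ∘ₗ (adjacentOp s n i hi + LinearMap.id)) (g := 0) (fun v => ?_) x
      rw [LinearMap.comp_apply, LinearMap.add_apply, adjacentOp_tprod, LinearMap.id_apply]
      rw [LinearMap.zero_apply]
      rw [← insertPair_self n i hi v, ← map_add]
      exact h1 _ _ (by rw [map_add, hs, add_comm])
    have h3 := LinearMap.congr_fun h2 x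
    rw [LinearMap.comp_apply, LinearMap.add_apply, hx, LinearMap.id_apply, map_add,
      LinearMap.zero_apply, ← two_smul ℂ] at h3
    exact (smul_eq_zero.1 h3).resolve_left two_ne_zero

theorem tensorToExt_surjective (n : ℕ) : Function.Surjective (tensorToExt s n) := by
  rintro ⟨x, hx⟩
  suffices h : x ∈ LinearMap.range ((toQExt s).toLinearMap ∘ₗ
      (TensorPower.toTensorAlgebra : (⨂[ℂ]^n V) →ₗ[ℂ] _)) by
    obtain ⟨y, hy⟩ := h
    exact ⟨y, Subtype.ext hy⟩
  rw [QExtPow, Submodule.pow_eq_span_pow_set] at hx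
  refine Submodule.span_le.2 ?_ hx
  intro y hy
  obtain ⟨f, rfl⟩ := Set.mem_pow.1 hy
  choose g hg using fun i => (f i).2
  refine ⟨PiTensorProduct.tprod ℂ g, ?_⟩
  rw [LinearMap.comp_apply, TensorPower.toTensorAlgebra_tprod, TensorAlgebra.tprod_apply]
  change toQExt s _ = _
  rw [map_list_prod, List.map_ofFn]
  congr 2
  funext i
  exact hg i

theorem antisymToExt_bijective [FiniteDimensional ℂ V] (hs : IsUnitaryInvolution s) (n : ℕ) :
    Function.Bijective (antisymToExt s n) := by
  have hc := isCompl_antisymTensors hs n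
  have hk := ker_tensorToExt hs.1 n
  constructor
  · rw [injective_iff_map_eq_zero]
    rintro ⟨x, hx⟩ h0
    have h1 : x ∈ symRel s n := by
      rw [← hk]
      exact h0
    exact Subtype.ext (Submodule.disjoint_def.1 hc.disjoint x hx h1)
  · intro y
    obtain ⟨x, rfl⟩ := tensorToExt_surjective n y
    obtain ⟨u, hu, r, hr, rfl⟩ := Submodule.mem_sup.1 (hc.sup_eq_top ▸ Submodule.mem_top : x ∈ _)
    refine ⟨⟨u, hu⟩, ?_⟩
    rw [← hk] at hr
    rw [map_add, LinearMap.mem_ker.1 hr, add_zero]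
    rfl

end TensorPower

end

end QuantumNilradical

/-! ### The pairing of exterior powers and the induced actions. -/

namespace QuantumNilradical

open scoped TensorProduct

noncomputable section

/-! ### Pairings of tensor powers -/

section Pairing

variable {V W : Type*} [AddCommGroup V] [Module ℂ V] [AddCommGroup W] [Module ℂ W]
  {B : W →ₗ[ℂ] V →ₗ[ℂ] ℂ}

theorem tensorPower_hom_ext₂ {n : ℕ} {f g : (⨂[ℂ]^n W) →ₗ[ℂ] (⨂[ℂ]^n V) →ₗ[ℂ] ℂ}
    (h : ∀ w v, f (PiTensorProduct.tprod ℂ w) (PiTensorProduct.tprod ℂ v) =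
      g (PiTensorProduct.tprod ℂ w) (PiTensorProduct.tprod ℂ v)) (y x) : f y x = g y x :=
  LinearMap.congr_fun (tensorPower_hom_ext (f := f) (g := g)
    (fun w => LinearMap.ext fun x => tensorPower_hom_ext (fun v => h w v) x) y) x

/-- Reversal of the factors sends the positions `i`, `i + 1` to `j + 1`, `j`, where `i + j + 2 = n`
because counting starts at `0`. On these two positions the pairing is `pairingSq`. -/
theorem tensorPairing_adjacentOp {s : V ⊗[ℂ] V →ₗ[ℂ] V ⊗[ℂ] V} {s' : W ⊗[ℂ] W →ₗ[ℂ] W ⊗[ℂ] W}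
    (hs : ∀ y x, GenAction.pairingSq B (s' y) x = GenAction.pairingSq B y (s x)) {n i j : ℕ}
    (hi : i + 1 < n) (hj : j + 1 < n) (hij : i + j + 2 = n) (y : ⨂[ℂ]^n W) (x : ⨂[ℂ]^n V) :
    tensorPairing B n (adjacentOp s' n i hi y) x = tensorPairing B n y (adjacentOp s n j hj x) := by
  have key : ∀ v w z z', tensorPairing B n (insertPair n i hi v z) (insertPair n j hj w z') =
      GenAction.pairingSq B z z' *
        ∏ k ∈ (Finset.univ.erase (⟨i, by omega⟩ : Fin n)).erase ⟨i + 1, hi⟩, B (v k) (w k.rev) := by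
    intro v w z z'
    induction z using TensorProduct.induction_on with
    | zero => simp
    | add x y hx hy => simp only [map_add, LinearMap.add_apply, hx, hy, add_mul]
    | tmul x y =>
      induction z' using TensorProduct.induction_on with
      | zero => simp
      | add x y hx hy => simp only [map_add, hx, hy, add_mul]
      | tmul x' y' =>
        have r1 : (⟨i, by omega⟩ : Fin n).rev = ⟨j + 1, hj⟩ := by
          ext; simp only [Fin.val_rev]; omega
        have r2 : (⟨i + 1, hi⟩ : Fin n).rev = ⟨j, by omega⟩ := by
          ext; simp only [Fin.val_rev]; omega
        rw [insertPair_tmul, insertPair_tmul, tensorPairing_tprod, prod_update_pair hi,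
          GenAction.pairingSq_tmul, r1, r2]
        congr 1
        · simp [mul_comm]
        · refine Finset.prod_congr rfl fun k hk => ?_
          simp only [Finset.mem_erase, Finset.mem_univ, and_true] at hk
          rw [Function.update_of_ne hk.1, Function.update_of_ne hk.2,
            Function.update_of_ne (fun h => hk.2 (by rw [← Fin.rev_rev k, h, ← r1, Fin.rev_rev])),
            Function.update_of_ne (fun h => hk.1 (by rw [← Fin.rev_rev k, h, ← r2, Fin.rev_rev]))]
  refine tensorPower_hom_ext₂ (f := (tensorPairing B n).comp (adjacentOp s' n i hi))
    (g := (tensorPairing B n).compl₂ (adjacentOp s n j hj)) (fun w v => ?_) y x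
  rw [LinearMap.comp_apply, LinearMap.compl₂_apply, ← insertPair_self n i hi w,
    ← insertPair_self n j hj v, adjacentOp_insertPair, adjacentOp_insertPair, key, key, hs]

/-- Transposing `s_j` multiplies the pairing by `1` on one side and by `-1` on the other, so it
vanishes. -/
theorem tensorPairing_antisym_symRel {s : V ⊗[ℂ] V →ₗ[ℂ] V ⊗[ℂ] V} {s' : W ⊗[ℂ] W →ₗ[ℂ] W ⊗[ℂ] W}
    (hs : ∀ y x, GenAction.pairingSq B (s' y) x = GenAction.pairingSq B y (s x)) {n : ℕ}
    {y : ⨂[ℂ]^n W} (hy : y ∈ antisymTensors s' n) {x : ⨂[ℂ]^n V} (hx : x ∈ symRel s n) :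
    tensorPairing B n y x = 0 := by
  have : symRel s n ≤ LinearMap.ker (tensorPairing B n y) := symRel_le fun j hj x hx => by
    have h1 := tensorPairing_adjacentOp hs (i := n - 2 - j) (by omega) hj (by omega) y x
    rw [mem_antisymTensors.1 hy, hx, map_neg, LinearMap.neg_apply] at h1
    rw [LinearMap.mem_ker]
    linear_combination -(1 / 2 : ℂ) * h1
  exact this hx

theorem tensorPairing_symRel_antisym {s : V ⊗[ℂ] V →ₗ[ℂ] V ⊗[ℂ] V} {s' : W ⊗[ℂ] W →ₗ[ℂ] W ⊗[ℂ] W}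
    (hs : ∀ y x, GenAction.pairingSq B (s' y) x = GenAction.pairingSq B y (s x)) {n : ℕ}
    {y : ⨂[ℂ]^n W} (hy : y ∈ symRel s' n) {x : ⨂[ℂ]^n V} (hx : x ∈ antisymTensors s n) :
    tensorPairing B n y x = 0 := by
  have : symRel s' n ≤ LinearMap.ker ((tensorPairing B n).flip x) := symRel_le fun i hi y hy => by
    have h1 := tensorPairing_adjacentOp hs (j := n - 2 - i) hi (by omega) (by omega) y x
    rw [mem_antisymTensors.1 hx, hy, map_neg] at h1
    rw [LinearMap.mem_ker, LinearMap.flip_apply]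
    linear_combination (1 / 2 : ℂ) * h1
  exact this hy

/-- For dual bases of `W` and `V`, the coordinates of a tensor are its pairings with the basis
tensors in reversed order. -/
theorem tensorPairing_nondegenerate [FiniteDimensional ℂ V] [FiniteDimensional ℂ W]
    (hB : B.Nondegenerate) (n : ℕ) : (tensorPairing B n).Nondegenerate := by
  have hp : B.IsPerfPair := LinearMap.IsPerfPair.of_injective
    (LinearMap.ker_eq_bot.1 (LinearMap.separatingLeft_iff_ker_eq_bot.1 hB.1))
    (LinearMap.ker_eq_bot.1 (LinearMap.separatingRight_iff_flip_ker_eq_bot.1 hB.2))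
  let b := Module.finBasis ℂ V
  let b' := b.dualBasis.map B.toPerfPair.symm
  have hbb : ∀ i j, B (b' i) (b j) = if i = j then 1 else 0 := by
    intro i j
    have : B (b' i) = b.dualBasis i := B.toPerfPair.apply_symm_apply (b.dualBasis i)
    rw [this, Module.Basis.dualBasis_apply_self]
    simp only [eq_comm]
  have hval : ∀ p p' : Fin n → Fin (Module.finrank ℂ V),
      tensorPairing B n (PiTensorProduct.tprod ℂ fun i => b' (p i))
        (PiTensorProduct.tprod ℂ fun i => b (p' i)) = if p = p' ∘ Fin.rev then 1 else 0 := by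
    intro p p'
    rw [tensorPairing_tprod]
    simp only [hbb]
    split_ifs with h
    · exact Finset.prod_eq_one fun i _ => if_pos (congrFun h i)
    · obtain ⟨i, hi⟩ := Function.ne_iff.1 h
      exact Finset.prod_eq_zero (Finset.mem_univ i) (if_neg hi)
  constructor
  · intro y hy
    let bn := Basis.piTensorProduct (fun _ : Fin n => b')
    refine bn.ext_elem fun p => ?_
    have : bn.coord p = (tensorPairing B n).flip (PiTensorProduct.tprod ℂ fun i => b (p i.rev)) := by
      refine bn.ext fun p' => ?_
      rw [Module.Basis.coord_apply, Module.Basis.repr_self, Finsupp.single_apply,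
        LinearMap.flip_apply, Basis.piTensorProduct_apply, hval]
      congr 1
      simp [funext_iff]
    have h1 := LinearMap.congr_fun this y
    rw [LinearMap.flip_apply, hy, Module.Basis.coord_apply] at h1
    simp [h1]
  · intro x hx
    let bn := Basis.piTensorProduct (fun _ : Fin n => b)
    refine bn.ext_elem fun p => ?_
    have : bn.coord p = tensorPairing B n (PiTensorProduct.tprod ℂ fun i => b' (p i.rev)) := by
      refine bn.ext fun p' => ?_
      rw [Module.Basis.coord_apply, Module.Basis.repr_self, Finsupp.single_apply,
        Basis.piTensorProduct_apply, hval]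
      congr 1
      simp only [funext_iff, Function.comp_apply, eq_iff_iff]
      exact ⟨fun h i => (h i.rev).symm, fun h i => by simpa using (h i.rev).symm⟩
    have h1 := LinearMap.congr_fun this x
    rw [hx, Module.Basis.coord_apply] at h1
    simp [h1]

section Invariance

variable {I : Type*} {t : I} {a : Matrix I I ℤ}

theorem tensorPower_K_tprod (X : GenAction t V) (n : ℕ) (l : Weight I) (v : Fin n → V) :
    (X.tensorPower a n).K l (PiTensorProduct.tprod ℂ v) =
      PiTensorProduct.tprod ℂ fun i => X.K l (v i) :=
  PiTensorProduct.map_tprod _ _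

theorem tensorPower_E_tprod (X : GenAction t V) (n : ℕ) (j) (v : Fin n → V) :
    (X.tensorPower a n).E j (PiTensorProduct.tprod ℂ v) =
      ∑ k : Fin n, PiTensorProduct.tprod ℂ fun i =>
        (if i < k then X.K (simpleRoot a j.1) else if i = k then X.E j else LinearMap.id) (v i) :=
  (LinearMap.sum_apply _ _ _).trans
    (Finset.sum_congr rfl fun _ _ => PiTensorProduct.map_tprod _ _)

theorem tensorPower_F_tprod (X : GenAction t V) (n : ℕ) (j) (v : Fin n → V) :
    (X.tensorPower a n).F j (PiTensorProduct.tprod ℂ v) =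
      ∑ k : Fin n, PiTensorProduct.tprod ℂ fun i =>
        (if i < k then LinearMap.id else if i = k then X.F j else X.K (-simpleRoot a j.1)) (v i) :=
  (LinearMap.sum_apply _ _ _).trans
    (Finset.sum_congr rfl fun _ _ => PiTensorProduct.map_tprod _ _)

theorem prod_add_prod_eq_zero {n : ℕ} (k : Fin n) {g g' : Fin n → ℂ}
    (h : ∀ i, i ≠ k → g i = g' i) (h0 : g k + g' k = 0) : ∏ i, g i + ∏ i, g' i = 0 := by
  rw [← Finset.mul_prod_erase _ _ (Finset.mem_univ k),
    ← Finset.mul_prod_erase _ g' (Finset.mem_univ k),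
    Finset.prod_congr rfl (fun i hi => h i (Finset.ne_of_mem_erase hi)), ← add_mul, h0, zero_mul]

variable {X : GenAction t V} {Y : GenAction t W} (hB : GenAction.IsInvariantPairing a Y X B) (n : ℕ)
include hB

theorem tensorPairing_invariant_K (l : Weight I) (y : ⨂[ℂ]^n W) (x : ⨂[ℂ]^n V) :
    tensorPairing B n ((Y.tensorPower a n).K l y) ((X.tensorPower a n).K l x) =
      tensorPairing B n y x := by
  refine tensorPower_hom_ext₂ (f := (tensorPairing B n).compl₁₂ ((Y.tensorPower a n).K l)
    ((X.tensorPower a n).K l)) (g := tensorPairing B n) (fun w v => ?_) y x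
  rw [LinearMap.compl₁₂_apply, tensorPower_K_tprod, tensorPower_K_tprod, tensorPairing_tprod,
    tensorPairing_tprod]
  exact Finset.prod_congr rfl fun i _ => hB.1 l _ _

theorem tensorPairing_invariant_E (j) (y : ⨂[ℂ]^n W) (x : ⨂[ℂ]^n V) :
    tensorPairing B n ((Y.tensorPower a n).E j y) x +
      tensorPairing B n ((Y.tensorPower a n).K (simpleRoot a j.1) y) ((X.tensorPower a n).E j x) =
      0 := by
  refine tensorPower_hom_ext₂ (f := (tensorPairing B n).comp ((Y.tensorPower a n).E j) +
    (tensorPairing B n).compl₁₂ ((Y.tensorPower a n).K (simpleRoot a j.1))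
      ((X.tensorPower a n).E j)) (g := 0) (fun w v => ?_) y x
  rw [LinearMap.add_apply, LinearMap.add_apply, LinearMap.comp_apply, LinearMap.compl₁₂_apply,
    tensorPower_K_tprod, tensorPower_E_tprod, tensorPower_E_tprod, map_sum, map_sum,
    LinearMap.sum_apply]
  simp only [tensorPairing_tprod]
  -- The summand with `E_j` at `k` on one side cancels the one with `E_j` at the reversed position
  -- on the other. The remaining factors agree, because reversal exchanges the places before and
  -- after `k` and `B` is invariant under `K_j`.
  rw [← Equiv.sum_comp Fin.revPerm (fun k => ∏ i : Fin n, B (Y.K (simpleRoot a j.1) (w i)) _),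
    ← Finset.sum_add_distrib]
  refine Finset.sum_eq_zero fun k _ => prod_add_prod_eq_zero k (fun i hik => ?_) ?_
  · rcases lt_or_gt_of_ne hik with h | h
    · simp [h, hik, h.not_gt]
    · simp [h, hik, h.not_gt, hB.1]
  · simpa using hB.2.1 j _ _

theorem tensorPairing_invariant_F (j) (y : ⨂[ℂ]^n W) (x : ⨂[ℂ]^n V) :
    tensorPairing B n ((Y.tensorPower a n).F j y) ((X.tensorPower a n).K (-simpleRoot a j.1) x) +
      tensorPairing B n y ((X.tensorPower a n).F j x) = 0 := by
  refine tensorPower_hom_ext₂ (f := (tensorPairing B n).compl₁₂ ((Y.tensorPower a n).F j)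
      ((X.tensorPower a n).K (-simpleRoot a j.1)) +
    (tensorPairing B n).compl₂ ((X.tensorPower a n).F j)) (g := 0) (fun w v => ?_) y x
  rw [LinearMap.add_apply, LinearMap.add_apply, LinearMap.compl₂_apply, LinearMap.compl₁₂_apply,
    tensorPower_K_tprod, tensorPower_F_tprod, tensorPower_F_tprod, map_sum, map_sum,
    LinearMap.sum_apply]
  simp only [tensorPairing_tprod]
  rw [← Equiv.sum_comp Fin.revPerm (fun k => ∏ i : Fin n, B (w i) _), ← Finset.sum_add_distrib]
  refine Finset.sum_eq_zero fun k _ => prod_add_prod_eq_zero k (fun i hik => ?_) ?_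
  · rcases lt_or_gt_of_ne hik with h | h
    · simp [h, hik, h.not_gt]
    · simp [h, hik, h.not_gt, hB.1]
  · simpa using hB.2.2 j _ _

theorem tensorPairing_isInvariant :
    GenAction.IsInvariantPairing a (Y.tensorPower a n) (X.tensorPower a n) (tensorPairing B n) :=
  ⟨tensorPairing_invariant_K hB n, tensorPairing_invariant_E hB n, tensorPairing_invariant_F hB n⟩

end Invariance

end Pairing

/-! ### The action on the quantum exterior powers -/

section Descent

variable {V : Type*} [AddCommGroup V] [Module ℂ V] {s : V ⊗[ℂ] V →ₗ[ℂ] V ⊗[ℂ] V} {n : ℕ}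
  (hb : Function.Bijective (antisymToExt s n))

/-- The antisymmetric representative of an element of the quantum exterior power. -/
def extLift : QExtPow s n →ₗ[ℂ] ⨂[ℂ]^n V :=
  (antisymTensors s n).subtype ∘ₗ (LinearEquiv.ofBijective _ hb).symm.toLinearMap

theorem extLift_mem (y : QExtPow s n) : extLift hb y ∈ antisymTensors s n :=
  ((LinearEquiv.ofBijective _ hb).symm y).2

theorem tensorToExt_extLift (y : QExtPow s n) : tensorToExt s n (extLift hb y) = y :=
  (LinearEquiv.ofBijective _ hb).apply_symm_apply y

theorem extLift_tensorToExt {x : ⨂[ℂ]^n V} (hx : x ∈ antisymTensors s n) :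
    extLift hb (tensorToExt s n x) = x :=
  congrArg Subtype.val ((LinearEquiv.ofBijective _ hb).symm_apply_apply ⟨x, hx⟩)

/-- The operator on the quantum exterior power induced by an operator on the tensor power. -/
def extDescend (A : Module.End ℂ (⨂[ℂ]^n V)) : Module.End ℂ (QExtPow s n) :=
  tensorToExt s n ∘ₗ A ∘ₗ extLift hb

/-- A tensor and the antisymmetric representative of its class differ by an element of `symRel`,
which `A` preserves. -/
theorem extDescend_tensorToExt (hs : ∀ x, s (s x) = x) {A : Module.End ℂ (⨂[ℂ]^n V)}
    (hA : ∀ x ∈ symRel s n, A x ∈ symRel s n) (x : ⨂[ℂ]^n V) :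
    tensorToExt s n (A x) = extDescend hb A (tensorToExt s n x) := by
  have hk := ker_tensorToExt hs n
  change tensorToExt s n (A x) = tensorToExt s n (A (extLift hb (tensorToExt s n x)))
  refine (LinearMap.sub_mem_ker_iff (R := ℂ) (R₂ := ℂ) (M := ⨂[ℂ]^n V) (M₂ := QExtPow s n)
    (f := tensorToExt s n)).1 ?_
  rw [hk, ← map_sub]
  refine hA _ ?_
  rw [← hk]
  exact (LinearMap.sub_mem_ker_iff (R := ℂ) (R₂ := ℂ) (M := ⨂[ℂ]^n V) (M₂ := QExtPow s n)
    (f := tensorToExt s n)).2 (tensorToExt_extLift hb _).symm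

theorem extLift_extDescend {A : Module.End ℂ (⨂[ℂ]^n V)}
    (hA : ∀ x ∈ antisymTensors s n, A x ∈ antisymTensors s n) (y : QExtPow s n) :
    extLift hb (extDescend hb A y) = A (extLift hb y) :=
  extLift_tensorToExt hb (hA _ (extLift_mem hb y))

/-- The action on the quantum exterior power induced by an action on the tensor power. -/
def extAction {I : Type*} {t : I} (X : GenAction t (⨂[ℂ]^n V)) : GenAction t (QExtPow s n) where
  K l := extDescend hb (X.K l)
  E j := extDescend hb (X.E j)
  F j := extDescend hb (X.F j)

theorem extAction_isHom {I : Type*} {t : I} {a : Matrix I I ℤ} {X : GenAction t V}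
    (hs : ∀ x, s (s x) = x) (hhom : GenAction.IsHom (X.tensor a X) (X.tensor a X) s) :
    GenAction.IsHom (X.tensorPower a n) (extAction hb (X.tensorPower a n)) (tensorToExt s n) :=
  ⟨fun l x => extDescend_tensorToExt hb hs ((symRel_isStable hhom n).K l) x,
    fun j x => extDescend_tensorToExt hb hs ((symRel_isStable hhom n).E j) x,
    fun j x => extDescend_tensorToExt hb hs ((symRel_isStable hhom n).F j) x⟩

variable {W : Type*} [AddCommGroup W] [Module ℂ W] {s' : W ⊗[ℂ] W →ₗ[ℂ] W ⊗[ℂ] W}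
  (hb' : Function.Bijective (antisymToExt s' n)) {B : W →ₗ[ℂ] V →ₗ[ℂ] ℂ}

theorem extPairing_apply (y x) :
    extPairing B s' s n hb' hb y x = tensorPairing B n (extLift hb' y) (extLift hb x) := rfl

/-- An antisymmetric tensor pairs to zero with the relations on the other side. If it also
annihilates the antisymmetric tensors there, it annihilates the whole tensor power and vanishes. -/
theorem extPairing_nondegenerate [FiniteDimensional ℂ V] [FiniteDimensional ℂ W]
    (hs : IsUnitaryInvolution s) (hs' : IsUnitaryInvolution s') (hB : B.Nondegenerate)
    (hss : ∀ y x, GenAction.pairingSq B (s' y) x = GenAction.pairingSq B y (s x)) :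
    (extPairing B s' s n hb' hb).Nondegenerate := by
  have hnd := tensorPairing_nondegenerate hB n
  constructor
  · intro y hy
    rw [← tensorToExt_extLift hb' y]
    rw [hnd.1 (extLift hb' y) fun x => ?_, map_zero]
    obtain ⟨u, hu, r, hr, rfl⟩ := Submodule.mem_sup.1
      ((isCompl_antisymTensors hs n).sup_eq_top ▸ Submodule.mem_top : x ∈ _)
    rw [map_add, tensorPairing_antisym_symRel hss (extLift_mem hb' y) hr, add_zero,
      ← extLift_tensorToExt hb hu]
    exact hy _
  · intro x hx
    rw [← tensorToExt_extLift hb x]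
    rw [hnd.2 (extLift hb x) fun y => ?_, map_zero]
    obtain ⟨u, hu, r, hr, rfl⟩ := Submodule.mem_sup.1
      ((isCompl_antisymTensors hs' n).sup_eq_top ▸ Submodule.mem_top : y ∈ _)
    rw [map_add, LinearMap.add_apply, tensorPairing_symRel_antisym hss hr (extLift_mem hb x),
      add_zero, ← extLift_tensorToExt hb' hu]
    exact hx _

/-- Antisymmetric tensors are stable under the action, so taking representatives intertwines the
actions and the invariance is that of `tensorPairing`. -/
theorem extPairing_isInvariant {I : Type*} {t : I} {a : Matrix I I ℤ} {X : GenAction t V}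
    {Y : GenAction t W} (hB : GenAction.IsInvariantPairing a Y X B)
    (hhom : GenAction.IsHom (X.tensor a X) (X.tensor a X) s)
    (hhom' : GenAction.IsHom (Y.tensor a Y) (Y.tensor a Y) s') :
    GenAction.IsInvariantPairing a (extAction hb' (Y.tensorPower a n))
      (extAction hb (X.tensorPower a n)) (extPairing B s' s n hb' hb) := by
  have hX := antisymTensors_isStable hhom n
  have hY := antisymTensors_isStable hhom' n
  have hT := tensorPairing_isInvariant hB n
  refine ⟨fun l y x => ?_, fun j y x => ?_, fun j y x => ?_⟩
  · rw [extPairing_apply, extPairing_apply, extAction, extAction, extLift_extDescend hb' (hY.K l),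
      extLift_extDescend hb (hX.K l), hT.1]
  · rw [extPairing_apply, extPairing_apply, extAction, extAction, extLift_extDescend hb' (hY.E j),
      extLift_extDescend hb' (hY.K _), extLift_extDescend hb (hX.E j), hT.2.1]
  · rw [extPairing_apply, extPairing_apply, extAction, extAction, extLift_extDescend hb' (hY.F j),
      extLift_extDescend hb (hX.K _), extLift_extDescend hb (hX.F j), hT.2.2]

theorem extAction_K_K_neg {I : Type*} {t : I} {a : Matrix I I ℤ} {X : GenAction t V}
    (hhom : GenAction.IsHom (X.tensor a X) (X.tensor a X) s)
    (hK : ∀ l v, X.K l (X.K (-l) v) = v) (l : Weight I) (x : QExtPow s n) :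
    (extAction hb (X.tensorPower a n)).K l ((extAction hb (X.tensorPower a n)).K (-l) x) = x := by
  have hX := antisymTensors_isStable hhom n
  have h1 : ∀ x, (X.tensorPower a n).K l ((X.tensorPower a n).K (-l) x) = x := by
    refine tensorPower_hom_ext
      (f := (X.tensorPower a n).K l ∘ₗ (X.tensorPower a n).K (-l)) (g := LinearMap.id) fun v => ?_
    rw [LinearMap.comp_apply, tensorPower_K_tprod, tensorPower_K_tprod]
    simp [hK]
  change tensorToExt s n ((X.tensorPower a n).K l (extLift hb (extDescend hb _ x))) = x
  rw [extLift_extDescend hb (hX.K (-l)), h1, tensorToExt_extLift]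

end Descent

/-- Translating by `K_j` turns the coproduct form of invariance into the one with the antipode
`S(E_j) = -K_j⁻¹ E_j`, `S(F_j) = -F_j K_j`. -/
theorem isHom_dual_of_isInvariantPairing {I : Type*} {t : I} {a : Matrix I I ℤ} {V W : Type*}
    [AddCommGroup V] [Module ℂ V] [AddCommGroup W] [Module ℂ W] {X : GenAction t V}
    {Y : GenAction t W} {B : W →ₗ[ℂ] V →ₗ[ℂ] ℂ} (hB : GenAction.IsInvariantPairing a Y X B)
    (hK : ∀ l v, X.K l (X.K (-l) v) = v) : GenAction.IsHom Y (X.dual a) B := by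
  refine ⟨fun l w => LinearMap.ext fun v => ?_, fun j w => LinearMap.ext fun v => ?_,
    fun j w => LinearMap.ext fun v => ?_⟩
  · change B (Y.K l w) v = B w (X.K (-l) v)
    rw [← hB.1 l w, hK]
  · change B (Y.E j w) v = B w ((-(X.K (-simpleRoot a j.1) * X.E j)) v)
    rw [LinearMap.neg_apply, Module.End.mul_apply, map_neg, ← hB.1 (simpleRoot a j.1) w, hK]
    exact eq_neg_of_add_eq_zero_left (hB.2.1 j w v)
  · change B (Y.F j w) v = B w ((-(X.F j * X.K (simpleRoot a j.1))) v)
    rw [LinearMap.neg_apply, Module.End.mul_apply, map_neg]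
    have := hB.2.2 j w (X.K (simpleRoot a j.1) v)
    have h2 := hK (-simpleRoot a j.1) v
    rw [neg_neg] at h2
    rw [h2] at this
    exact eq_neg_of_add_eq_zero_left this

theorem exists_equiv_dual {I : Type*} {t : I} {a : Matrix I I ℤ} {V W : Type*}
    [AddCommGroup V] [Module ℂ V] [AddCommGroup W] [Module ℂ W] [FiniteDimensional ℂ V]
    [FiniteDimensional ℂ W] {X : GenAction t V} {Y : GenAction t W} {B : W →ₗ[ℂ] V →ₗ[ℂ] ℂ}
    (hnd : B.Nondegenerate) (hB : GenAction.IsInvariantPairing a Y X B)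
    (hK : ∀ l v, X.K l (X.K (-l) v) = v) :
    ∃ Φ : W ≃ₗ[ℂ] Module.Dual ℂ V, (∀ y x, Φ y x = B y x) ∧
      GenAction.IsHom Y (X.dual a) Φ.toLinearMap := by
  have hpp : B.IsPerfPair := LinearMap.IsPerfPair.of_injective
    (LinearMap.ker_eq_bot.1 (LinearMap.separatingLeft_iff_ker_eq_bot.1 hnd.1))
    (LinearMap.ker_eq_bot.1 (LinearMap.separatingRight_iff_flip_ker_eq_bot.1 hnd.2))
  exact ⟨B.toPerfPair, fun y x => rfl, isHom_dual_of_isInvariantPairing hB hK⟩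

theorem exists_extPairing {I : Type*} {t : I} {a : Matrix I I ℤ} {V W : Type*}
    [AddCommGroup V] [Module ℂ V] [AddCommGroup W] [Module ℂ W] [FiniteDimensional ℂ V]
    [FiniteDimensional ℂ W] {X : GenAction t V}
    {Y : GenAction t W} {B : W →ₗ[ℂ] V →ₗ[ℂ] ℂ} (hB : B.Nondegenerate)
    (hBinv : GenAction.IsInvariantPairing a Y X B)
    (hK : ∀ l v, X.K l (X.K (-l) v) = v) {s : V ⊗[ℂ] V →ₗ[ℂ] V ⊗[ℂ] V}
    {s' : W ⊗[ℂ] W →ₗ[ℂ] W ⊗[ℂ] W}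
    (hs : IsUnitaryInvolution s) (hs' : IsUnitaryInvolution s')
    (hhom : GenAction.IsHom (X.tensor a X) (X.tensor a X) s)
    (hhom' : GenAction.IsHom (Y.tensor a Y) (Y.tensor a Y) s')
    (hss : ∀ y x, GenAction.pairingSq B (s' y) x = GenAction.pairingSq B y (s x)) (n : ℕ) :
    ∃ (Ym : GenAction t (QExtPow s' n)) (Yp : GenAction t (QExtPow s n))
      (hm : Function.Bijective (antisymToExt s' n)) (hp : Function.Bijective (antisymToExt s n)),
      GenAction.IsHom (Y.tensorPower a n) Ym (tensorToExt s' n) ∧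
      GenAction.IsHom (X.tensorPower a n) Yp (tensorToExt s n) ∧
      (extPairing B _ _ n hm hp).Nondegenerate ∧
      GenAction.IsInvariantPairing a Ym Yp (extPairing B _ _ n hm hp) ∧
      ∃ Φ : QExtPow s' n ≃ₗ[ℂ] Module.Dual ℂ (QExtPow s n),
        (∀ y x, Φ y x = extPairing B _ _ n hm hp y x) ∧
        GenAction.IsHom Ym (Yp.dual a) Φ.toLinearMap := by
  have hm := antisymToExt_bijective hs' n
  have hp := antisymToExt_bijective hs n
  have hnd := extPairing_nondegenerate hp hm hs hs' hB hss
  have hinv := extPairing_isInvariant hp hm hBinv hhom hhom'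
  have : FiniteDimensional ℂ (QExtPow s n) :=
    Module.Finite.of_surjective _ (tensorToExt_surjective (s := s) n)
  have : FiniteDimensional ℂ (QExtPow s' n) :=
    Module.Finite.of_surjective _ (tensorToExt_surjective (s := s') n)
  refine ⟨extAction hm (Y.tensorPower a n), extAction hp (X.tensorPower a n), hm, hp,
    extAction_isHom hm hs'.1 hhom', extAction_isHom hp hs.1 hhom, hnd, hinv, ?_⟩
  exact exists_equiv_dual hnd hinv (extAction_K_K_neg hp hhom hK)

namespace GenAction

variable {I : Type*} {t : I} {V W : Type*} [AddCommGroup V] [Module ℂ V]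
  [AddCommGroup W] [Module ℂ W] {a : Matrix I I ℤ} {d : I → ℝ} {q : ℝ} {X : GenAction t V}
  {Y : GenAction t W}

theorem IsSignOf.isUnitaryInvolution {h : V →ₗ⋆[ℂ] V →ₗ[ℂ] ℂ}
    {h₂ : V ⊗[ℂ] V →ₗ⋆[ℂ] V ⊗[ℂ] V →ₗ[ℂ] ℂ} {s R : V ⊗[ℂ] V →ₗ[ℂ] V ⊗[ℂ] V} (hh : IsPosForm h)
    (hh₂ : ∀ v w v' w', h₂ (v ⊗ₜ[ℂ] w) (v' ⊗ₜ[ℂ] w') = h v v' * h w w')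
    (hR : ∀ x y, h₂ (R x) y = h₂ x (R y)) (hs : IsSignOf s R) : IsUnitaryInvolution s :=
  ⟨hs.involutive, h, h₂, hh, hh₂, hs.adjoint hs (fun r => Complex.conj_ofReal r) hR⟩

theorem IsSignOf.isHom {s R : V ⊗[ℂ] V →ₗ[ℂ] V ⊗[ℂ] V} (hs : IsSignOf s R)
    (hR : IsHom (X.tensor a X) (X.tensor a X) R) : IsHom (X.tensor a X) (X.tensor a X) s :=
  ⟨fun l => hs.comm (hR.1 l), fun j => hs.comm (hR.2.1 j), fun j => hs.comm (hR.2.2 j)⟩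

theorem exists_extPairing_of_isCommutor [Fintype I] (D : IsDatum a d q) [FiniteDimensional ℂ V]
    [FiniteDimensional ℂ W] (hX : X.IsRep a d q) (hXirr : X.IsIrr)
    (hXspan : ⨆ ν, X.weightSpace a d q ν = ⊤) (hY : Y.IsRep a d q) (hYirr : Y.IsIrr)
    (hYspan : ⨆ ν, Y.weightSpace a d q ν = ⊤) {B : W →ₗ[ℂ] V →ₗ[ℂ] ℂ} (hB : B.Nondegenerate)
    (hBinv : IsInvariantPairing a Y X B) {s : V ⊗[ℂ] V →ₗ[ℂ] V ⊗[ℂ] V}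
    {s' : W ⊗[ℂ] W →ₗ[ℂ] W ⊗[ℂ] W} (hs : X.IsCommutor a d q s) (hs' : Y.IsCommutor a d q s')
    (n : ℕ) :
    ∃ (Ym : GenAction t (QExtPow s' n)) (Yp : GenAction t (QExtPow s n))
      (hm : Function.Bijective (antisymToExt s' n)) (hp : Function.Bijective (antisymToExt s n)),
      GenAction.IsHom (Y.tensorPower a n) Ym (tensorToExt s' n) ∧
      GenAction.IsHom (X.tensorPower a n) Yp (tensorToExt s n) ∧
      (extPairing B _ _ n hm hp).Nondegenerate ∧
      GenAction.IsInvariantPairing a Ym Yp (extPairing B _ _ n hm hp) ∧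
      ∃ Φ : QExtPow s' n ≃ₗ[ℂ] Module.Dual ℂ (QExtPow s n),
        (∀ y x, Φ y x = extPairing B _ _ n hm hp y x) ∧
        GenAction.IsHom Ym (Yp.dual a) Φ.toLinearMap := by
  obtain ⟨h, h₂, R, hh, hh₂, hself, hR, hsR⟩ := hs.exists_isSignOf D hX hXirr hXspan
  obtain ⟨h', h₂', R', hh', hh₂', hself', hR', hsR'⟩ := hs'.exists_isSignOf D hY hYirr hYspan
  have := hYirr.nontrivial
  obtain ⟨μ, v, hv⟩ := exists_isLowest D hYspan
  exact exists_extPairing hB hBinv hX.K_K_neg (hsR.isUnitaryInvolution hh hh₂ hself)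
    (hsR'.isUnitaryInvolution hh' hh₂' hself') (hsR.isHom hR.1) (hsR'.isHom hR'.1)
    (hsR'.adjoint hsR (σ := RingHom.id ℂ) (fun r => rfl)
      (IsBraiding.pairingSq_apply D hX hY hYirr hXspan hYspan hv hBinv hB hR hR')) n

end GenAction

end

end QuantumNilradical

/-! ### Constructions used in the existence proof for the commutor. -/

namespace QuantumNilradical

open scoped TensorProduct

noncomputable section

namespace GenAction

variable {I : Type*} {t : I} {V W : Type*} [AddCommGroup V] [Module ℂ V] [AddCommGroup W]
  [Module ℂ W] {a : Matrix I I ℤ} {d : I → ℝ} {q : ℝ} {X : GenAction t V} {Y : GenAction t W}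

/-! ### Constructions of representations -/

/-- The action on a product. -/
def prod (X : GenAction t V) (Y : GenAction t W) : GenAction t (V × W) where
  K l := (X.K l).prodMap (Y.K l)
  E j := (X.E j).prodMap (Y.E j)
  F j := (X.F j).prodMap (Y.F j)

/-- The action with the roles of the `E_j` and the `F_j` exchanged. -/
def op (X : GenAction t V) : GenAction t V where
  K l := X.K (-l)
  E j := X.F j
  F j := X.E j

/-- The adjoint action on linear maps. -/
def hom (a : Matrix I I ℤ) (X : GenAction t V) (Y : GenAction t W) : GenAction t (V →ₗ[ℂ] W) where
  K l :=
    { toFun := fun g => Y.K l ∘ₗ g ∘ₗ X.K (-l)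
      map_add' := fun g g' => by ext; simp
      map_smul' := fun c g => by ext; simp }
  E j :=
    { toFun := fun g => Y.E j ∘ₗ g -
        Y.K (simpleRoot a j.1) ∘ₗ g ∘ₗ X.K (-simpleRoot a j.1) ∘ₗ X.E j
      map_add' := fun g g' => by ext; simp; abel
      map_smul' := fun c g => by ext; simp [smul_sub] }
  F j :=
    { toFun := fun g => (Y.F j ∘ₗ g - g ∘ₗ X.F j) ∘ₗ X.K (simpleRoot a j.1)
      map_add' := fun g g' => by ext; simp; abel
      map_smul' := fun c g => by ext; simp [smul_sub] }

theorem hom_K_apply (l : Weight I) (g : V →ₗ[ℂ] W) (v : V) :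
    (X.hom a Y).K l g v = Y.K l (g (X.K (-l) v)) := rfl

theorem hom_E_apply (j) (g : V →ₗ[ℂ] W) (v : V) :
    (X.hom a Y).E j g v = Y.E j (g v) -
      Y.K (simpleRoot a j.1) (g (X.K (-simpleRoot a j.1) (X.E j v))) := rfl

theorem hom_F_apply (j) (g : V →ₗ[ℂ] W) (v : V) :
    (X.hom a Y).F j g v = Y.F j (g (X.K (simpleRoot a j.1) v)) -
      g (X.F j (X.K (simpleRoot a j.1) v)) := rfl

theorem op_isStable {N : Submodule ℂ V} : X.op.IsStable N ↔ X.IsStable N := by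
  constructor
  · intro h
    exact ⟨fun l => by simpa [op] using h.K (-l), h.F, h.E⟩
  · intro h
    exact ⟨fun l => h.K (-l), h.F, h.E⟩

variable [Fintype I]

namespace IsRep

variable (hX : X.IsRep a d q) (hY : Y.IsRep a d q)

include hX in
theorem K_K_apply (l m : Weight I) (v : V) : X.K l (X.K m v) = X.K (l + m) v := by
  rw [hX.K_add]; rfl

include hX in
theorem E_F_same_apply (j) (v : V) : X.E j (X.F j v) = X.F j (X.E j v) +
    (((qi d q j.1 - (qi d q j.1)⁻¹)⁻¹ : ℝ) : ℂ) •
      (X.K (simpleRoot a j.1) v - X.K (-simpleRoot a j.1) v) := by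
  rw [← sub_eq_iff_eq_add']
  exact LinearMap.congr_fun (hX.E_F_same j) v

include hX in
theorem E_F_ne_apply {i j} (hij : i ≠ j) (v : V) : X.E i (X.F j v) = X.F j (X.E i v) := by
  rw [← sub_eq_zero]
  exact LinearMap.congr_fun (hX.E_F_ne i j hij) v

include hX hY in
theorem prod : (X.prod Y).IsRep a d q := by
  refine ⟨?_, ?_, ?_, ?_, ?_, ?_⟩
  · refine LinearMap.ext fun v => ?_
    simp [GenAction.prod, hX.K_zero, hY.K_zero]
  · intro l m
    refine LinearMap.ext fun v => ?_
    simp [GenAction.prod, hX.K_add, hY.K_add]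
  · intro l j
    refine LinearMap.ext fun v => ?_
    simp [GenAction.prod, hX.K_E_apply, hY.K_E_apply]
  · intro l j
    refine LinearMap.ext fun v => ?_
    simp [GenAction.prod, hX.K_F_apply, hY.K_F_apply]
  · intro j
    refine LinearMap.ext fun v => ?_
    simp [GenAction.prod, hX.E_F_same_apply, hY.E_F_same_apply]
  · intro i j hij
    refine LinearMap.ext fun v => ?_
    simp [GenAction.prod, hX.E_F_ne_apply hij, hY.E_F_ne_apply hij]

-- Exchanging the `E_j` and the `F_j` negates all weights, so arguments about lowest weight vectors
-- also serve highest weight vectors.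
include hX in
theorem op (D : IsDatum a d q) : X.op.IsRep a d q := by
  refine ⟨?_, ?_, ?_, ?_, ?_, ?_⟩
  · simp [GenAction.op, hX.K_zero]
  · intro l m
    simp [GenAction.op, ← hX.K_add, add_comm]
  · intro l j
    change X.K (-l) * X.F j = _ • (X.F j * X.K (-l))
    rw [hX.K_F, qchar_neg_left D, qchar_neg_right D, inv_inv]
  · intro l j
    change X.K (-l) * X.E j = _ • (X.E j * X.K (-l))
    rw [hX.K_E, qchar_neg_left D, qchar_neg_right D]
  · intro j
    change X.F j * X.E j - X.E j * X.F j = _ • (X.K (-_) - X.K (- -_))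
    rw [← neg_sub, hX.E_F_same, neg_neg, ← smul_neg, neg_sub]
  · intro i j hij
    change X.F i * X.E j - X.E j * X.F i = 0
    rw [← neg_sub, hX.E_F_ne j i hij.symm, neg_zero]

include hX hY in
theorem tensor (D : IsDatum a d q) : (X.tensor a Y).IsRep a d q := by
  refine ⟨?_, ?_, ?_, ?_, ?_, ?_⟩
  · ext v w
    simp [hX.K_zero, hY.K_zero]
  · intro l m
    ext v w
    simp [hX.K_add, hY.K_add]
  · intro l j
    ext v w
    simp only [TensorProduct.AlgebraTensorModule.curry_apply, TensorProduct.curry_apply,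
      LinearMap.coe_restrictScalars, Module.End.mul_apply, LinearMap.smul_apply, tensor_E_tmul,
      tensor_K_tmul, map_add, hX.K_E_apply, hY.K_E_apply, hX.K_K_apply, smul_add,
      TensorProduct.smul_tmul', TensorProduct.tmul_smul, add_comm]
  · intro l j
    ext v w
    simp only [TensorProduct.AlgebraTensorModule.curry_apply, TensorProduct.curry_apply,
      LinearMap.coe_restrictScalars, Module.End.mul_apply, LinearMap.smul_apply, tensor_F_tmul,
      tensor_K_tmul, map_add, hX.K_F_apply, hY.K_F_apply, hY.K_K_apply, smul_add,
      TensorProduct.smul_tmul', TensorProduct.tmul_smul, add_comm]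
  · intro j
    ext v w
    simp only [TensorProduct.AlgebraTensorModule.curry_apply, TensorProduct.curry_apply,
      LinearMap.coe_restrictScalars, Module.End.mul_apply, LinearMap.smul_apply, tensor_F_tmul,
      tensor_E_tmul, tensor_K_tmul, map_add, hX.K_F_apply, hY.K_E_apply, LinearMap.sub_apply,
      hX.E_F_same_apply, hY.E_F_same_apply, smul_sub, TensorProduct.add_tmul,
      TensorProduct.sub_tmul, TensorProduct.tmul_sub, TensorProduct.tmul_add,
      TensorProduct.smul_tmul', TensorProduct.tmul_smul, qchar_neg_left D, qchar_neg_right D]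
    abel
  · intro i j hij
    ext v w
    simp only [TensorProduct.AlgebraTensorModule.curry_apply, TensorProduct.curry_apply,
      LinearMap.coe_restrictScalars, Module.End.mul_apply, LinearMap.zero_apply, tensor_F_tmul,
      tensor_E_tmul, map_add, hX.K_F_apply, hY.K_E_apply, LinearMap.sub_apply,
      hX.E_F_ne_apply hij, hY.E_F_ne_apply hij,
      TensorProduct.smul_tmul', TensorProduct.tmul_smul,
      qchar_neg_left D, qchar_neg_right D,
      qchar_comm D (simpleRoot a i.1) (simpleRoot a j.1)]
    abel

include hX hY in
theorem hom (D : IsDatum a d q) : (X.hom a Y).IsRep a d q := by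
  refine ⟨?_, ?_, ?_, ?_, ?_, ?_⟩
  · ext g v
    simp [hom_K_apply, hX.K_zero, hY.K_zero]
  · intro l m
    ext g v
    simp [hom_K_apply, hX.K_K_apply, hY.K_K_apply, add_comm]
  · intro l j
    ext g v
    have hne := qchar_ne_zero D l (simpleRoot a j.1)
    simp only [Module.End.mul_apply, LinearMap.smul_apply, hom_K_apply, hom_E_apply, map_sub,
      hY.K_E_apply, hX.K_E_apply, hX.K_K_apply, hY.K_K_apply, smul_sub, map_smul, smul_smul,
      qchar_neg_left D, add_comm]
    congr 2
    rw [mul_comm (qchar a d q l _), mul_assoc, inv_mul_cancel₀ hne, mul_one]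
  · intro l j
    ext g v
    have hne := qchar_ne_zero D l (simpleRoot a j.1)
    simp only [Module.End.mul_apply, LinearMap.smul_apply, hom_K_apply, hom_F_apply, map_sub,
      hY.K_F_apply, hX.K_F_apply, hX.K_K_apply, smul_sub, map_smul, smul_smul,
      qchar_neg_left D, qchar_neg_right D, inv_inv, inv_mul_cancel₀ hne, one_smul, add_comm]
  · intro j
    ext g v
    set α := simpleRoot a j.1 with hα
    have hne := qchar_ne_zero D α α
    simp only [Module.End.mul_apply, LinearMap.smul_apply, LinearMap.sub_apply, hom_K_apply,
      hom_F_apply, hom_E_apply, ← hα, map_sub, map_add,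
      hY.K_F_apply, hX.K_F_apply, hX.K_E_apply, hX.K_K_apply, smul_sub,
      hX.E_F_same_apply, hY.E_F_same_apply, map_smul, smul_smul,
      qchar_neg_left D, qchar_neg_right D, inv_inv, inv_mul_cancel₀ hne, mul_inv_cancel₀ hne,
      one_smul, add_neg_cancel, neg_add_cancel, hX.K_zero, neg_neg, Module.End.one_apply]
    rw [show -α + (α + α) = α by abel]
    abel
  · intro i j hij
    ext g v
    simp only [Module.End.mul_apply, LinearMap.zero_apply, LinearMap.sub_apply,
      hom_F_apply, hom_E_apply, map_sub,
      hY.K_F_apply, hX.K_F_apply, hX.K_E_apply, hX.K_K_apply, smul_sub,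
      hX.E_F_ne_apply hij, hY.E_F_ne_apply hij, map_smul, smul_smul,
      qchar_neg_left D, qchar_neg_right D, inv_inv]
    have h₁ := qchar_ne_zero D (simpleRoot a i.1) (simpleRoot a j.1)
    rw [qchar_comm D (simpleRoot a j.1) (simpleRoot a i.1), mul_assoc, mul_inv_cancel₀ h₁, mul_one,
      mul_comm (qchar a d q (simpleRoot a i.1) (simpleRoot a j.1)),
      add_comm (-simpleRoot a i.1)]
    abel

end IsRep

end GenAction

end

end QuantumNilradical

namespace QuantumNilradical

open scoped TensorProduct

noncomputable section

namespace GenAction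

variable {I : Type*} {t : I} {V W : Type*} [AddCommGroup V] [Module ℂ V] [AddCommGroup W]
  [Module ℂ W] {a : Matrix I I ℤ} {d : I → ℝ} {q : ℝ} {X : GenAction t V} {Y : GenAction t W}

/-! ### Submodules generated by a lowest weight vector -/

/-- The vectors `E_{j₁} ⋯ E_{jₖ} u`. -/
inductive IsRaised (X : GenAction t V) (u : V) : V → Prop
  | base : IsRaised X u u
  | E (j) {v : V} (hv : IsRaised X u v) : IsRaised X u (X.E j v)

/-- The span of the vectors `E_{j₁} ⋯ E_{jₖ} u`. -/
def raise (X : GenAction t V) (u : V) : Submodule ℂ V := Submodule.span ℂ {v | X.IsRaised u v}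

theorem mem_raise_self (u : V) : u ∈ X.raise u := Submodule.subset_span .base

theorem E_mem_raise (j) {u v : V} (hv : v ∈ X.raise u) : X.E j v ∈ X.raise u := by
  suffices h : X.raise u ≤ (X.raise u).comap (X.E j) from h hv
  exact Submodule.span_le.2 fun w hw => Submodule.subset_span (.E j hw)

theorem raise_le {u : V} {N : Submodule ℂ V} (hu : u ∈ N) (hE : ∀ j, ∀ v ∈ N, X.E j v ∈ N) :
    X.raise u ≤ N := by
  refine Submodule.span_le.2 fun w hw => ?_
  induction hw with
  | base => exact hu
  | E j _ ih => exact hE j _ ih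

theorem prod_raise_snd {u : V} {z : W} {v : V × W} (hv : v ∈ (X.prod Y).raise (u, z)) :
    v.2 ∈ Y.raise z := by
  suffices h : (X.prod Y).raise (u, z) ≤ (Y.raise z).comap (LinearMap.snd ℂ V W) from h hv
  exact raise_le (mem_raise_self z) fun j w hw => E_mem_raise j hw

/-- A stable subspace of a product that is the graph of a function gives a homomorphism. -/
theorem exists_isHom_of_graph {G : Submodule ℂ (V × W)} (hG : (X.prod Y).IsStable G)
    (hex : ∀ v, ∃ w, (v, w) ∈ G) (huniq : ∀ w, (0, w) ∈ G → w = 0) :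
    ∃ φ : V →ₗ[ℂ] W, IsHom X Y φ ∧ ∀ v w, (v, w) ∈ G → φ v = w := by
  have hbij : Function.Bijective ((LinearMap.fst ℂ V W).domRestrict G) := by
    constructor
    · rw [← LinearMap.ker_eq_bot, LinearMap.ker_eq_bot']
      rintro ⟨⟨v, w⟩, h⟩ hv
      obtain rfl : v = 0 := hv
      obtain rfl := huniq w h
      rfl
    · intro v
      obtain ⟨w, hw⟩ := hex v
      exact ⟨⟨(v, w), hw⟩, rfl⟩
  set e := LinearEquiv.ofBijective _ hbij
  have key : ∀ v w, (v, w) ∈ G → ((e.symm v : G) : V × W).2 = w := by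
    intro v w h
    have : e.symm v = ⟨(v, w), h⟩ := by
      rw [LinearEquiv.symm_apply_eq]
      rfl
    rw [this]
  have hmem : ∀ v, (v, ((e.symm v : G) : V × W).2) ∈ G := fun v => by
    obtain ⟨w, hw⟩ := hex v
    rwa [key v w hw]
  refine ⟨(LinearMap.snd ℂ V W).domRestrict G ∘ₗ e.symm.toLinearMap, ⟨?_, ?_, ?_⟩, key⟩
  · exact fun l v => key _ _ (hG.K l _ (hmem v))
  · exact fun j v => key _ _ (hG.E j _ (hmem v))
  · exact fun j v => key _ _ (hG.F j _ (hmem v))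

theorem IsStable.map_fst {G : Submodule ℂ (V × W)} (hG : (X.prod Y).IsStable G) :
    X.IsStable (G.map (LinearMap.fst ℂ V W)) := by
  refine ⟨?_, ?_, ?_⟩
  · rintro l _ ⟨v, hv, rfl⟩
    exact ⟨_, hG.K l v hv, rfl⟩
  · rintro l _ ⟨v, hv, rfl⟩
    exact ⟨_, hG.E l v hv, rfl⟩
  · rintro l _ ⟨v, hv, rfl⟩
    exact ⟨_, hG.F l v hv, rfl⟩

theorem IsStable.comap_inr {G : Submodule ℂ (V × W)} (hG : (X.prod Y).IsStable G) :
    Y.IsStable (G.comap (LinearMap.inr ℂ V W)) := by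
  refine ⟨?_, ?_, ?_⟩
  · intro l v hv
    simpa [GenAction.prod] using hG.K l _ hv
  · intro l v hv
    simpa [GenAction.prod] using hG.E l _ hv
  · intro l v hv
    simpa [GenAction.prod] using hG.F l _ hv

/-- The projection of a stable subspace to `V` is stable, hence onto once it is nonzero. -/
theorem IsIrr.exists_mem_graph (hirr : X.IsIrr) {G : Submodule ℂ (V × W)}
    (hG : (X.prod Y).IsStable G) {u : V × W} (hu : u ∈ G) (hu0 : u.1 ≠ 0) (v : V) :
    ∃ w, (v, w) ∈ G := by
  have h : v ∈ G.map (LinearMap.fst ℂ V W) := by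
    rw [hirr.eq_top hG.map_fst (v := u.1) ⟨u, hu, rfl⟩ hu0]
    trivial
  obtain ⟨⟨v, w⟩, hw, rfl⟩ := h
  exact ⟨w, hw⟩

variable [Fintype I]

theorem IsRaised.weight (D : IsDatum a d q) (hX : X.IsRep a d q) {μ : Weight I} {u v : V}
    (hu : u ∈ X.weightSpace a d q μ) (hv : X.IsRaised u v) :
    ∃ ν, v ∈ X.weightSpace a d q ν ∧ (v = u ∧ ν = μ ∨ WeightLT a t μ ν) := by
  induction hv with
  | base => exact ⟨μ, hu, .inl ⟨rfl, rfl⟩⟩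
  | E j hv ih =>
    obtain ⟨ν, hν, h⟩ := ih
    refine ⟨_, hX.E_mem D hν j, .inr ?_⟩
    have h1 := weightLT_of_add_simpleRoot a j.2 ν
    rcases h with ⟨-, rfl⟩ | h
    · exact h1
    · exact WeightLT.trans h h1

/-- Moving `F_i` to the right past the `E_j` produces only `K`-terms, which are scalars on weight
vectors, and in the end `F_i u = 0`. -/
theorem IsRep.isStable_raise (D : IsDatum a d q) (hX : X.IsRep a d q) {μ : Weight I} {u : V}
    (hu : u ∈ X.weightSpace a d q μ) (hF : ∀ j, X.F j u = 0) : X.IsStable (X.raise u) := by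
  have hK : ∀ l, ∀ v ∈ X.raise u, X.K l v ∈ X.raise u := by
    intro l v hv
    suffices h : X.raise u ≤ (X.raise u).comap (X.K l) from h hv
    refine Submodule.span_le.2 fun w hw => ?_
    obtain ⟨ν, hν, -⟩ := hw.weight D hX hu
    rw [SetLike.mem_coe, Submodule.mem_comap]
    rw [mem_weightSpace.1 hν l]
    exact Submodule.smul_mem _ _ (Submodule.subset_span hw)
  refine ⟨hK, fun j v hv => E_mem_raise j hv, fun i v hv => ?_⟩
  suffices h : X.raise u ≤ (X.raise u).comap (X.F i) from h hv
  refine Submodule.span_le.2 fun w hw => ?_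
  rw [SetLike.mem_coe, Submodule.mem_comap]
  induction hw with
  | base => simp [hF]
  | @E j w hw ih =>
    have hw' : w ∈ X.raise u := Submodule.subset_span hw
    by_cases hij : j = i
    · subst hij
      rw [eq_sub_of_add_eq (hX.E_F_same_apply j w).symm]
      exact Submodule.sub_mem _ (E_mem_raise j ih)
        (Submodule.smul_mem _ _ (Submodule.sub_mem _ (hK _ _ hw') (hK _ _ hw')))
    · rw [← hX.E_F_ne_apply hij]
      exact E_mem_raise j ih

/-- In the generated subspace the weight `μ` occurs only along the line of `u`; this is what rules
out unwanted vectors of weight `μ` in a graph. -/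
theorem IsRep.raise_le_sup (D : IsDatum a d q) (hX : X.IsRep a d q) {μ : Weight I} {u : V}
    (hu : u ∈ X.weightSpace a d q μ) : X.raise u ≤ Submodule.span ℂ {u} ⊔
      ⨆ (ν) (_ : WeightLT a t μ ν), X.weightSpace a d q ν := by
  refine Submodule.span_le.2 fun w hw => ?_
  obtain ⟨ν, hν, ⟨rfl, -⟩ | h⟩ := hw.weight D hX hu
  · exact Submodule.mem_sup_left (Submodule.mem_span_singleton_self _)
  · exact Submodule.mem_sup_right (Submodule.mem_iSup_of_mem ν (Submodule.mem_iSup_of_mem h hν))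

theorem IsRep.iSupIndep_weightSpace (D : IsDatum a d q) (hX : X.IsRep a d q) :
    iSupIndep fun μ => X.weightSpace a d q μ := by
  have h := Module.End.independent_iInf_maxGenEigenspace_of_forall_mapsTo X.K (by
    intro l m c
    refine Module.End.mapsTo_maxGenEigenspace_of_comm ?_ c
    change X.K m * X.K l = X.K l * X.K m
    rw [← hX.K_add, ← hX.K_add, add_comm])
  have h' := h.comp (f := fun (μ : Weight I) l => qchar a d q l μ)
    (fun μ ν hμν => qchar_injective D fun l => congrFun hμν l)
  refine h'.mono fun μ v hv => ?_
  simp only [Function.comp, Submodule.mem_iInf]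
  intro l
  exact (Module.End.genEigenspace (X.K l) _).mono le_top
    (Module.End.mem_eigenspace_iff.2 (mem_weightSpace.1 hv l))

end GenAction

/-- By the modular law, a family below an independent one cannot be strictly smaller anywhere if it
still spans. This applies to subspaces of weight spaces. -/
theorem iSupIndep.eq_of_le_of_iSup_eq_top {α ι : Type*} [CompleteLattice α] [IsModularLattice α]
    {f g : ι → α} (hf : iSupIndep f) (hle : g ≤ f) (htop : ⨆ i, g i = ⊤) (i : ι) : g i = f i := by
  refine le_antisymm (hle i) ?_
  have h1 : g i ⊔ ⨆ (j) (_ : j ≠ i), f j = ⊤ := by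
    rw [eq_top_iff, ← htop]
    refine iSup_le fun j => ?_
    by_cases h : j = i
    · subst h
      exact le_sup_left
    · exact le_sup_of_le_right ((hle j).trans (le_iSup₂_of_le j h le_rfl))
  calc f i = (g i ⊔ ⨆ (j) (_ : j ≠ i), f j) ⊓ f i := by rw [h1, top_inf_eq]
    _ = g i ⊔ (⨆ (j) (_ : j ≠ i), f j) ⊓ f i := sup_inf_assoc_of_le _ (hle i)
    _ ≤ g i := by rw [inf_comm, (hf i).eq_bot, sup_bot_eq]

end

end QuantumNilradical

namespace QuantumNilradical

open scoped TensorProduct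

noncomputable section

namespace GenAction

variable {I : Type*} [Fintype I] {t : I} {V W : Type*} [AddCommGroup V] [Module ℂ V]
  [AddCommGroup W] [Module ℂ W] {a : Matrix I I ℤ} {d : I → ℝ} {q : ℝ} {X : GenAction t V}
  {Y : GenAction t W}

/-! ### Existence of the braiding -/

/-- The common kernel of a stable space of linear maps is stable. -/
theorem IsRep.isStable_iInf_ker (hX : X.IsRep a d q) (hY : Y.IsRep a d q)
    {N : Submodule ℂ (V →ₗ[ℂ] W)} (hN : (X.hom a Y).IsStable N) :
    X.IsStable (⨅ g ∈ N, LinearMap.ker g) := by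
  have hK : ∀ l, ∀ v ∈ ⨅ g ∈ N, LinearMap.ker g, X.K l v ∈ ⨅ g ∈ N, LinearMap.ker g := by
    intro l v hv
    simp only [Submodule.mem_iInf, LinearMap.mem_ker] at hv ⊢
    intro g hg
    have := hv _ (hN.K (-l) g hg)
    rw [hom_K_apply, neg_neg] at this
    rw [← hY.K_K_neg l (g _), this, map_zero]
  refine ⟨hK, fun j v hv => ?_, fun j v hv => ?_⟩
  · rw [← hX.K_K_neg (simpleRoot a j.1) (X.E j v)]
    refine hK _ _ ?_
    simp only [Submodule.mem_iInf, LinearMap.mem_ker] at hv ⊢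
    intro g hg
    have := hv _ (hN.E j g hg)
    rw [hom_E_apply, hv g hg, map_zero, zero_sub, neg_eq_zero] at this
    rw [← hY.K_neg_K (simpleRoot a j.1) (g _), this, map_zero]
  · have hv' := hK (-simpleRoot a j.1) v hv
    simp only [Submodule.mem_iInf, LinearMap.mem_ker] at hv hv' ⊢
    intro g hg
    have := hv' _ (hN.F j g hg)
    rwa [hom_F_apply, hX.K_K_neg, hv g hg, map_zero, zero_sub, neg_eq_zero] at this

/-- The map `w ↦ K_μ w ⊗ v`. -/
def tensorLowest (X : GenAction t V) (μ : Weight I) (v : V) : V →ₗ[ℂ] V ⊗[ℂ] V :=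
  (TensorProduct.mk ℂ V V).flip v ∘ₗ X.K μ

omit [Fintype I] in
theorem tensorLowest_apply (μ : Weight I) (v w : V) :
    X.tensorLowest μ v w = X.K μ w ⊗ₜ[ℂ] v := rfl

theorem IsRep.tensorLowest_mem (hX : X.IsRep a d q) {μ : Weight I} {v : V}
    (hv : v ∈ X.weightSpace a d q μ) :
    X.tensorLowest μ v ∈ (X.hom a (X.tensor a X)).weightSpace a d q μ := by
  rw [mem_weightSpace] at hv ⊢
  intro l
  ext w
  rw [hom_K_apply, tensorLowest_apply, tensor_K_tmul, hv, hX.K_K_apply, hX.K_K_apply,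
    LinearMap.smul_apply, tensorLowest_apply, TensorProduct.tmul_smul,
    add_neg_cancel_comm]

/-- The map has to be killed by `F_j`, as `v` is, in order to be the image of `v` under a
homomorphism. The twist by `K_μ` makes the two terms of the adjoint action cancel. -/
theorem IsRep.F_tensorLowest (D : IsDatum a d q) (hX : X.IsRep a d q) {μ : Weight I} {v : V}
    (hv : v ∈ X.weightSpace a d q μ) (hF : ∀ j, X.F j v = 0) (j) :
    (X.hom a (X.tensor a X)).F j (X.tensorLowest μ v) = 0 := by
  ext w
  rw [mem_weightSpace] at hv
  rw [hom_F_apply, tensorLowest_apply, tensorLowest_apply, tensor_F_tmul, hF, hv, hX.K_F_apply,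
    TensorProduct.tmul_zero, add_zero, TensorProduct.tmul_smul, TensorProduct.smul_tmul',
    qchar_comm D, sub_self]
  rfl

/-- The adjoint action on linear maps is made for this tensor-hom adjunction. -/
theorem IsRep.isHom_lift (hX : X.IsRep a d q) {φ : V →ₗ[ℂ] V →ₗ[ℂ] V ⊗[ℂ] V}
    (hφ : IsHom X (X.hom a (X.tensor a X)) φ) :
    IsHom (X.tensor a X) (X.tensor a X) (TensorProduct.lift φ) := by
  obtain ⟨hK, hE, hF⟩ := hφ
  refine ⟨fun l x => ?_, fun j x => ?_, fun j x => ?_⟩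
  · induction x with
    | zero => simp
    | add x y hx hy => simp only [map_add, hx, hy]
    | tmul v w =>
      rw [tensor_K_tmul, TensorProduct.lift.tmul, TensorProduct.lift.tmul, hK, hom_K_apply,
        hX.K_neg_K]
  · induction x with
    | zero => simp
    | add x y hx hy => simp only [map_add, hx, hy]
    | tmul v w =>
      rw [tensor_E_tmul, map_add, TensorProduct.lift.tmul, TensorProduct.lift.tmul,
        TensorProduct.lift.tmul, hK, hE, hom_K_apply, hom_E_apply, sub_add_cancel]
  · induction x with
    | zero => simp
    | add x y hx hy => simp only [map_add, hx, hy]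
    | tmul v w =>
      rw [tensor_F_tmul, map_add, TensorProduct.lift.tmul, TensorProduct.lift.tmul,
        TensorProduct.lift.tmul, hF, hom_F_apply, hX.K_K_neg, sub_add_cancel]

/-- Existence of a homomorphism `v ↦ R (v ⊗ ·)` with prescribed value at a lowest weight vector. -/
theorem IsRep.exists_isHom_tensorLowest (D : IsDatum a d q) (hX : X.IsRep a d q) (hirr : X.IsIrr)
    {μ l : Weight I} {v w : V} (hv : v ∈ X.weightSpace a d q μ) (hv0 : v ≠ 0)
    (hF : ∀ j, X.F j v = 0) (hw : w ∈ X.weightSpace a d q l) (hw0 : w ≠ 0)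
    (hE : ∀ j, X.E j w = 0) :
    ∃ φ : V →ₗ[ℂ] V →ₗ[ℂ] V ⊗[ℂ] V, IsHom X (X.hom a (X.tensor a X)) φ ∧
      φ v = X.tensorLowest μ v := by
  have hT := hX.tensor hX D
  have hH := hX.hom hT D
  set G := (X.prod (X.hom a (X.tensor a X))).raise (v, X.tensorLowest μ v) with hGdef
  have hmem : (v, X.tensorLowest μ v) ∈ G := mem_raise_self _
  have hG : (X.prod (X.hom a (X.tensor a X))).IsStable G := by
    refine (hX.prod hH).isStable_raise D (μ := μ) ?_ ?_
    · have h := mem_weightSpace.1 hv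
      have h' := mem_weightSpace.1 (hX.tensorLowest_mem hv)
      rw [mem_weightSpace]
      exact fun l => Prod.ext (h l) (h' l)
    · exact fun j => Prod.ext (hF j) (hX.F_tensorLowest D hv hF j)
  rw [mem_weightSpace] at hv hw
  -- At the highest weight vector `w` the future braiding is known: `R (x ⊗ w) = w ⊗ K_l x`. This
  -- holds for the generating pair and persists under the `E_j`, because `E_j w = 0`.
  have heval : ∀ p ∈ G, p.2 w = w ⊗ₜ[ℂ] X.K l p.1 := by
    let N : Submodule ℂ (V × (V →ₗ[ℂ] V ⊗[ℂ] V)) := LinearMap.ker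
      (LinearMap.applyₗ w ∘ₗ LinearMap.snd ℂ _ _ -
        TensorProduct.mk ℂ V V w ∘ₗ X.K l ∘ₗ LinearMap.fst ℂ _ _)
    have hN : ∀ p, p ∈ N ↔ p.2 w = w ⊗ₜ[ℂ] X.K l p.1 := fun p => by
      simp [N, LinearMap.mem_ker, sub_eq_zero]
    suffices h : G ≤ N from fun p hp => (hN p).1 (h hp)
    refine raise_le ?_ ?_
    · rw [hN]
      change X.K μ w ⊗ₜ[ℂ] v = _
      rw [hw, hv, qchar_comm D, TensorProduct.tmul_smul, TensorProduct.smul_tmul']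
    · rintro j ⟨x, g⟩ hp
      rw [hN] at hp ⊢
      change (X.hom a (X.tensor a X)).E j g w = w ⊗ₜ[ℂ] X.K l (X.E j x)
      change g w = w ⊗ₜ[ℂ] X.K l x at hp
      rw [hom_E_apply, hE, map_zero, map_zero, map_zero, sub_zero, hp, tensor_E_tmul, hE,
        TensorProduct.zero_tmul, zero_add, hw, hX.K_E_apply, qchar_comm D,
        TensorProduct.tmul_smul, TensorProduct.smul_tmul']
  obtain ⟨φ, hφ, hφG⟩ := exists_isHom_of_graph hG (hirr.exists_mem_graph hG hmem hv0) (by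
    intro g hg
    -- The maps `g` with `(0, g) ∈ G` form a stable space and all kill `w`. Their common kernel is
    -- stable and nonzero, so it is `V`, and `G` is the graph of a function.
    have htop := hirr.eq_top (hX.isStable_iInf_ker hT hG.comap_inr) (v := w) (by
      simp only [Submodule.mem_iInf, LinearMap.mem_ker]
      intro g hg
      simpa using heval _ hg) hw0
    ext x
    have hx : x ∈ ⨅ g ∈ G.comap (LinearMap.inr ℂ _ _), LinearMap.ker g := by rw [htop]; trivial
    simp only [Submodule.mem_iInf, LinearMap.mem_ker] at hx
    exact hx g hg)
  exact ⟨φ, hφ, hφG _ _ hmem⟩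

/-- The span of the `w' ⊗ v'` with `v'` of weight lower than `μ` and `w'` of weight higher than
`ν`. -/
def lowerTensors (a : Matrix I I ℤ) (d : I → ℝ) (q : ℝ) (X : GenAction t V) (μ ν : Weight I) :
    Submodule ℂ (V ⊗[ℂ] V) :=
  Submodule.span ℂ {z : V ⊗[ℂ] V | ∃ (μ' ν' : Weight I) (v' w' : V),
    v' ∈ X.weightSpace a d q μ' ∧ w' ∈ X.weightSpace a d q ν' ∧
    WeightLT a t μ' μ ∧ WeightLT a t ν ν' ∧ z = w' ⊗ₜ[ℂ] v'}

theorem tmul_mem_lowerTensors {μ ν μ' ν' : Weight I} {v w : V}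
    (hv : v ∈ X.weightSpace a d q μ') (hw : w ∈ X.weightSpace a d q ν')
    (hμ : WeightLT a t μ' μ) (hν : WeightLT a t ν ν') :
    w ⊗ₜ[ℂ] v ∈ X.lowerTensors a d q μ ν :=
  Submodule.subset_span ⟨μ', ν', v, w, hv, hw, hμ, hν, rfl⟩

theorem lowerTensors_add_right_le (j : {j : I // j ≠ t}) (μ ν : Weight I) :
    X.lowerTensors a d q μ (ν + simpleRoot a j.1) ≤
      X.lowerTensors a d q (μ + simpleRoot a j.1) ν := by
  refine Submodule.span_le.2 ?_
  rintro _ ⟨μ', ν', v, w, hv, hw, hμ, hν, rfl⟩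
  exact tmul_mem_lowerTensors hv hw (WeightLT.trans hμ (weightLT_of_add_simpleRoot a j.2 _))
    (WeightLT.trans (weightLT_of_add_simpleRoot a j.2 _) hν)

theorem WeightLT.add_right {μ ν : Weight I} (h : WeightLT a t μ ν) (κ : Weight I) :
    WeightLT a t (μ + κ) (ν + κ) := by
  obtain ⟨c, hc, hc0, rfl⟩ := h
  exact ⟨c, hc, hc0, by abel⟩

theorem IsRep.E_mem_lowerTensors (D : IsDatum a d q) (hX : X.IsRep a d q) (j) {μ ν : Weight I}
    {z : V ⊗[ℂ] V} (hz : z ∈ X.lowerTensors a d q μ ν) :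
    (X.tensor a X).E j z ∈ X.lowerTensors a d q (μ + simpleRoot a j.1) ν := by
  suffices h : X.lowerTensors a d q μ ν ≤
    (X.lowerTensors a d q (μ + simpleRoot a j.1) ν).comap ((X.tensor a X).E j) from h hz
  refine Submodule.span_le.2 ?_
  rintro _ ⟨μ', ν', v, w, hv, hw, hμ, hν, rfl⟩
  rw [SetLike.mem_coe, Submodule.mem_comap, tensor_E_tmul, mem_weightSpace.1 hw]
  have hα := fun κ => weightLT_of_add_simpleRoot a j.2 κ
  refine Submodule.add_mem _ ?_ ?_
  · exact tmul_mem_lowerTensors hv (hX.E_mem D hw j) (WeightLT.trans hμ (hα _))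
      (WeightLT.trans hν (hα _))
  · exact tmul_mem_lowerTensors (hX.E_mem D hv j) (Submodule.smul_mem _ _ hw)
      (WeightLT.add_right hμ _) hν

/-- The map is a homomorphism by construction, and at the lowest vector `v` it has no correction
terms. The required triangular form then spreads from `v` to all of `V` by applying the `E_j` in the
first factor. -/
theorem IsRep.exists_isBraiding (D : IsDatum a d q) (hX : X.IsRep a d q) (hirr : X.IsIrr)
    {μ l : Weight I} {v w : V} (hv : v ∈ X.weightSpace a d q μ) (hv0 : v ≠ 0)
    (hF : ∀ j, X.F j v = 0) (hw : w ∈ X.weightSpace a d q l) (hw0 : w ≠ 0)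
    (hE : ∀ j, X.E j w = 0) : ∃ R, X.IsBraiding a d q R := by
  obtain ⟨φ, hφ, hφv⟩ := hX.exists_isHom_tensorLowest D hirr hv hv0 hF hw hw0 hE
  set R := TensorProduct.lift φ with hR
  have hRhom := hX.isHom_lift hφ
  refine ⟨R, hRhom, ?_⟩
  let T : Weight I → Submodule ℂ V := fun κ =>
    { carrier := {x | x ∈ X.weightSpace a d q κ ∧ ∀ ν, ∀ y ∈ X.weightSpace a d q ν,
        R (x ⊗ₜ[ℂ] y) - qchar a d q κ ν • (y ⊗ₜ[ℂ] x) ∈ X.lowerTensors a d q κ ν}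
      add_mem' := by
        rintro x x' ⟨hx, h⟩ ⟨hx', h'⟩
        refine ⟨Submodule.add_mem _ hx hx', fun ν y hy => ?_⟩
        have := Submodule.add_mem _ (h ν y hy) (h' ν y hy)
        rwa [← add_sub_add_comm, ← map_add, ← smul_add, ← TensorProduct.add_tmul,
          ← TensorProduct.tmul_add] at this
      zero_mem' := ⟨Submodule.zero_mem _, fun ν y _ => by simp⟩
      smul_mem' := by
        rintro c x ⟨hx, h⟩
        refine ⟨Submodule.smul_mem _ _ hx, fun ν y hy => ?_⟩
        have := Submodule.smul_mem _ c (h ν y hy)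
        rwa [smul_sub, smul_comm c, ← map_smul, TensorProduct.smul_tmul',
          ← TensorProduct.tmul_smul] at this }
  have hTle : T ≤ fun κ => X.weightSpace a d q κ := fun κ x hx => hx.1
  have hTop : ⨆ κ, T κ = ⊤ := by
    rw [eq_top_iff, ← hirr.eq_top (hX.isStable_raise D hv hF) (mem_raise_self v) hv0]
    refine raise_le (Submodule.mem_iSup_of_mem μ ⟨hv, fun ν y hy => ?_⟩) fun j => ?_
    · rw [hR, TensorProduct.lift.tmul, hφv, tensorLowest_apply, mem_weightSpace.1 hy,
        TensorProduct.smul_tmul', sub_self]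
      exact Submodule.zero_mem _
    · suffices h : ⨆ κ, T κ ≤ (⨆ κ, T κ).comap (X.E j) from h
      refine iSup_le fun κ x hx => Submodule.mem_iSup_of_mem (κ + simpleRoot a j.1)
        ⟨hX.E_mem D hx.1 j, fun ν y hy => ?_⟩
      -- Since `R` is a homomorphism, `R (E_j x ⊗ y)` is `E_j R (x ⊗ y)` minus a multiple of `R (x ⊗
      -- E_j y)`. Both leading terms are known; the contributions to `E_j y ⊗ x` count as
      -- corrections for the raised weight of `E_j x`.
      have h1 := hX.E_mem_lowerTensors D j (hx.2 ν y hy)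
      have h2 := lowerTensors_add_right_le j _ _ (hx.2 _ _ (hX.E_mem D hy j))
      have h3 : X.E j y ⊗ₜ[ℂ] x ∈ X.lowerTensors a d q (κ + simpleRoot a j.1) ν :=
        tmul_mem_lowerTensors hx.1 (hX.E_mem D hy j) (weightLT_of_add_simpleRoot a j.2 _)
          (weightLT_of_add_simpleRoot a j.2 _)
      have h4 := hRhom.2.1 j (x ⊗ₜ[ℂ] y)
      rw [tensor_E_tmul, mem_weightSpace.1 hx.1, map_add, ← TensorProduct.smul_tmul', map_smul,
        ← hR, ← eq_sub_iff_add_eq] at h4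
      rw [h4]
      rw [map_sub, map_smul, tensor_E_tmul, mem_weightSpace.1 hy] at h1
      set c := qchar a d q (simpleRoot a j.1) κ
      have h5 := Submodule.add_mem _ (Submodule.sub_mem _ h1 (Submodule.smul_mem _ c h2))
        (Submodule.smul_mem _ (qchar a d q κ ν - c * qchar a d q κ (ν + simpleRoot a j.1)) h3)
      convert h5 using 1
      rw [qchar_add_left D, ← TensorProduct.smul_tmul']
      module
  intro κ ν x y hx hy
  -- The `T κ` lie in the independent weight spaces and together span `V`, so each fills its weight
  -- space.
  have hx' : x ∈ T κ := by
    rw [iSupIndep.eq_of_le_of_iSup_eq_top (hX.iSupIndep_weightSpace D) hTle hTop κ]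
    exact hx
  exact hx'.2 ν y hy

end GenAction

end

end QuantumNilradical

/-! ### Existence of the commutor from an invariant inner product, and transport of inner products.
-/

namespace QuantumNilradical

open scoped TensorProduct

noncomputable section

/-! ### Diagonal forms and the polar decomposition -/

section PosForm

variable {E ι : Type*} [AddCommGroup E] [Module ℂ E] [Fintype ι]

/-- The Hermitian form for which the basis `e` is orthogonal and `e i` has square length `m i`. -/
def diagForm (e : Module.Basis ι ℂ E) (m : ι → ℝ) : E →ₗ⋆[ℂ] E →ₗ[ℂ] ℂ :=
  LinearMap.mk₂'ₛₗ (starRingEnd ℂ) (RingHom.id ℂ)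
    (fun x y => ∑ i, m i * (starRingEnd ℂ (e.repr x i) * e.repr y i))
    (fun x x' y => by simp [add_mul, mul_add, Finset.sum_add_distrib])
    (fun c x y => by simp only [map_smul, Finsupp.smul_apply, smul_eq_mul, map_mul,
      Finset.mul_sum]; exact Finset.sum_congr rfl fun i _ => by ring)
    (fun x y y' => by simp [mul_add, Finset.sum_add_distrib])
    (fun c x y => by simp only [map_smul, Finsupp.smul_apply, smul_eq_mul, RingHom.id_apply,
      Finset.mul_sum]; exact Finset.sum_congr rfl fun i _ => by ring)

theorem diagForm_apply (e : Module.Basis ι ℂ E) (m : ι → ℝ) (x y : E) :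
    diagForm e m x y = ∑ i, m i * (starRingEnd ℂ (e.repr x i) * e.repr y i) := rfl

theorem diagForm_basis [DecidableEq ι] (e : Module.Basis ι ℂ E) (m : ι → ℝ) (i j : ι) :
    diagForm e m (e i) (e j) = if i = j then (m i : ℂ) else 0 := by
  rw [diagForm_apply, Finset.sum_eq_single i]
  · by_cases h : i = j
    · simp [h]
    · simp [h]
  · intro k _ hk
    simp [Finsupp.single_apply, hk.symm]
  · simp

theorem isPosForm_diagForm (e : Module.Basis ι ℂ E) {m : ι → ℝ} (hm : ∀ i, 0 < m i) :
    IsPosForm (diagForm e m) := by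
  refine ⟨fun v w => ?_, fun v hv => ?_⟩
  · simp only [diagForm_apply, map_sum, map_mul, Complex.conj_ofReal, Complex.conj_conj]
    exact Finset.sum_congr rfl fun i _ => by ring
  · have h1 : ∀ i, ((m i : ℂ) * (starRingEnd ℂ (e.repr v i) * e.repr v i)).re =
        m i * Complex.normSq (e.repr v i) := fun i => by
      rw [← Complex.normSq_eq_conj_mul_self, ← Complex.ofReal_mul, Complex.ofReal_re]
    rw [diagForm_apply, Complex.re_sum, Finset.sum_congr rfl fun i _ => h1 i]
    obtain ⟨i, hi⟩ : ∃ i, e.repr v i ≠ 0 := by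
      by_contra! h
      exact hv (e.ext_elem fun i => by simp [h])
    exact Finset.sum_pos' (fun i _ => mul_nonneg (hm i).le (Complex.normSq_nonneg _))
      ⟨i, Finset.mem_univ i, mul_pos (hm i) (Complex.normSq_pos.2 hi)⟩

omit [Fintype ι] in
/-- Two sesquilinear forms that agree on a basis are equal. -/
theorem sesquilin_ext {h h' : E →ₗ⋆[ℂ] E →ₗ[ℂ] ℂ} (e : Module.Basis ι ℂ E)
    (hh : ∀ i j, h (e i) (e j) = h' (e i) (e j)) (x y : E) : h x y = h' x y := by
  have : h = h' := e.ext fun i => e.ext fun j => hh i j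
  rw [this]

/-- In an orthonormal eigenbasis with eigenvalues `r i`, the factors are diagonal with entries `|r
i|` and `r i / |r i|`. -/
theorem IsPosForm.exists_polar [FiniteDimensional ℂ E] {h : E →ₗ⋆[ℂ] E →ₗ[ℂ] ℂ}
    (hh : IsPosForm h) {T : E →ₗ[ℂ] E} (hT : ∀ x y, h (T x) y = h x (T y))
    (hinj : Function.Injective T) :
    ∃ s P : E →ₗ[ℂ] E, (∀ x y, h (P x) y = h x (P y)) ∧ (∀ x, 0 ≤ (h x (P x)).re) ∧
      (Function.Surjective s ∧ ∀ x y, h (s x) (s y) = h x y) ∧ T = s ∘ₗ P := by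
  obtain ⟨e, r, he, her⟩ : ∃ (e : Module.Basis (Fin (Module.finrank ℂ E)) ℂ E)
      (r : Fin (Module.finrank ℂ E) → ℝ), (∀ i j, h (e i) (e j) = if i = j then 1 else 0) ∧
        ∀ i, T (e i) = (r i : ℂ) • e i := by
    let _ := hh.core.toNormedAddCommGroup
    let _ : InnerProductSpace ℂ E := InnerProductSpace.ofCore hh.core.toCore
    have hsym : T.IsSymmetric := hT
    refine ⟨(hsym.eigenvectorBasis rfl).toBasis, hsym.eigenvalues rfl, fun i j => ?_, fun i => ?_⟩
    · rw [OrthonormalBasis.coe_toBasis]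
      exact orthonormal_iff_ite.1 (hsym.eigenvectorBasis rfl).orthonormal i j
    · rw [OrthonormalBasis.coe_toBasis]
      exact hsym.apply_eigenvectorBasis rfl i
  have hr : ∀ i, r i ≠ 0 := fun i hi => by
    have : T (e i) = 0 := by rw [her, hi]; simp
    exact e.ne_zero i (hinj (this.trans (map_zero T).symm))
  let P : E →ₗ[ℂ] E := e.constr ℂ fun i => ((|r i| : ℝ) : ℂ) • e i
  let s : E →ₗ[ℂ] E := e.constr ℂ fun i => ((r i / |r i| : ℝ) : ℂ) • e i
  have hP : ∀ i, P (e i) = ((|r i| : ℝ) : ℂ) • e i := fun i => e.constr_basis ℂ _ i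
  have hs : ∀ i, s (e i) = ((r i / |r i| : ℝ) : ℂ) • e i := fun i => e.constr_basis ℂ _ i
  have hsq : ∀ i, (r i / |r i|) * (r i / |r i|) = 1 := fun i => by
    rw [div_mul_div_comm, abs_mul_abs_self, div_self (mul_ne_zero (hr i) (hr i))]
  have hform : ∀ x y, h x y = ∑ i, starRingEnd ℂ (e.repr x i) * e.repr y i := by
    intro x y
    have : h = diagForm e fun _ => 1 := e.ext fun i => e.ext fun j => by
      rw [he, diagForm_basis]; simp
    rw [this, diagForm_apply]
    simp
  refine ⟨s, P, fun x y => ?_, fun x => ?_, ⟨fun x => ⟨s x, ?_⟩, fun x y => ?_⟩, ?_⟩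
  · refine sesquilin_ext (h := h ∘ₛₗ P) (h' := (LinearMap.lcomp ℂ ℂ P) ∘ₛₗ h) e (fun i j => ?_) x y
    change h (P (e i)) (e j) = h (e i) (P (e j))
    rw [hP, hP, LinearMap.map_smulₛₗ, Complex.conj_ofReal, map_smul, LinearMap.smul_apply, he]
    by_cases hij : i = j <;> simp [hij]
  · have hrep : ∀ i, e.repr (P x) i = ((|r i| : ℝ) : ℂ) * e.repr x i := by
      intro i
      have : (e.coord i ∘ₗ P) = ((|r i| : ℝ) : ℂ) • e.coord i := e.ext fun j => by
        simp only [LinearMap.comp_apply, hP, map_smul, LinearMap.smul_apply, Module.Basis.coord_apply,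
          Module.Basis.repr_self, Finsupp.single_apply, smul_eq_mul]
        by_cases hij : j = i <;> simp [hij]
      exact LinearMap.congr_fun this x
    rw [hform, Complex.re_sum]
    refine Finset.sum_nonneg fun i _ => ?_
    rw [hrep, mul_left_comm, Complex.re_ofReal_mul, ← Complex.normSq_eq_conj_mul_self,
      Complex.ofReal_re]
    exact mul_nonneg (abs_nonneg _) (Complex.normSq_nonneg _)
  · have : s ∘ₗ s = LinearMap.id := e.ext fun i => by
      rw [LinearMap.comp_apply, hs, map_smul, hs, smul_smul, ← Complex.ofReal_mul, hsq,
        Complex.ofReal_one, one_smul, LinearMap.id_apply]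
    exact LinearMap.congr_fun this x
  · refine sesquilin_ext (h := (LinearMap.lcomp ℂ ℂ s) ∘ₛₗ h ∘ₛₗ s) (h' := h) e (fun i j => ?_) x y
    change h (s (e i)) (s (e j)) = h (e i) (e j)
    rw [hs, hs, map_smul, LinearMap.map_smulₛₗ h, Complex.conj_ofReal, LinearMap.smul_apply, he]
    by_cases hij : i = j
    · subst hij
      simp only [if_true, smul_eq_mul, mul_one]
      rw [← Complex.ofReal_mul, hsq, Complex.ofReal_one]
    · simp [hij]
  · refine e.ext fun i => ?_
    rw [LinearMap.comp_apply, hP, map_smul, hs, her, smul_smul, ← Complex.ofReal_mul,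
      mul_div_cancel₀ _ (abs_ne_zero.2 (hr i))]

end PosForm

namespace GenAction

variable {I : Type*} {t : I} {V W : Type*} [AddCommGroup V] [Module ℂ V] [AddCommGroup W]
  [Module ℂ W] {a : Matrix I I ℤ} {d : I → ℝ} {q : ℝ} {X : GenAction t V} {Y : GenAction t W}

theorem exists_tensor_form [FiniteDimensional ℂ V] {h : V →ₗ⋆[ℂ] V →ₗ[ℂ] ℂ} (hh : IsPosForm h) :
    ∃ h₂ : V ⊗[ℂ] V →ₗ⋆[ℂ] V ⊗[ℂ] V →ₗ[ℂ] ℂ,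
      ∀ v w v' w', h₂ (v ⊗ₜ[ℂ] w) (v' ⊗ₜ[ℂ] w') = h v v' * h w w' := by
  obtain ⟨e, he⟩ := hh.exists_basis
  have hform : h = diagForm e fun _ => 1 := e.ext fun i => e.ext fun j => by
    rw [he, diagForm_basis]; simp
  refine ⟨diagForm (e.tensorProduct e) fun _ => 1, fun v w v' w' => ?_⟩
  simp only [hform, diagForm_apply, Fintype.sum_prod_type, Module.Basis.tensorProduct_repr_tmul_apply,
    Finset.sum_mul_sum]
  refine Finset.sum_congr rfl fun i _ => Finset.sum_congr rfl fun j _ => ?_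
  simp only [smul_eq_mul, map_mul, Complex.ofReal_one]
  ring

variable [Fintype I]

theorem exists_isCommutor (D : IsDatum a d q) [FiniteDimensional ℂ V] (hX : X.IsRep a d q)
    (hirr : X.IsIrr) (hspan : ⨆ ν, X.weightSpace a d q ν = ⊤) {h : V →ₗ⋆[ℂ] V →ₗ[ℂ] ℂ}
    (hh : X.IsInvariantInner a h) {l : Weight I} {w : V} (hw : w ∈ X.weightSpace a d q l)
    (hw0 : w ≠ 0) (hE : ∀ j, X.E j w = 0) : ∃ s, X.IsCommutor a d q s := by
  have := hirr.nontrivial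
  obtain ⟨μ, v, hv⟩ := exists_isLowest D hspan
  obtain ⟨R, hR⟩ := hX.exists_isBraiding D hirr hv.mem hv.ne_zero (hv.F_eq_zero D hX) hw hw0 hE
  have hpos : IsPosForm h := ⟨hh.1, hh.2.1⟩
  obtain ⟨h₂, hh₂⟩ := exists_tensor_form hpos
  have hinj : Function.Injective R :=
    LinearMap.injective_iff_surjective.2 (hR.surjective D hX hirr hspan hv)
  obtain ⟨s, P, h1, h2, h3, h4⟩ := (isPosForm_tensor hpos hh₂).exists_polar
    (hR.selfAdjoint D hX hirr hspan hv hh hh₂) hinj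
  exact ⟨s, h, h₂, R, P, hh, hh₂, hR, h1, h2, h3, h4⟩

/-! ### Transport of invariant inner products -/

theorem op_weightSpace (D : IsDatum a d q) (μ : Weight I) :
    X.op.weightSpace a d q μ = X.weightSpace a d q (-μ) := by
  ext v
  rw [mem_weightSpace, mem_weightSpace]
  constructor
  · intro h l
    have := h (-l)
    change X.K (- -l) v = _ at this
    rw [neg_neg] at this
    rw [this, qchar_neg_left D, qchar_neg_right D]
  · intro h l
    change X.K (-l) v = _
    rw [h, qchar_neg_left D, qchar_neg_right D, inv_inv]

omit [Fintype I] in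
theorem IsIrr.op (h : X.IsIrr) : X.op.IsIrr :=
  ⟨h.nontrivial, fun N hN => h.eq_bot_or_eq_top N (op_isStable.1 hN)⟩

omit [Fintype I] in
theorem isHom_op {f : V →ₗ[ℂ] W} (h : IsHom X.op Y.op f) : IsHom X Y f :=
  ⟨fun l v => by simpa [GenAction.op] using h.1 (-l) v, h.2.2, h.2.1⟩

/-- The orthogonal complement of a stable subspace is stable. -/
theorem IsInvariantInner.isStable_orthogonal (hY : Y.IsRep a d q) {h : W →ₗ⋆[ℂ] W →ₗ[ℂ] ℂ}
    (hh : Y.IsInvariantInner a h) {N : Submodule ℂ W} (hN : Y.IsStable N) :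
    Y.IsStable (⨅ x ∈ N, LinearMap.ker (h x)) := by
  obtain ⟨-, -, hK, hE, hF⟩ := hh
  refine ⟨fun l v hv => ?_, fun j v hv => ?_, fun j v hv => ?_⟩ <;>
    simp only [Submodule.mem_iInf, LinearMap.mem_ker] at hv ⊢ <;> intro x hx
  · rw [← hK]
    exact hv _ (hN.K l x hx)
  · have := hF j x (Y.K (simpleRoot a j.1) v)
    rw [hY.K_neg_K] at this
    rw [← this, ← hK]
    exact hv _ (hN.K _ _ (hN.F j x hx))
  · have := hE j (Y.K (-simpleRoot a j.1) x) v
    rw [← hK, hY.K_K_neg] at this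
    rw [← this]
    exact hv _ (hN.E j _ (hN.K _ _ hx))

/-- An irreducible representation with a lowest weight vector embeds in every representation
with an invariant inner product and a lowest weight vector of the same weight. -/
theorem IsRep.exists_injective_isHom (D : IsDatum a d q) (hX : X.IsRep a d q) (hirr : X.IsIrr)
    (hY : Y.IsRep a d q) {h : W →ₗ⋆[ℂ] W →ₗ[ℂ] ℂ} (hh : IsPosForm h)
    (horth : ∀ N, Y.IsStable N → Y.IsStable (⨅ x ∈ N, LinearMap.ker (h x)))
    (hweight : ∀ μ ν, μ ≠ ν → ∀ x ∈ Y.weightSpace a d q μ, ∀ y ∈ Y.weightSpace a d q ν, h x y = 0)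
    {μ : Weight I} {v : V} (hv : v ∈ X.weightSpace a d q μ) (hv0 : v ≠ 0)
    (hF : ∀ j, X.F j v = 0) {w : W} (hw : w ∈ Y.weightSpace a d q μ) (hw0 : w ≠ 0)
    (hF' : ∀ j, Y.F j w = 0) : ∃ φ : V →ₗ[ℂ] W, IsHom X Y φ ∧ Function.Injective φ := by
  have hZ := hX.prod hY
  have hvw : (v, w) ∈ (X.prod Y).weightSpace a d q μ := by
    rw [mem_weightSpace] at hv hw ⊢
    exact fun l => Prod.ext (hv l) (hw l)
  have hG := hZ.isStable_raise D hvw fun j => Prod.ext (hF j) (hF' j)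
  set G := (X.prod Y).raise (v, w) with hGdef
  have hmem : (v, w) ∈ G := mem_raise_self _
  have hN := hG.comap_inr
  set N := G.comap (LinearMap.inr ℂ V W) with hNdef
  -- Write `(0, z)` as a multiple of `(v, w)` plus vectors of higher weight. The first component
  -- shows that the multiple is zero, so `z` has only weights above `μ` and is orthogonal to `w`.
  have hwN : ∀ z ∈ N, h z w = 0 := by
    intro z hz
    obtain ⟨x, hx, y, hy, hxy⟩ := Submodule.mem_sup.1 (hZ.raise_le_sup D hvw hz)
    obtain ⟨c, rfl⟩ := Submodule.mem_span_singleton.1 hx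
    have hprod : ∀ ν, ∀ p ∈ (X.prod Y).weightSpace a d q ν,
        p.1 ∈ X.weightSpace a d q ν ∧ p.2 ∈ Y.weightSpace a d q ν := by
      intro ν p hp
      simp only [mem_weightSpace] at hp ⊢
      exact ⟨fun l => congrArg Prod.fst (hp l), fun l => congrArg Prod.snd (hp l)⟩
    have hy1 : y.1 ∈ ⨆ (ν) (_ : ν ≠ μ), X.weightSpace a d q ν := by
      suffices hle : (⨆ (ν) (_ : WeightLT a t μ ν), (X.prod Y).weightSpace a d q ν) ≤
        (⨆ (ν) (_ : ν ≠ μ), X.weightSpace a d q ν).comap (LinearMap.fst ℂ V W) from hle hy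
      refine iSup₂_le fun ν hν p hp => Submodule.mem_iSup_of_mem ν
        (Submodule.mem_iSup_of_mem ?_ (hprod ν p hp).1)
      rintro rfl
      exact lt_irrefl _ (weightForm_lt_of_weightLT D hν)
    have hy2 : h w y.2 = 0 := by
      suffices hle : (⨆ (ν) (_ : WeightLT a t μ ν), (X.prod Y).weightSpace a d q ν) ≤
        (LinearMap.ker (h w)).comap (LinearMap.snd ℂ V W) from hle hy
      refine iSup₂_le fun ν hν p hp => hweight μ ν ?_ w hw p.2 (hprod ν p hp).2
      rintro rfl
      exact lt_irrefl _ (weightForm_lt_of_weightLT D hν)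
    have hc : c = 0 := by
      have h1 : c • v = -y.1 := by
        rw [eq_neg_iff_add_eq_zero]
        exact congrArg Prod.fst hxy
      have h2 : c • v = 0 := by
        have := (hX.iSupIndep_weightSpace D μ).eq_bot
        rw [← Submodule.mem_bot ℂ, ← this]
        exact ⟨Submodule.smul_mem _ c hv, h1 ▸ Submodule.neg_mem _ hy1⟩
      exact (smul_eq_zero.1 h2).resolve_right hv0
    have hz2 : z = y.2 := by
      have := congrArg Prod.snd hxy
      rw [hc] at this
      simpa using this.symm
    rw [hh.symm w z, hz2, hy2, map_zero]
  -- The complement of `N` is stable and contains `w`, hence everything generated from `w`. But `N`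
  -- itself lies in what `w` generates, so each `z ∈ N` is orthogonal to itself.
  have hperp := horth N hN
  have hle : Y.raise w ≤ ⨅ x ∈ N, LinearMap.ker (h x) := by
    refine raise_le ?_ hperp.E
    simpa only [Submodule.mem_iInf, LinearMap.mem_ker] using hwN
  obtain ⟨φ, hφ, hφG⟩ := exists_isHom_of_graph hG (hirr.exists_mem_graph hG hmem hv0) (by
    intro z hz
    have h1 := hle (prod_raise_snd hz)
    simp only [Submodule.mem_iInf, LinearMap.mem_ker] at h1
    exact hh.eq_zero (by rw [h1 z hz]; simp))
  refine ⟨φ, hφ, LinearMap.ker_eq_bot.1 ?_⟩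
  have hker : X.IsStable (LinearMap.ker φ) := by
    refine ⟨fun l x hx => ?_, fun j x hx => ?_, fun j x hx => ?_⟩ <;>
      rw [LinearMap.mem_ker] at hx ⊢
    · rw [hφ.1, hx, map_zero]
    · rw [hφ.2.1, hx, map_zero]
    · rw [hφ.2.2, hx, map_zero]
  refine (hirr.eq_bot_or_eq_top _ hker).resolve_right fun htop => hw0 ?_
  rw [← hφG v w hmem, ← LinearMap.mem_ker, htop]
  trivial

/-- An irreducible representation has an invariant inner product if some representation with a
highest weight vector of the same weight has one. -/
theorem IsRep.exists_isInvariantInner (D : IsDatum a d q) (hX : X.IsRep a d q) (hirr : X.IsIrr)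
    (hY : Y.IsRep a d q) {h : W →ₗ⋆[ℂ] W →ₗ[ℂ] ℂ} (hh : Y.IsInvariantInner a h)
    {μ : Weight I} {v : V} (hv : v ∈ X.weightSpace a d q μ) (hv0 : v ≠ 0)
    (hE : ∀ j, X.E j v = 0) {w : W} (hw : w ∈ Y.weightSpace a d q μ) (hw0 : w ≠ 0)
    (hE' : ∀ j, Y.E j w = 0) : ∃ h' : V →ₗ⋆[ℂ] V →ₗ[ℂ] ℂ, X.IsInvariantInner a h' := by
  -- After exchanging the `E_j` and the `F_j`, the highest weight vectors become lowest ones of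
  -- weight `-μ`. The inner product is then pulled back along the embedding.
  obtain ⟨φ, hφ, hinj⟩ := (hX.op D).exists_injective_isHom D (μ := -μ) hirr.op (hY.op D)
    ⟨hh.1, hh.2.1⟩
    (fun N hN => op_isStable.2 (hh.isStable_orthogonal hY (op_isStable.1 hN)))
    (fun κ ν hne x hx y hy => by
      rw [op_weightSpace D] at hx hy
      exact weightSpace_form_eq_zero D hh (neg_injective.ne hne) hx hy)
    (by rw [op_weightSpace D, neg_neg]; exact hv) hv0 hE
    (by rw [op_weightSpace D, neg_neg]; exact hw) hw0 hE'
  obtain ⟨hφK, hφE, hφF⟩ := isHom_op hφ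
  obtain ⟨h1, h2, h3, h4, h5⟩ := hh
  let h' : V →ₗ⋆[ℂ] V →ₗ[ℂ] ℂ := (LinearMap.lcomp ℂ ℂ φ) ∘ₛₗ h ∘ₛₗ φ
  refine ⟨h', fun x y => h1 _ _, fun x hx => h2 _ ?_, fun l x y => ?_, fun j x y => ?_,
    fun j x y => ?_⟩
  · exact fun h0 => hx (hinj (h0.trans (map_zero φ).symm))
  · simpa [h', hφK] using h3 l (φ x) (φ y)
  · simpa [h', hφK, hφE, hφF] using h4 j (φ x) (φ y)
  · simpa [h', hφK, hφE, hφF] using h5 j (φ x) (φ y)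

end GenAction

end

end QuantumNilradical

/-! ### The combinatorics of the roots of an abelian nilradical. -/

namespace QuantumNilradical

noncomputable section

/-! ### Root strings through the weights of an abelian nilradical -/

section Roots

variable {ι R M N : Type*} [CommRing R] [CharZero R] [IsDomain R] [AddCommGroup M] [Module R M]
  [AddCommGroup N] [Module R N] {P : RootPairing ι R M N} [P.IsCrystallographic]

omit [IsDomain R] in
theorem pairingIn_add_zsmul {β γ j : ι} {z : ℤ} (h : P.root γ = P.root β + z • P.root j) (i : ι) :
    P.pairingIn ℤ γ i = P.pairingIn ℤ β i + z * P.pairingIn ℤ j i := by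
  have h1 : P.pairing γ i = P.pairing β i + z * P.pairing j i := by
    simp only [← P.root_coroot_eq_pairing, h, map_add, map_zsmul, LinearMap.add_apply,
      LinearMap.smul_apply, zsmul_eq_mul]
  have h2 := fun k l => P.algebraMap_pairingIn ℤ k l
  simp only [eq_intCast] at h2
  rw [← h2, ← h2, ← h2] at h1
  exact_mod_cast h1

omit [IsDomain R] in
theorem pairingIn_add {β γ j : ι} (h : P.root γ = P.root β + P.root j) (i : ι) :
    P.pairingIn ℤ γ i = P.pairingIn ℤ β i + P.pairingIn ℤ j i := by
  simpa using pairingIn_add_zsmul (z := 1) (by simpa using h) i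

omit [CharZero R] [IsDomain R] in
theorem root_reflectionPerm_eq (i k : ι) :
    P.root (P.reflectionPerm i k) = P.root k + (-P.pairingIn ℤ k i) • P.root i := by
  have h2 := P.algebraMap_pairingIn ℤ k i
  rw [eq_intCast] at h2
  rw [P.root_reflectionPerm, P.reflection_apply_root, ← h2, neg_smul, ← sub_eq_add_neg,
    Int.cast_smul_eq_zsmul]

/-- A set of roots that is the set of weights of an abelian nilradical, as a module over the Levi
factor with simple roots `α_j`, `j ≠ t`. -/
structure IsAbelianRootSet (b : P.Base) (t : b.support) (Φ : Set ι) : Prop where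
  closed : ∀ j : b.support, j ≠ t → ∀ β ∈ Φ, ∀ (γ : ι) (z : ℤ),
    P.root γ = P.root β + z • P.root j → γ ∈ Φ
  ne : ∀ j : b.support, j ≠ t → ∀ β ∈ Φ, P.root β ≠ P.root j ∧ P.root β ≠ -P.root j
  add_notMem : ∀ α ∈ Φ, ∀ β ∈ Φ, P.root α + P.root β ∉ Set.range P.root

namespace IsAbelianRootSet

variable {b : P.Base} {t : b.support} {Φ : Set ι} (A : IsAbelianRootSet b t Φ)
  {i j : b.support} (hi : i ≠ t) (hj : j ≠ t)
include A

section
include hj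

omit [CharZero R] [IsDomain R] in
theorem reflectionPerm_mem {β : ι} (hβ : β ∈ Φ) : P.reflectionPerm j β ∈ Φ :=
  A.closed j hj β hβ _ _ (root_reflectionPerm_eq _ _)

variable [Finite ι] [P.IsReduced]

/-- A pairing `±3` would make the product of the two pairings of `β` and `α_j` equal to `3`. Then
`⟨s_j β, β^∨⟩ = 2 - 3 = -1`, so `s_j β + β` would be a root, although both summands lie in `Φ`. -/
theorem abs_pairingIn_le {β : ι} (hβ : β ∈ Φ) :
    -2 ≤ P.pairingIn ℤ β j ∧ P.pairingIn ℤ β j ≤ 2 := by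
  have h := P.pairingIn_pairingIn_mem_set_of_isCrystal_of_isRed' β j (A.ne j hj β hβ).1
    (A.ne j hj β hβ).2
  have key : P.pairingIn ℤ β j * P.pairingIn ℤ j β ≠ 3 := by
    intro h3
    refine A.add_notMem _ (A.reflectionPerm_mem hj hβ) β hβ
      ⟨P.reflectionPerm β (P.reflectionPerm j β), ?_⟩
    have h1 := pairingIn_add_zsmul (root_reflectionPerm_eq (P := P) j β) β
    rw [P.pairingIn_same, neg_mul, h3] at h1
    rw [root_reflectionPerm_eq, h1]
    simp
  simp only [Set.mem_insert_iff, Set.mem_singleton_iff, Prod.mk.injEq] at h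
  rcases h with ⟨h, h'⟩ | ⟨h, h'⟩ | ⟨h, h'⟩ | ⟨h, h'⟩ | ⟨h, h'⟩ | ⟨h, h'⟩ | ⟨h, h'⟩ | ⟨h, h'⟩ |
    ⟨h, h'⟩ | ⟨h, h'⟩ | ⟨h, h'⟩ <;> rw [h, h'] at key <;> simp at key <;> omega

omit [P.IsReduced] in
theorem exists_add {β : ι} (hβ : β ∈ Φ) (h : P.pairingIn ℤ β j < 0) :
    ∃ γ ∈ Φ, P.root γ = P.root β + P.root j := by
  obtain ⟨γ, hγ⟩ := P.root_add_root_mem_of_pairingIn_neg h (A.ne j hj β hβ).2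
  exact ⟨γ, A.closed j hj β hβ γ 1 (by simpa using hγ), hγ⟩

omit [P.IsReduced] in
theorem exists_sub {β : ι} (hβ : β ∈ Φ) (h : 0 < P.pairingIn ℤ β j) :
    ∃ γ ∈ Φ, P.root β = P.root γ + P.root j := by
  obtain ⟨γ, hγ⟩ := P.root_sub_root_mem_of_pairingIn_pos h
    (fun hbj => (A.ne j hj β hβ).1 (by rw [hbj]))
  exact ⟨γ, A.closed j hj β hβ γ (-1) (by simpa [sub_eq_add_neg] using hγ), by simp [hγ]⟩

theorem pairingIn_of_add {β γ : ι} (hβ : β ∈ Φ) (hγ : γ ∈ Φ)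
    (h : P.root γ = P.root β + P.root j) :
    -2 ≤ P.pairingIn ℤ β j ∧ P.pairingIn ℤ β j ≤ 0 ∧
      P.pairingIn ℤ γ j = P.pairingIn ℤ β j + 2 := by
  have h1 := pairingIn_add h (j : ι)
  rw [P.pairingIn_same] at h1
  have h2 := A.abs_pairingIn_le hj hβ
  have h3 := A.abs_pairingIn_le hj hγ
  omega

-- The reflection in `α_j` fixes `β` and exchanges `β + α_j` with `β - α_j`.
omit [IsDomain R] [Finite ι] [P.IsReduced] in
theorem exists_add_iff_exists_sub {β : ι} (h : P.pairingIn ℤ β j = 0) :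
    (∃ γ ∈ Φ, P.root γ = P.root β + P.root j) ↔ ∃ γ ∈ Φ, P.root β = P.root γ + P.root j := by
  constructor
  · rintro ⟨γ, hγ, hr⟩
    refine ⟨P.reflectionPerm j γ, A.reflectionPerm_mem hj hγ, ?_⟩
    rw [root_reflectionPerm_eq, pairingIn_add hr, h, P.pairingIn_same, hr]
    module
  · rintro ⟨γ, hγ, hr⟩
    refine ⟨P.reflectionPerm j γ, A.reflectionPerm_mem hj hγ, ?_⟩
    have h1 := pairingIn_add hr (j : ι)
    rw [h, P.pairingIn_same] at h1
    rw [root_reflectionPerm_eq, show P.pairingIn ℤ γ j = -2 by omega, hr]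
    module

/-- A pairing `±2` between nonproportional roots forces the opposite pairing to be `±1`, and the
ratio of the pairings is the ratio of the square lengths. -/
theorem form_eq_two_mul (B : P.InvariantForm) {θ : ι} (hθ : θ ∈ Φ)
    (h : P.pairingIn ℤ θ j = 2 ∨ P.pairingIn ℤ θ j = -2) :
    B.form (P.root θ) (P.root θ) = 2 * B.form (P.root j) (P.root j) := by
  have h1 := P.pairingIn_pairingIn_mem_set_of_isCrystal_of_isRed' θ j (A.ne j hj θ hθ).1
    (A.ne j hj θ hθ).2
  have h2 := B.pairing_mul_eq_pairing_mul_swap θ j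
  have h3 := fun k l => P.algebraMap_pairingIn ℤ k l
  simp only [eq_intCast] at h3
  rw [← h3, ← h3] at h2
  simp only [Set.mem_insert_iff, Set.mem_singleton_iff, Prod.mk.injEq] at h1
  rcases h with h | h
  · have h4 : P.pairingIn ℤ j θ = 1 := by omega
    rw [h, h4] at h2
    push_cast at h2
    linear_combination h2
  · have h4 : P.pairingIn ℤ j θ = -1 := by omega
    rw [h, h4] at h2
    push_cast at h2
    linear_combination -h2

end

variable [Finite ι]
include hi hj

theorem exists_sub_iff_exists_add (hij : i ≠ j) {β γ : ι} (hβ : β ∈ Φ)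
    (h : P.root γ + P.root j = P.root β + P.root i) :
    (∃ δ ∈ Φ, P.root β = P.root δ + P.root j ∧ P.root γ = P.root δ + P.root i) ↔
      ∃ ε ∈ Φ, P.root ε = P.root β + P.root i ∧ P.root ε = P.root γ + P.root j := by
  have key := b.root_sub_mem_iff_root_add_mem i j β (fun h => hij (Subtype.ext h)) i.2 j.2
    (fun h => (A.ne j hj β hβ).1 (by rw [h])) (A.ne i hi β hβ).2
    ⟨γ, by rw [← h, add_sub_cancel_right]⟩
  constructor
  · rintro ⟨δ, -, hδ, -⟩
    obtain ⟨ε, hε⟩ := key.1 ⟨δ, by rw [hδ, add_sub_cancel_right]⟩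
    exact ⟨ε, A.closed i hi β hβ ε 1 (by simpa using hε), hε, by rw [hε, h]⟩
  · rintro ⟨ε, -, hε, -⟩
    obtain ⟨δ, hδ⟩ := key.2 ⟨ε, hε⟩
    refine ⟨δ, A.closed j hj β hβ δ (-1) (by simpa [sub_eq_add_neg] using hδ), by simp [hδ], ?_⟩
    rw [hδ, sub_add_eq_add_sub, ← h, add_sub_cancel_right]

/-- This is what makes the matrix coefficients along the two paths of a square of roots multiply to
the same number. Either opposite sides have equal pairings, or `α_i` and `α_j` span a system of type
`A₂` and the same two coefficients occur in exchanged order. -/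
theorem pairingIn_parallelogram [P.IsReduced] (hij : i ≠ j) {δ β γ ε : ι} (hδ : δ ∈ Φ)
    (hβ : β ∈ Φ) (hγ : γ ∈ Φ) (hε : ε ∈ Φ) (hβδ : P.root β = P.root δ + P.root j)
    (hγδ : P.root γ = P.root δ + P.root i) (hεβ : P.root ε = P.root β + P.root i)
    (hεγ : P.root ε = P.root γ + P.root j) :
    (P.pairingIn ℤ β i = P.pairingIn ℤ δ i ∧ P.pairingIn ℤ γ j = P.pairingIn ℤ δ j) ∨
    (P.pairingIn ℤ i j = -1 ∧ P.pairingIn ℤ j i = -1 ∧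
      ((P.pairingIn ℤ δ i = 0 ∧ P.pairingIn ℤ δ j = -1 ∧ P.pairingIn ℤ β i = -1 ∧
          P.pairingIn ℤ γ j = -2) ∨
        (P.pairingIn ℤ δ i = -1 ∧ P.pairingIn ℤ δ j = 0 ∧ P.pairingIn ℤ β i = -2 ∧
          P.pairingIn ℤ γ j = -1))) := by
  have := Fintype.ofFinite ι
  have : P.IsAnisotropic := P.instIsAnisotropicOfIsCrystallographic
  let B := P.toInvariantForm
  have hij' : (i : ι) ≠ j := fun h => hij (Subtype.ext h)
  have hset := P.pairingIn_pairingIn_mem_set_of_isCrystal_of_isRed' i j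
    (fun h => hij' (P.root.injective h)) (b.root_ne_neg_of_ne i.2 j.2 hij')
  have hle := b.pairingIn_le_zero_of_ne hij' i.2 j.2
  have hswap := B.pairing_mul_eq_pairing_mul_swap (i : ι) j
  have hcast := fun k l => P.algebraMap_pairingIn ℤ k l
  simp only [eq_intCast] at hcast
  -- If `θ` pairs to `±2` with `α_k`, its square length is twice that of `α_k`, hence twice that of
  -- an equally long `α_l`. So `⟨θ, α_l^∨⟩ = 2 ⟨α_l, θ^∨⟩`.
  have heven : ∀ θ ∈ Φ, ∀ k l : b.support, k ≠ t → (P.pairingIn ℤ θ k = 2 ∨ P.pairingIn ℤ θ k = -2) →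
      B.form (P.root k) (P.root k) = B.form (P.root l) (P.root l) → Even (P.pairingIn ℤ θ l) := by
    intro θ hθ k l hk h hkl
    have h1 := A.form_eq_two_mul hk B hθ h
    have h2 := B.pairing_mul_eq_pairing_mul_swap θ (l : ι)
    rw [h1, hkl, ← hcast, ← hcast, ← mul_assoc] at h2
    have h3 := mul_right_cancel₀ (B.ne_zero l) h2
    refine ⟨P.pairingIn ℤ l θ, ?_⟩
    have h4 : P.pairingIn ℤ l θ * 2 = P.pairingIn ℤ θ l := by exact_mod_cast h3
    omega
  have hne : ∀ θ ∈ Φ, (P.pairingIn ℤ θ i = 2 ∨ P.pairingIn ℤ θ i = -2) →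
      (P.pairingIn ℤ θ j = 2 ∨ P.pairingIn ℤ θ j = -2) →
      B.form (P.root i) (P.root i) = B.form (P.root j) (P.root j) := by
    intro θ hθ h h'
    have h1 := (A.form_eq_two_mul hi B hθ h).symm.trans (A.form_eq_two_mul hj B hθ h')
    exact mul_left_cancel₀ two_ne_zero h1
  have hlen : B.form (P.root i) (P.root i) = B.form (P.root j) (P.root j) →
      P.pairingIn ℤ i j = P.pairingIn ℤ j i := by
    intro h
    rw [h, ← hcast, ← hcast] at hswap
    exact_mod_cast (mul_right_cancel₀ (B.ne_zero j) hswap).symm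
  have hlen' : P.pairingIn ℤ i j = -1 → P.pairingIn ℤ j i = -1 →
      B.form (P.root i) (P.root i) = B.form (P.root j) (P.root j) := by
    intro h h'
    rw [← hcast, ← hcast, h, h'] at hswap
    push_cast at hswap
    linear_combination -hswap
  have e1 := pairingIn_add hβδ (i : ι)
  have e2 := pairingIn_add hβδ (j : ι)
  have e3 := pairingIn_add hγδ (i : ι)
  have e4 := pairingIn_add hγδ (j : ι)
  have r1 := A.pairingIn_of_add hj hδ hβ hβδ
  have r2 := A.pairingIn_of_add hi hδ hγ hγδ
  have r3 := A.pairingIn_of_add hi hβ hε hεβ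
  have r4 := A.pairingIn_of_add hj hγ hε hεγ
  rw [P.pairingIn_same] at e2 e3
  have hγ' : P.pairingIn ℤ γ i = 2 ∨ P.pairingIn ℤ γ i = -2 → B.form (P.root i) (P.root i) =
      B.form (P.root j) (P.root j) → P.pairingIn ℤ γ j % 2 = 0 :=
    fun h h' => Int.even_iff.1 (heven γ hγ i j hi h h')
  have hβ' : P.pairingIn ℤ β i = 2 ∨ P.pairingIn ℤ β i = -2 → B.form (P.root i) (P.root i) =
      B.form (P.root j) (P.root j) → P.pairingIn ℤ β j % 2 = 0 :=
    fun h h' => Int.even_iff.1 (heven β hβ i j hi h h')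
  have hβn := fun h h' => hlen (hne β hβ h h')
  have hγn := fun h h' => hlen (hne γ hγ h h')
  simp only [Set.mem_insert_iff, Set.mem_singleton_iff, Prod.mk.injEq] at hset
  by_cases hp : P.pairingIn ℤ i j = -1 ∧ P.pairingIn ℤ j i = -1
  · have hL := hlen' hp.1 hp.2
    have hγ'' := fun h => hγ' h hL
    have hβ'' := fun h => hβ' h hL
    clear hγ' hβ' hlen hlen' hne heven hβn hγn
    omega
  · clear hγ' hβ' hlen hlen' hne heven
    rcases hset with ⟨h, h'⟩ | ⟨h, h'⟩ | ⟨h, h'⟩ | ⟨h, h'⟩ | ⟨h, h'⟩ | ⟨h, h'⟩ | ⟨h, h'⟩ |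
      ⟨h, h'⟩ | ⟨h, h'⟩ | ⟨h, h'⟩ | ⟨h, h'⟩ <;> rw [h, h'] at hβn hγn hp <;> rw [h] at hle e4 <;>
      rw [h'] at e1 <;> omega

end IsAbelianRootSet

end Roots

end

end QuantumNilradical

/-! ### Explicit unitary models. -/

namespace QuantumNilradical

open scoped TensorProduct

noncomputable section

/-! ### Representations with one-dimensional weight spaces -/

namespace GenAction

variable {I : Type*} [Fintype I] {t : I} {a : Matrix I I ℤ} {d : I → ℝ} {q : ℝ}
  {S : Type*} [Fintype S] [DecidableEq S]

/-- The action on `ℂ^S` for which the basis vector `x_β` has weight `wt β`,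
`E_j x_β = ∑_γ m j β γ x_γ`, and `F_j` is the transpose of `E_j`. -/
def model (a : Matrix I I ℤ) (d : I → ℝ) (q : ℝ) (wt : S → Weight I)
    (m : {j : I // j ≠ t} → S → S → ℝ) : GenAction t (S → ℂ) where
  K l := Matrix.toLin' (Matrix.diagonal fun β => qchar a d q l (wt β))
  E j := Matrix.toLin' (Matrix.of fun γ β => (m j β γ : ℂ))
  F j := Matrix.toLin' (Matrix.of fun β γ => (m j β γ : ℂ))

/-- Conditions on the matrix entries under which `model` is a representation. -/
structure IsModel (a : Matrix I I ℤ) (d : I → ℝ) (q : ℝ) (wt : S → Weight I)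
    (m : {j : I // j ≠ t} → S → S → ℝ) : Prop where
  weight : ∀ j β γ, m j β γ ≠ 0 → wt γ = wt β + simpleRoot a j.1
  comm_same : ∀ j β γ, ∑ δ, m j δ γ * m j δ β - ∑ ε, m j γ ε * m j β ε =
    if γ = β then (qi d q j.1 - (qi d q j.1)⁻¹)⁻¹ *
      (qi d q j.1 ^ wt β j.1 - qi d q j.1 ^ (-wt β j.1)) else 0
  comm_ne : ∀ i j, i ≠ j → ∀ β γ, ∑ δ, m i δ γ * m j δ β = ∑ ε, m j γ ε * m i β ε

variable {wt : S → Weight I} {m : {j : I // j ≠ t} → S → S → ℝ}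

theorem model_K_apply (l : Weight I) (v : S → ℂ) (β : S) :
    (model (t := t) a d q wt m).K l v β = qchar a d q l (wt β) * v β := by
  simp [model, Matrix.mulVec_diagonal]

theorem model_E_apply (j) (v : S → ℂ) (γ : S) :
    (model a d q wt m).E j v γ = ∑ β, (m j β γ : ℂ) * v β := rfl

theorem model_F_apply (j) (v : S → ℂ) (β : S) :
    (model a d q wt m).F j v β = ∑ γ, (m j β γ : ℂ) * v γ := rfl

theorem IsModel.isRep (D : IsDatum a d q) (hm : IsModel a d q wt m) :
    (model a d q wt m).IsRep a d q := by
  refine ⟨?_, fun l l' => ?_, fun l j => ?_, fun l j => ?_, fun j => ?_, fun i j hij => ?_⟩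
  · simp [model, qchar_zero_left, Module.End.one_eq_id]
  · change Matrix.toLin' _ = Matrix.toLin' _ ∘ₗ Matrix.toLin' _
    rw [← Matrix.toLin'_mul, Matrix.diagonal_mul_diagonal]
    simp only [qchar_add_left D]
  · change Matrix.toLin' _ ∘ₗ Matrix.toLin' _ = _ • (Matrix.toLin' _ ∘ₗ Matrix.toLin' _)
    rw [← Matrix.toLin'_mul, ← Matrix.toLin'_mul, ← map_smul]
    congr 1
    ext γ β
    rw [Matrix.smul_apply, Matrix.diagonal_mul, Matrix.mul_diagonal, Matrix.of_apply, smul_eq_mul]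
    by_cases h0 : m j β γ = 0
    · simp [h0]
    · rw [hm.weight j β γ h0, qchar_add_right D]
      ring
  · change Matrix.toLin' _ ∘ₗ Matrix.toLin' _ = _ • (Matrix.toLin' _ ∘ₗ Matrix.toLin' _)
    rw [← Matrix.toLin'_mul, ← Matrix.toLin'_mul, ← map_smul]
    congr 1
    ext β γ
    rw [Matrix.smul_apply, Matrix.diagonal_mul, Matrix.mul_diagonal, Matrix.of_apply, smul_eq_mul]
    by_cases h0 : m j β γ = 0
    · simp [h0]
    · rw [hm.weight j β γ h0, qchar_add_right D, qchar_neg_right D]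
      field_simp [qchar_ne_zero D l (simpleRoot a j.1)]
  · change Matrix.toLin' _ ∘ₗ Matrix.toLin' _ - Matrix.toLin' _ ∘ₗ Matrix.toLin' _ =
      _ • (Matrix.toLin' _ - Matrix.toLin' _)
    rw [← Matrix.toLin'_mul, ← Matrix.toLin'_mul, ← map_sub, ← map_sub, ← map_smul]
    congr 1
    ext γ β
    have h := congrArg (fun x : ℝ => (x : ℂ)) (hm.comm_same j β γ)
    simp only [Matrix.sub_apply, Matrix.mul_apply, Matrix.of_apply, Matrix.smul_apply,
      Matrix.diagonal_apply, smul_eq_mul]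
    simp only [Complex.ofReal_sub, Complex.ofReal_sum, Complex.ofReal_mul] at h
    rw [h]
    by_cases hγβ : γ = β
    · subst hγβ
      simp only [if_true]
      rw [qchar_neg_left D, qchar_comm D, qchar_simpleRoot D]
      push_cast
      rw [zpow_neg]
    · simp [hγβ]
  · change Matrix.toLin' _ ∘ₗ Matrix.toLin' _ - Matrix.toLin' _ ∘ₗ Matrix.toLin' _ = 0
    rw [← Matrix.toLin'_mul, ← Matrix.toLin'_mul, ← map_sub, map_eq_zero_iff _
      (LinearEquiv.injective _)]
    ext γ β
    have h := congrArg (fun x : ℝ => (x : ℂ)) (hm.comm_ne i j hij β γ)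
    simp only [Complex.ofReal_sum, Complex.ofReal_mul] at h
    simp only [Matrix.sub_apply, Matrix.mul_apply, Matrix.of_apply, Matrix.zero_apply, h, sub_self]

/-- The square length of the basis vector `x_β` for the invariant inner product on `model`. -/
def modelNorm (a : Matrix I I ℤ) (d : I → ℝ) (q : ℝ) (wt : S → Weight I) (β : S) : ℝ :=
  q ^ (weightForm a d (wt β) (wt β) / 2 - weightForm a d (fun _ => 1) (wt β))

-- As `(ρ, α_j) = d_j = (α_j, α_j) / 2`, raising `β` by `α_j` changes the exponent `(β, β) / 2 - (ρ,
-- β)` by exactly `(α_j, β)`. This is the factor `K_j` in `E_j* = K_j F_j`, as `F_j` is the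
-- transpose of `E_j`.
omit [Fintype S] [DecidableEq S] in
theorem IsModel.modelNorm_eq (D : IsDatum a d q) (h2 : ∀ j, a j j = 2)
    (hw : ∀ j β γ, m j β γ ≠ 0 → wt γ = wt β + simpleRoot a j.1) {j β γ} (h : m j β γ ≠ 0) :
    (modelNorm a d q wt γ : ℂ) =
      modelNorm a d q wt β * qchar a d q (simpleRoot a j.1) (wt β) := by
  rw [modelNorm, modelNorm, qchar, ← Complex.ofReal_mul, ← Real.rpow_add D.q_pos, hw j β γ h]
  congr 2
  simp only [weightForm_add_left, weightForm_add_right, D.form_comm (simpleRoot a j.1) (wt β)]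
  rw [D.form_simpleRoot (simpleRoot a j.1), D.form_simpleRoot fun _ => 1,
    show simpleRoot a j.1 j.1 = 2 from h2 j.1]
  push_cast
  ring

theorem IsModel.isInvariantInner (D : IsDatum a d q) (h2 : ∀ j, a j j = 2)
    (hm : IsModel a d q wt m) : (model a d q wt m).IsInvariantInner a
      (diagForm (Pi.basisFun ℂ S) (modelNorm a d q wt)) := by
  have hpos := isPosForm_diagForm (Pi.basisFun ℂ S) (m := modelNorm a d q wt)
    fun β => Real.rpow_pos_of_pos D.q_pos _
  refine ⟨hpos.1, hpos.2, fun l v w => ?_, fun j v w => ?_, fun j v w => ?_⟩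
  · simp only [diagForm_apply, model_K_apply, Pi.basisFun_repr, map_mul]
    refine Finset.sum_congr rfl fun β _ => ?_
    rw [qchar, Complex.conj_ofReal]
    ring
  · simp only [diagForm_apply, model_K_apply, model_E_apply, model_F_apply, Pi.basisFun_repr, map_sum, map_mul,
      Complex.conj_ofReal, Finset.mul_sum, Finset.sum_mul]
    rw [Finset.sum_comm]
    refine Finset.sum_congr rfl fun β _ => Finset.sum_congr rfl fun γ _ => ?_
    by_cases h0 : m j β γ = 0
    · simp [h0]
    · rw [IsModel.modelNorm_eq D h2 hm.weight h0]
      ring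
  · simp only [diagForm_apply, model_K_apply, model_E_apply, model_F_apply, Pi.basisFun_repr, map_sum, map_mul,
      Complex.conj_ofReal, Finset.mul_sum, Finset.sum_mul]
    rw [Finset.sum_comm]
    refine Finset.sum_congr rfl fun γ _ => Finset.sum_congr rfl fun β _ => ?_
    by_cases h0 : m j β γ = 0
    · simp [h0]
    · rw [IsModel.modelNorm_eq D h2 hm.weight h0, qchar_neg_left D]
      field_simp [qchar_ne_zero D (simpleRoot a j.1) (wt β)]

theorem model_single_mem (β : S) :
    Pi.single β 1 ∈ (model (t := t) a d q wt m).weightSpace a d q (wt β) := by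
  rw [mem_weightSpace]
  intro l
  ext γ
  by_cases h : γ = β
  · subst h
    simp [model, Matrix.mulVec_diagonal]
  · simp [model, Matrix.mulVec_diagonal, h]

theorem model_E_single {β : S} {j} (h : ∀ γ, m j β γ = 0) :
    (model a d q wt m).E j (Pi.single β 1) = 0 := by
  ext γ
  simp [model, h]

end GenAction

end

end QuantumNilradical

namespace QuantumNilradical

noncomputable section

/-! ### The representation on the root vectors of an abelian nilradical -/

section RootModel

variable {ι R M N : Type*} [CommRing R] [CharZero R] [IsDomain R] [AddCommGroup M] [Module R M]
  [AddCommGroup N] [Module R N] {P : RootPairing ι R M N} [P.IsCrystallographic]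

/-- The matrix entry of `E_j` between root vectors for `β` and `β + α_j`, where
`x = ⟨β, α_j^∨⟩` and `Q = q_j`. -/
def stepCoeff (Q : ℝ) (x : ℤ) : ℝ := if x = -1 then 1 else √(Q + Q⁻¹)

open scoped Classical in
/-- The matrix entries of the `E_j` in a basis of root vectors. -/
def rootStep (b : P.Base) (t : b.support) (d : b.support → ℝ) (q : ℝ) (Φ : Set ι)
    (j : {j : b.support // j ≠ t}) (β γ : Φ) : ℝ :=
  if P.root γ = P.root β + P.root j.1 then stepCoeff (qi d q j.1) (P.pairingIn ℤ β j.1) else 0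

variable {b : P.Base} {t : b.support} {d : b.support → ℝ} {q : ℝ} {Φ : Set ι}

omit [CharZero R] [IsDomain R] in
theorem rootStep_of_eq {j : {j : b.support // j ≠ t}} {β γ : Φ}
    (h : P.root γ = P.root β + P.root j.1) :
    rootStep b t d q Φ j β γ = stepCoeff (qi d q j.1) (P.pairingIn ℤ β j.1) := if_pos h

omit [CharZero R] [IsDomain R] in
theorem root_eq_of_rootStep_ne_zero {j : {j : b.support // j ≠ t}} {β γ : Φ}
    (h : rootStep b t d q Φ j β γ ≠ 0) : P.root γ = P.root β + P.root j.1 := by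
  by_contra h0
  exact h (if_neg h0)

variable [Fintype Φ]

-- A root is determined by its vector, so a two-step path has at most one intermediate root and the
-- sum has at most one term.
omit [CharZero R] [IsDomain R] in
theorem sum_rootStep_left {i j : {j : b.support // j ≠ t}} {β γ : Φ} :
    (∀ δ : Φ, P.root β = P.root δ + P.root j.1 → P.root γ = P.root δ + P.root i.1 →
      ∑ δ, rootStep b t d q Φ i δ γ * rootStep b t d q Φ j δ β =
        stepCoeff (qi d q i.1) (P.pairingIn ℤ δ i.1) *
          stepCoeff (qi d q j.1) (P.pairingIn ℤ δ j.1)) ∧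
    ((¬ ∃ δ ∈ Φ, P.root β = P.root δ + P.root j.1 ∧ P.root γ = P.root δ + P.root i.1) →
      ∑ δ, rootStep b t d q Φ i δ γ * rootStep b t d q Φ j δ β = 0) := by
  constructor
  · intro δ hj hi
    rw [Finset.sum_eq_single δ, rootStep_of_eq hi, rootStep_of_eq hj]
    · intro δ' _ hne
      by_contra h0
      refine hne (Subtype.ext (P.root.injective ?_))
      have := root_eq_of_rootStep_ne_zero (right_ne_zero_of_mul h0)
      rw [hj] at this
      exact (add_right_cancel this).symm
    · simp
  · intro h
    refine Finset.sum_eq_zero fun δ _ => ?_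
    by_contra h0
    exact h ⟨δ, δ.2, root_eq_of_rootStep_ne_zero (right_ne_zero_of_mul h0),
      root_eq_of_rootStep_ne_zero (left_ne_zero_of_mul h0)⟩

omit [CharZero R] [IsDomain R] in
theorem sum_rootStep_right {i j : {j : b.support // j ≠ t}} {β γ : Φ} :
    (∀ ε : Φ, P.root ε = P.root β + P.root i.1 → P.root ε = P.root γ + P.root j.1 →
      ∑ ε, rootStep b t d q Φ j γ ε * rootStep b t d q Φ i β ε =
        stepCoeff (qi d q j.1) (P.pairingIn ℤ γ j.1) *
          stepCoeff (qi d q i.1) (P.pairingIn ℤ β i.1)) ∧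
    ((¬ ∃ ε ∈ Φ, P.root ε = P.root β + P.root i.1 ∧ P.root ε = P.root γ + P.root j.1) →
      ∑ ε, rootStep b t d q Φ j γ ε * rootStep b t d q Φ i β ε = 0) := by
  constructor
  · intro ε hi hj
    rw [Finset.sum_eq_single ε, rootStep_of_eq hi, rootStep_of_eq hj]
    · intro ε' _ hne
      by_contra h0
      refine hne (Subtype.ext (P.root.injective ?_))
      rw [hi]
      exact root_eq_of_rootStep_ne_zero (right_ne_zero_of_mul h0)
    · simp
  · intro h
    refine Finset.sum_eq_zero fun ε _ => ?_
    by_contra h0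
    exact h ⟨ε, ε.2, root_eq_of_rootStep_ne_zero (right_ne_zero_of_mul h0),
      root_eq_of_rootStep_ne_zero (left_ne_zero_of_mul h0)⟩

theorem stepCoeff_mul_self {Q : ℝ} (hQ : 0 < Q) (x : ℤ) :
    stepCoeff Q x * stepCoeff Q x = if x = -1 then 1 else Q + Q⁻¹ := by
  unfold stepCoeff
  split_ifs
  · simp
  · exact Real.mul_self_sqrt (by positivity)

variable [Finite ι] [P.IsReduced]

/-- The coefficients realize `α_j`-strings with pairings `0`, or `-1, 1`, or `-2, 0, 2`, that is,
quantum `sl₂`-modules of dimension at most `3`; `Q + Q⁻¹` is the quantum integer `[2]`. Distinct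
`E_i` and `F_j` commute by comparing the two paths in a square of roots. -/
theorem IsAbelianRootSet.isModel [DecidableEq Φ] (A : IsAbelianRootSet b t Φ)
    (hd : ∀ i, 0 < d i) (hq : 1 < q)
    (hsymm : ∀ i j, d i * b.cartanMatrix.transpose i j = d j * b.cartanMatrix.transpose j i) :
    GenAction.IsModel b.cartanMatrix.transpose d q
      (fun (β : Φ) (i : b.support) => P.pairingIn ℤ β i) (rootStep b t d q Φ) := by
  have hQ : ∀ j, 1 < qi d q j := fun j => Real.one_lt_rpow hq (hd j)
  refine ⟨fun j β γ h => ?_, fun j β γ => ?_, fun i j hij β γ => ?_⟩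
  · funext i
    exact pairingIn_add (root_eq_of_rootStep_ne_zero h) i
  · by_cases hγβ : γ = β
    · subst hγβ
      simp only [if_true]
      set Q := qi d q j.1 with hQdef
      have hQ1 := hQ j.1
      rw [← hQdef] at hQ1
      have hQ0 : 0 < Q := by linarith
      set x := P.pairingIn ℤ γ j.1 with hx
      have hL : (∃ δ ∈ Φ, P.root γ = P.root δ + P.root j.1) →
          ∑ δ, rootStep b t d q Φ j δ γ * rootStep b t d q Φ j δ γ =
            if x - 2 = -1 then 1 else Q + Q⁻¹ := by
        rintro ⟨δ, hδ, h⟩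
        have h1 := (A.pairingIn_of_add j.2 hδ γ.2 h).2.2
        rw [sum_rootStep_left.1 ⟨δ, hδ⟩ h h, stepCoeff_mul_self hQ0,
          show x - 2 = P.pairingIn ℤ δ j.1 by omega]
      have hL' : (¬ ∃ δ ∈ Φ, P.root γ = P.root δ + P.root j.1) →
          ∑ δ, rootStep b t d q Φ j δ γ * rootStep b t d q Φ j δ γ = 0 :=
        fun h => sum_rootStep_left.2 fun ⟨δ, hδ, h', _⟩ => h ⟨δ, hδ, h'⟩
      have hR : (∃ ε ∈ Φ, P.root ε = P.root γ + P.root j.1) →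
          ∑ ε, rootStep b t d q Φ j γ ε * rootStep b t d q Φ j γ ε =
            if x = -1 then 1 else Q + Q⁻¹ := by
        rintro ⟨ε, hε, h⟩
        rw [sum_rootStep_right.1 ⟨ε, hε⟩ h h, stepCoeff_mul_self hQ0]
      have hR' : (¬ ∃ ε ∈ Φ, P.root ε = P.root γ + P.root j.1) →
          ∑ ε, rootStep b t d q Φ j γ ε * rootStep b t d q Φ j γ ε = 0 :=
        fun h => sum_rootStep_right.2 fun ⟨ε, hε, h', _⟩ => h ⟨ε, hε, h'⟩
      have hadd : (∃ ε ∈ Φ, P.root ε = P.root γ + P.root j.1) → x ≤ 0 :=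
        fun ⟨ε, hε, h⟩ => (A.pairingIn_of_add j.2 γ.2 hε h).2.1
      have hsub : (∃ δ ∈ Φ, P.root γ = P.root δ + P.root j.1) → 0 ≤ x := by
        rintro ⟨δ, hδ, h⟩
        have h1 := A.pairingIn_of_add j.2 hδ γ.2 h
        omega
      have hadd' := A.exists_add j.2 γ.2
      have hsub' := A.exists_sub j.2 γ.2
      have hiff := A.exists_add_iff_exists_sub j.2 (β := γ)
      obtain ⟨hx1, hx2⟩ := A.abs_pairingIn_le j.2 γ.2
      rw [← hx] at hadd' hsub' hiff hx1 hx2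
      have hne : Q - Q⁻¹ ≠ 0 := sub_ne_zero.2 ((inv_lt_one_of_one_lt₀ hQ1).trans hQ1).ne'
      clear_value x
      -- The diagonal entry of `[E_j, F_j]` must be the quantum integer `[x]`. For `x ≠ 0` the
      -- string continues in one direction only; for `x = 0` it continues in both or in neither, and
      -- the two contributions cancel.
      obtain rfl | rfl | rfl | rfl | rfl : x = -2 ∨ x = -1 ∨ x = 0 ∨ x = 1 ∨ x = 2 := by omega
      · rw [hL' fun h => by simpa using hsub h, hR (hadd' (by norm_num)), eq_inv_mul_iff_mul_eq₀ hne]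
        norm_num
        field_simp
        ring
      · rw [hL' fun h => by simpa using hsub h, hR (hadd' (by norm_num)), eq_inv_mul_iff_mul_eq₀ hne]
        norm_num
      · by_cases hex : ∃ ε ∈ Φ, P.root ε = P.root γ + P.root j.1
        · rw [hL ((hiff rfl).1 hex), hR hex]
          norm_num
        · rw [hL' (mt (hiff rfl).2 hex), hR' hex]
          norm_num
      · rw [hL (hsub' (by norm_num)), hR' fun h => by simpa using hadd h, eq_inv_mul_iff_mul_eq₀ hne]
        norm_num
      · rw [hL (hsub' (by norm_num)), hR' fun h => by simpa using hadd h, eq_inv_mul_iff_mul_eq₀ hne]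
        norm_num
        field_simp
        ring
    · rw [if_neg hγβ, sum_rootStep_left.2, sum_rootStep_right.2, sub_zero]
      · rintro ⟨ε, -, h, h'⟩
        exact hγβ (Subtype.ext (P.root.injective (add_right_cancel (h'.symm.trans h))))
      · rintro ⟨δ, -, h, h'⟩
        exact hγβ (Subtype.ext (P.root.injective (h'.trans h.symm)))
  · have hij' : i.1 ≠ j.1 := fun h => hij (Subtype.ext h)
    by_cases hsq : P.root γ + P.root j.1 = P.root β + P.root i.1
    · have hiff := A.exists_sub_iff_exists_add i.2 j.2 hij' β.2 hsq
      by_cases hex : ∃ δ ∈ Φ, P.root β = P.root δ + P.root j.1 ∧ P.root γ = P.root δ + P.root i.1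
      · obtain ⟨ε, hε, hε1, hε2⟩ := hiff.1 hex
        obtain ⟨δ, hδ, hδ1, hδ2⟩ := hex
        rw [sum_rootStep_left.1 ⟨δ, hδ⟩ hδ1 hδ2, sum_rootStep_right.1 ⟨ε, hε⟩ hε1 hε2]
        rcases A.pairingIn_parallelogram i.2 j.2 hij' hδ β.2 γ.2 hε hδ1 hδ2 hε1 hε2 with
          ⟨h1, h2⟩ | ⟨h1, h2, h3⟩
        · rw [h1, h2, mul_comm]
        · have hdij : d i.1 = d j.1 := by
            have := hsymm i.1 j.1
            have e1 : b.cartanMatrix.transpose i.1 j.1 = -1 := h2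
            have e2 : b.cartanMatrix.transpose j.1 i.1 = -1 := h1
            rw [e1, e2] at this
            push_cast at this
            linarith
          have hQij : qi d q i.1 = qi d q j.1 := by rw [qi, qi, hdij]
          -- Here `q_i = q_j`, and both products are `1` times `√[2]`, in opposite order.
          rcases h3 with ⟨h3, h4, h5, h6⟩ | ⟨h3, h4, h5, h6⟩
          · simp only [h3, h4, h5, h6, hQij, stepCoeff]
            norm_num
          · simp only [h3, h4, h5, h6, hQij, stepCoeff]
            norm_num
      · rw [sum_rootStep_left.2 hex, sum_rootStep_right.2 (mt hiff.2 hex)]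
    · rw [sum_rootStep_left.2, sum_rootStep_right.2]
      · rintro ⟨ε, -, h, h'⟩
        exact hsq (h'.symm.trans h)
      · rintro ⟨δ, -, h, h'⟩
        exact hsq (by rw [h, h']; abel)

theorem IsAbelianRootSet.exists_isInvariantInner (A : IsAbelianRootSet b t Φ)
    {a : Matrix b.support b.support ℤ} (ha : a = b.cartanMatrix.transpose) (D : IsDatum a d q)
    (hsymm : ∀ i j, d i * a i j = d j * a j i) {V : Type*} [AddCommGroup V] [Module ℂ V]
    {X : GenAction t V} (hX : X.IsRep a d q) (hirr : X.IsIrr) {α : ι} (hα : α ∈ Φ)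
    (hmax : ∀ j : b.support, j ≠ t → ∀ β ∈ Φ, P.root β ≠ P.root α + P.root j.1) {v : V}
    (hv0 : v ≠ 0) (hv : v ∈ X.weightSpace a d q fun i => P.pairingIn ℤ α i)
    (hE : ∀ j, X.E j v = 0) : ∃ h : V →ₗ⋆[ℂ] V →ₗ[ℂ] ℂ, X.IsInvariantInner a h := by
  classical
  subst ha
  have hm := A.isModel D.d_pos D.one_lt hsymm
  have hY := hm.isRep D
  have hh := hm.isInvariantInner D fun j => b.cartanMatrix_apply_same j
  have hw := GenAction.model_single_mem (t := t) (a := b.cartanMatrix.transpose) (d := d) (q := q)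
    (wt := fun (β : Φ) (i : b.support) => P.pairingIn ℤ β i) (m := rootStep b t d q Φ) ⟨α, hα⟩
  have hw0 : (Pi.single (⟨α, hα⟩ : Φ) 1 : Φ → ℂ) ≠ 0 := by simp
  have hE' : ∀ j, (GenAction.model b.cartanMatrix.transpose d q
      (fun (β : Φ) (i : b.support) => P.pairingIn ℤ β i) (rootStep b t d q Φ)).E j
        (Pi.single (⟨α, hα⟩ : Φ) 1) = 0 := fun j => GenAction.model_E_single fun γ => by
    by_contra h0
    exact hmax j.1 j.2 γ γ.2 (root_eq_of_rootStep_ne_zero h0)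
  exact hX.exists_isInvariantInner D hirr hY hh hv hv0 hE hw hw0 hE'

end RootModel

end

end QuantumNilradical

/-! ### The weight form and the roots of a cominuscule nilradical. -/

namespace QuantumNilradical

noncomputable section

/-! ### The weight form of a symmetrizable matrix -/

section Datum

variable {I : Type*} [Fintype I] {a : Matrix I I ℤ} {d : I → ℝ} {q : ℝ}

-- With `D` diagonal and `A` the matrix, symmetry of `D A` gives symmetry of `D A⁻¹`, the matrix of
-- the form in fundamental weights.
open scoped Classical in
theorem isDatum_of_symm (hdet : (a.map (Int.cast : ℤ → ℝ)).det ≠ 0) (hd : ∀ i, 0 < d i)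
    (hsymm : ∀ i j, d i * a i j = d j * a j i) (hq : 1 < q) : IsDatum a d q := by
  set A := a.map (Int.cast : ℤ → ℝ) with hA
  have hunit : IsUnit A.det := hdet.isUnit
  have h1 : A⁻¹ * A = 1 := Matrix.nonsing_inv_mul A hunit
  have h2 : A * A⁻¹ = 1 := Matrix.mul_nonsing_inv A hunit
  have hDA : Matrix.diagonal d * A = A.transpose * Matrix.diagonal d := by
    ext i j
    rw [Matrix.diagonal_mul, Matrix.mul_diagonal, Matrix.transpose_apply, hA, Matrix.map_apply,
      Matrix.map_apply, hsymm, mul_comm]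
  have hDinv : Matrix.diagonal d * A⁻¹ = A⁻¹.transpose * Matrix.diagonal d := by
    have h3 : A⁻¹.transpose * A.transpose = 1 := by
      rw [← Matrix.transpose_mul, h2, Matrix.transpose_one]
    calc Matrix.diagonal d * A⁻¹ = (A⁻¹.transpose * A.transpose) * Matrix.diagonal d * A⁻¹ := by
          rw [h3, one_mul]
      _ = A⁻¹.transpose * (Matrix.diagonal d * A) * A⁻¹ := by rw [hDA]; simp only [mul_assoc]
      _ = A⁻¹.transpose * Matrix.diagonal d := by simp only [mul_assoc, h2, mul_one]
  have hinv : ∀ i j, d i * A⁻¹ i j = d j * A⁻¹ j i := fun i j => by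
    have := congrFun (congrFun hDinv i) j
    rwa [Matrix.diagonal_mul, Matrix.mul_diagonal, Matrix.transpose_apply, mul_comm _ (d j)] at this
  refine ⟨fun l j => ?_, fun μ ν => ?_, hd, hq⟩
  · have h3 : ∀ i, ∑ k, A⁻¹ i k * (a k j : ℝ) = (1 : Matrix I I ℝ) i j := fun i => by
      rw [← h1, Matrix.mul_apply]; rfl
    calc weightForm a d l (simpleRoot a j) = ∑ i, d i * l i * ∑ k, A⁻¹ i k * (a k j : ℝ) := by
          simp only [weightForm, simpleRoot, Finset.mul_sum]
          exact Finset.sum_congr rfl fun i _ => Finset.sum_congr rfl fun k _ => by ring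
      _ = d j * l j := by
          simp only [h3, Matrix.one_apply]
          simp
  · rw [weightForm, weightForm, Finset.sum_comm]
    refine Finset.sum_congr rfl fun i _ => Finset.sum_congr rfl fun j _ => ?_
    rw [hinv j i]
    ring

end Datum

section Parabolic

open LieAlgebra LieAlgebra.IsKilling

variable {𝔤 : Type*} [LieRing 𝔤] [LieAlgebra ℂ 𝔤] [FiniteDimensional ℂ 𝔤] [IsSimple ℂ 𝔤]
  {H : LieSubalgebra ℂ 𝔤} [H.IsCartanSubalgebra] (b : (rootSystem H).Base)

theorem isDatum_cartan {d : b.support → ℝ} (hd : ∀ i, 0 < d i)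
    (hsymm : ∀ i j, d i * cartan b i j = d j * cartan b j i) {q : ℝ} (hq : 1 < q) :
    IsDatum (cartan b) d q := by
  classical
  refine isDatum_of_symm ?_ hd hsymm hq
  have h := Matrix.nondegenerate_iff_det_ne_zero.1 b.cartanMatrix_nondegenerate
  have h1 : ((cartan b).map (Int.cast : ℤ → ℝ)).det = ((b.cartanMatrix.det : ℤ) : ℝ) := by
    rw [cartan, ← Matrix.det_transpose b.cartanMatrix]
    exact ((Int.castRingHom ℝ).map_det _).symm
  have h2 : ((b.cartanMatrix.det : ℤ) : ℝ) ≠ 0 := Int.cast_ne_zero.2 h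
  rw [← h1] at h2
  convert h2

/-! ### The roots of the nilradical -/

variable {b} {t : b.support}

theorem coord_root_of_ne {j : b.support} (hj : j ≠ t) :
    b.toWeightBasis.coord t ((rootSystem H).root j) = 0 := by
  rw [Module.Basis.coord_apply, RootPairing.Base.toWeightBasis_repr_root,
    Finsupp.single_eq_of_ne hj.symm]

theorem exists_coord_root (α : H.root) : ∃ f : H.root → ℤ, (0 < f ∨ f < 0) ∧
    b.height α = ∑ j ∈ b.support, f j ∧
    (rootSystem H).root α = ∑ j ∈ b.support, f j • (rootSystem H).root j ∧
    b.toWeightBasis.coord t ((rootSystem H).root α) = f t := by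
  obtain ⟨f, -, hf, hα⟩ := b.exists_root_eq_sum_int α
  refine ⟨f, hf, RootPairing.Base.height_eq_sum hα, hα, ?_⟩
  rw [hα, map_sum, Finset.sum_eq_single t.1]
  · simp only [map_zsmul, Module.Basis.coord_apply, RootPairing.Base.toWeightBasis_repr_root]
    simp
  · intro j hj hjt
    rw [map_zsmul, coord_root_of_ne (j := ⟨j, hj⟩) (fun h => hjt (congrArg Subtype.val h)),
      smul_zero]
  · exact fun h => absurd t.2 h

/-- Membership depends only on the coefficient of `α_t`: all coefficients of a root have the same
sign, and a positive one at `α_t` settles both positivity and independence from the other simple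
roots. -/
theorem mem_radicalRoots_iff {α : H.root} : α ∈ radicalRoots b t ↔
    ∃ n : ℕ, 0 < n ∧ b.toWeightBasis.coord t ((rootSystem H).root α) = n := by
  obtain ⟨f, hf, hheight, hα, hcoord⟩ := exists_coord_root (t := t) α
  constructor
  · rintro ⟨hpos, hspan⟩
    have hf' : 0 ≤ f := by
      rcases hf with h | h
      · exact h.le
      · rw [RootPairing.Base.isPos_iff, hheight] at hpos
        exact absurd hpos (not_lt.2 (Finset.sum_nonpos fun i _ => h.le i))
    obtain ⟨n, hn⟩ := Int.eq_ofNat_of_zero_le (hf' t)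
    refine ⟨n, Nat.pos_of_ne_zero ?_, by rw [hcoord, hn]; simp⟩
    rintro rfl
    refine hspan ?_
    rw [hα]
    refine Submodule.sum_mem _ fun j hj => ?_
    by_cases hjt : j = t.1
    · rw [hjt, hn]
      simp
    · have hmem : (rootSystem H).root j ∈ Submodule.span ℂ
          ((rootSystem H).root '' {j | j ∈ b.support ∧ j ≠ t.1}) :=
        Submodule.subset_span ⟨j, ⟨hj, hjt⟩, rfl⟩
      exact zsmul_mem hmem _
  · rintro ⟨n, hn, hcn⟩
    have hft : f t = n := by
      rw [hcoord] at hcn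
      exact_mod_cast hcn
    refine ⟨?_, fun hspan => ?_⟩
    · rw [RootPairing.Base.isPos_iff', hheight]
      rcases hf with h | h
      · exact Finset.sum_nonneg fun i _ => h.le i
      · have := h.le t
        simp only [Pi.zero_apply] at this
        omega
    · have : b.toWeightBasis.coord t ((rootSystem H).root α) = 0 := by
        suffices h : Submodule.span ℂ ((rootSystem H).root '' {j | j ∈ b.support ∧ j ≠ t.1}) ≤
          LinearMap.ker (b.toWeightBasis.coord t) from h hspan
        refine Submodule.span_le.2 ?_
        rintro _ ⟨j, ⟨hj, hjt⟩, rfl⟩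
        exact coord_root_of_ne (j := ⟨j, hj⟩) (fun h => hjt (congrArg Subtype.val h))
      rw [hcn] at this
      exact hn.ne' (by exact_mod_cast this)

theorem root_reflectionPerm_self (α : H.root) :
    (rootSystem H).root ((rootSystem H).reflectionPerm α α) = -(rootSystem H).root α := by
  rw [RootPairing.root_reflectionPerm, RootPairing.reflection_apply_self]

theorem mem_negRadicalRoots_iff {α : H.root} : α ∈ negRadicalRoots b t ↔
    (rootSystem H).reflectionPerm α α ∈ radicalRoots b t := by
  constructor
  · rintro ⟨β, hβ, h⟩
    convert hβ
    apply (rootSystem H).root.injective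
    rw [root_reflectionPerm_self, h, neg_neg]
  · exact fun h => ⟨_, h, by rw [root_reflectionPerm_self, neg_neg]⟩

theorem mem_nilradical {α : H.root} (hα : α ∈ radicalRoots b t) {x : 𝔤}
    (hx : x ∈ rootSpace H (α.1 : H → ℂ)) : x ∈ nilradical b t :=
  Submodule.mem_iSup_of_mem α (Submodule.mem_iSup_of_mem hα hx)

/-- Take an `sl₂`-triple `e, h', f` for `α` and a nonzero root vector `z` for `γ`. Then `[e, z]` and
`[e, [f, z]]` are brackets inside the abelian nilradical, so `[h', z] = [[e, f], z] = 0`. -/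
theorem IsCominuscule.pairing_eq_zero (ht : IsCominuscule b t) {α β γ : H.root}
    (hα : α ∈ radicalRoots b t) (hβ : β ∈ radicalRoots b t) (hγ : γ ∈ radicalRoots b t)
    (h : (rootSystem H).root γ = (rootSystem H).root α + (rootSystem H).root β) :
    (rootSystem H).pairing γ α = 0 := by
  have hα0 : α.1.IsNonZero := LieSubalgebra.isNonZero_coe_root α
  obtain ⟨h', e, f, htr, he, hf⟩ := exists_isSl2Triple_of_weight_isNonZero hα0
  obtain ⟨z, hz, hz0⟩ := γ.1.exists_ne_zero
  have hez : ⁅e, z⁆ = 0 := ht e (mem_nilradical hα he) z (mem_nilradical hγ hz)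
  have hfz : ⁅f, z⁆ ∈ rootSpace H (β.1 : H → ℂ) := by
    have h1 := lie_mem_genWeightSpace_of_mem_genWeightSpace hf hz
    have h2 : -(α.1 : H → ℂ) + (γ.1 : H → ℂ) = β.1 := by
      funext x
      have := LinearMap.congr_fun h x
      simp only [rootSystem_root_apply, LinearMap.add_apply] at this
      change -(α.1 x) + γ.1 x = β.1 x
      have h3 : γ.1 x = α.1 x + β.1 x := this
      rw [h3]
      ring
    rwa [h2] at h1
  have hefz : ⁅e, ⁅f, z⁆⁆ = 0 := ht e (mem_nilradical hα he) _ (mem_nilradical hβ hfz)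
  have hhz : ⁅h', z⁆ = 0 := by
    rw [← htr.lie_e_f, lie_lie, hefz, hez, lie_zero, sub_zero]
  rw [htr.h_eq_coroot hα0 he hf] at hhz
  have h4 := lie_eq_smul_of_mem_rootSpace hz (coroot α.1)
  have h5 : ⁅coroot α.1, z⁆ = 0 := hhz
  rw [h5] at h4
  exact (smul_eq_zero.1 h4.symm).resolve_right hz0

/-- If the sum `γ` were a root, then `⟨γ, α^∨⟩ = ⟨γ, β^∨⟩ = 0` would give `⟨β, α^∨⟩ = ⟨α, β^∨⟩ =
-2`, which is impossible for `α ≠ -β`. -/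
theorem IsCominuscule.add_notMem (ht : IsCominuscule b t) {α β : H.root}
    (hα : α ∈ radicalRoots b t) (hβ : β ∈ radicalRoots b t) :
    (rootSystem H).root α + (rootSystem H).root β ∉ Set.range (rootSystem H).root := by
  rintro ⟨γ, h⟩
  have hγ : γ ∈ radicalRoots b t := by
    rw [mem_radicalRoots_iff] at hα hβ ⊢
    obtain ⟨n, hn, hn'⟩ := hα
    obtain ⟨m, hm, hm'⟩ := hβ
    exact ⟨n + m, by omega, by rw [h, map_add, hn', hm']; push_cast; rfl⟩
  have hcast := fun k l => (rootSystem H).algebraMap_pairingIn ℤ k l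
  simp only [eq_intCast] at hcast
  have h1 := ht.pairing_eq_zero hα hβ hγ h
  have h2 := ht.pairing_eq_zero hβ hα hγ (by rw [h, add_comm])
  rw [← hcast, Int.cast_eq_zero, pairingIn_add h, RootPairing.pairingIn_same] at h1 h2
  have hne : (rootSystem H).root α ≠ (rootSystem H).root β := fun h0 => by
    have := (rootSystem H).root.injective h0
    subst this
    rw [RootPairing.pairingIn_same] at h1
    omega
  have hne' : (rootSystem H).root α ≠ -(rootSystem H).root β := fun h0 => by
    rw [h0, neg_add_cancel] at h
    exact (rootSystem H).ne_zero γ h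
  have h3 := (rootSystem H).pairingIn_pairingIn_mem_set_of_isCrystal_of_isRed' α β hne hne'
  simp only [Set.mem_insert_iff, Set.mem_singleton_iff, Prod.mk.injEq] at h3
  omega

theorem IsCominuscule.isAbelianRootSet (ht : IsCominuscule b t) :
    IsAbelianRootSet b t (radicalRoots b t) := by
  refine ⟨fun j hj β hβ γ z h => ?_, fun j hj β hβ => ?_, fun α hα β hβ => ht.add_notMem hα hβ⟩
  · rw [mem_radicalRoots_iff] at hβ ⊢
    rwa [h, map_add, map_zsmul, coord_root_of_ne hj, smul_zero, add_zero]
  · rw [mem_radicalRoots_iff] at hβ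
    obtain ⟨n, hn, hn'⟩ := hβ
    have hn0 : (n : ℂ) ≠ 0 := by exact_mod_cast hn.ne'
    constructor <;> intro h <;> rw [h] at hn'
    · rw [coord_root_of_ne hj] at hn'
      exact hn0 hn'.symm
    · rw [map_neg, coord_root_of_ne hj, neg_zero] at hn'
      exact hn0 hn'.symm

theorem IsCominuscule.isAbelianRootSet_neg (ht : IsCominuscule b t) :
    IsAbelianRootSet b t (negRadicalRoots b t) := by
  have A := ht.isAbelianRootSet
  refine ⟨fun j hj β hβ γ z h => ?_, fun j hj β hβ => ?_, fun α hα β hβ => ?_⟩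
  · rw [mem_negRadicalRoots_iff] at hβ ⊢
    refine A.closed j hj _ hβ _ (-z) ?_
    rw [root_reflectionPerm_self, root_reflectionPerm_self, h, neg_add, neg_smul]
  · rw [mem_negRadicalRoots_iff] at hβ
    have h := A.ne j hj _ hβ
    rw [root_reflectionPerm_self] at h
    exact ⟨fun h' => h.2 (by rw [h']), fun h' => h.1 (by rw [h', neg_neg])⟩
  · rw [mem_negRadicalRoots_iff] at hα hβ
    rintro ⟨γ, h⟩
    refine A.add_notMem _ hα _ hβ ⟨(rootSystem H).reflectionPerm γ γ, ?_⟩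
    simp only [root_reflectionPerm_self, h, neg_add]

end Parabolic

end

end QuantumNilradical

namespace QuantumNilradical

noncomputable section

section Parabolic

open LieAlgebra LieAlgebra.IsKilling

variable {𝔤 : Type*} [LieRing 𝔤] [LieAlgebra ℂ 𝔤] [FiniteDimensional ℂ 𝔤] [IsSimple ℂ 𝔤]
  {H : LieSubalgebra ℂ 𝔤} [H.IsCartanSubalgebra] {b : (rootSystem H).Base} {t : b.support}

/-! ### The commutor of a quantized nilradical -/

/-- Existence is what is proved here; once a commutor exists, the chosen `moduleCommutor` is one and
its default value does not occur. -/
theorem IsQuantization.isCommutor {d : b.support → ℝ} (hd : ∀ i, 0 < d i)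
    (hsymm : ∀ i j, d i * cartan b i j = d j * cartan b j i) {q : ℝ} (hq : 1 < q)
    {Φ : Set H.root} (A : IsAbelianRootSet b t Φ) {V : Type*} [AddCommGroup V] [Module ℂ V]
    [Module (UqLevi (cartan b) d q t) V] [IsScalarTower ℂ (UqLevi (cartan b) d q t) V]
    (hV : IsQuantization b d q t Φ V) :
    (⨆ ν, (genAction (cartan b) d q t V).weightSpace (cartan b) d q ν = ⊤) ∧
    (genAction (cartan b) d q t V).IsCommutor (cartan b) d q
      (moduleCommutor (cartan b) d q t V) := by
  classical
  obtain ⟨hfin, hsimple, α, ⟨hα, hmax⟩, v, hv0, hv, hE⟩ := hV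
  have D := isDatum_cartan b hd hsymm hq
  have hX := genAction_isRep (t := t) (V := V) D
  have hirr := genAction_isIrr (a := cartan b) (d := d) (q := q) (t := t) (V := V)
  have hspan := hX.iSup_weightSpace_eq_top D hirr hv hv0
  refine ⟨hspan, ?_⟩
  have := Fintype.ofFinite Φ
  obtain ⟨h, hh⟩ := A.exists_isInvariantInner rfl D hsymm hX hirr hα hmax hv0 hv hE
  have hex := GenAction.exists_isCommutor D hX hirr hspan hh hv hv0 hE
  rw [moduleCommutor, GenAction.commutor, dif_pos hex]
  exact hex.choose_spec

end Parabolic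

end

end QuantumNilradical

open QuantumNilradical in
theorem mainTheorem7 {𝔤 : Type*} [LieRing 𝔤] [LieAlgebra ℂ 𝔤] [FiniteDimensional ℂ 𝔤]
    [LieAlgebra.IsSimple ℂ 𝔤] (H : LieSubalgebra ℂ 𝔤) [H.IsCartanSubalgebra]
    (b : (LieAlgebra.IsKilling.rootSystem H).Base) (t : b.support) (ht : IsCominuscule b t)
    (d : b.support → ℝ) (hd : ∀ i, 0 < d i)
    (hsymm : ∀ i j, d i * cartan b i j = d j * cartan b j i)
    (q : ℝ) (hq : 1 < q)
    (Up : Type*) [AddCommGroup Up] [Module ℂ Up] [Module (UqLevi (cartan b) d q t) Up]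
    [IsScalarTower ℂ (UqLevi (cartan b) d q t) Up]
    (Um : Type*) [AddCommGroup Um] [Module ℂ Um] [Module (UqLevi (cartan b) d q t) Um]
    [IsScalarTower ℂ (UqLevi (cartan b) d q t) Um]
    (hUp : IsQuantization b d q t (radicalRoots b t) Up)
    (hUm : IsQuantization b d q t (negRadicalRoots b t) Um)
    (B : Um →ₗ[ℂ] Up →ₗ[ℂ] ℂ) (hB : B.Nondegenerate)
    (hBinv : GenAction.IsInvariantPairing (cartan b) (genAction (cartan b) d q t Um)
      (genAction (cartan b) d q t Up) B)
    (n : ℕ) :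
    ∃ (Ym : GenAction t (QExtPow (moduleCommutor (cartan b) d q t Um) n))
      (Yp : GenAction t (QExtPow (moduleCommutor (cartan b) d q t Up) n))
      (hm : Function.Bijective (antisymToExt (moduleCommutor (cartan b) d q t Um) n))
      (hp : Function.Bijective (antisymToExt (moduleCommutor (cartan b) d q t Up) n)),
      GenAction.IsHom ((genAction (cartan b) d q t Um).tensorPower (cartan b) n) Ym
        (tensorToExt (moduleCommutor (cartan b) d q t Um) n) ∧
      GenAction.IsHom ((genAction (cartan b) d q t Up).tensorPower (cartan b) n) Yp
        (tensorToExt (moduleCommutor (cartan b) d q t Up) n) ∧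
      (extPairing B _ _ n hm hp).Nondegenerate ∧
      GenAction.IsInvariantPairing (cartan b) Ym Yp (extPairing B _ _ n hm hp) ∧
      ∃ Φ : QExtPow (moduleCommutor (cartan b) d q t Um) n ≃ₗ[ℂ]
          Module.Dual ℂ (QExtPow (moduleCommutor (cartan b) d q t Up) n),
        (∀ y x, Φ y x = extPairing B _ _ n hm hp y x) ∧
        GenAction.IsHom Ym (Yp.dual (cartan b)) Φ.toLinearMap := by
  have D := isDatum_cartan b hd hsymm hq
  have hp := hUp.isCommutor hd hsymm hq ht.isAbelianRootSet
  have hm := hUm.isCommutor hd hsymm hq ht.isAbelianRootSet_neg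
  have := hUp.1
  have := hUm.1
  have := hUp.2.1
  have := hUm.2.1
  exact GenAction.exists_extPairing_of_isCommutor D (genAction_isRep D) genAction_isIrr hp.1
    (genAction_isRep D) genAction_isIrr hm.1 hB hBinv hp.2 hm.2 n
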